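/- Let $k$ be an algebraically closed field of characteristic zero, let $Z$ be a smooth projective surface over $k$, and let $C\subset Z$ be a closed curve with $C\cong\mathbb{P}^1$ and $C^2=-d$ for an integer $d>0$. Let $2C\subset Z$ be the closed subscheme with ideal sheaf $\mathcal{I}_C^2$. For a $k$-scheme $T$ consider the surjective morphisms of $\mathcal{O}_{Z\times T}$-modules $\mathcal{O}_{Z\times T}^2\to\mathcal{O}_{2C\times T}$ up to automorphisms of the $\mathcal{O}_{Z\times T}$-module $\mathcal{O}_{2C\times T}$. For a locally free sheaf $\mathcal{E}$ on $\mathbb{P}^1$ write $\mathbb{V}(\mathcal{E})=\operatorname{Spec}_{\mathbb{P}^1}\operatorname{Sym}(\mathcal{E})$ for its total space. Then the surjections $\mathcal{O}_Z^2\to\mathcal{O}_{2C}$ are parametrised by the total space $$E=\mathbb{V}\bigl(\mathcal{O}_{\mathbb{P}^1}(-2)^{\oplus(d+1)}\bigr),$$ that is, by the $\mathbb{A}^{d+1}$-bundle over $\mathbb{P}^1$ glued from two copies of $\mathbb{A}^1\times\mathbb{A}^{d+1}$ by $(t,b_0,\dots,b_d)\mapsto(t^{-1},t^{-2}b_0,\dots,t^{-2}b_d)$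 over $t\neq0$. Here "parametrised" means that $E$ is a fine moduli space: $E$ represents the Zariski sheaf on $k$-schemes associated with $$T\longmapsto\{\text{surjections }\mathcal{O}_{Z\times T}^2\to\mathcal{O}_{2C\times T}\}/\operatorname{Aut}(\mathcal{O}_{2C\times T}).$$ In particular, the $k$-points of $E$ are in bijection with the surjections $\mathcal{O}_Z^2\to\mathcal{O}_{2C}$ up to automorphisms of $\mathcal{O}_{2C}$. Equivalently, these surjections are parametrised, in the same sense, by the smooth locus of the quadric $V(xz+y^2)\subset\mathbb{P}^{d+3}$, where $(x:y:z:u_0:\dots:u_d)$ are homogeneous coordinates on $\mathbb{P}^{d+3}$: this smooth locus is isomorphic to $E$ over $k$. -/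

import Mathlib

open CategoryTheory CategoryTheory.Limits AlgebraicGeometry

universe u

noncomputable section

attribute [local instance] MvPolynomial.gradedAlgebra

/-! ## Projective space, smooth projective surfaces -/

/-- Projective `n`-space `ℙⁿ = Proj k[x₀, …, xₙ]` over `k`. -/
def ProjSp (k : Type u) [Field k] (n : ℕ) : Scheme.{u} :=
  Proj (MvPolynomial.homogeneousSubmodule (Fin (n + 1)) k)

/-- The structure morphism `ℙⁿ ⟶ Spec k`. -/
def projSpStr (k : Type u) [Field k] (n : ℕ) : ProjSp k n ⟶ Spec (.of k) :=
  Proj.toSpecZero (MvPolynomial.homogeneousSubmodule (Fin (n + 1)) k) ≫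
    Spec.map (CommRingCat.ofHom
      (algebraMap k (MvPolynomial.homogeneousSubmodule (Fin (n + 1)) k 0)))

/-- `p : Z ⟶ Spec k` is a smooth projective surface (an integral scheme, smooth of relative
dimension two over `k`, and a closed subscheme of some `ℙⁿ` over `k`). -/
structure IsSmoothProjectiveSurface {k : Type u} [Field k] {Z : Scheme.{u}}
    (p : Z ⟶ Spec (.of k)) : Prop where
  isIntegral : IsIntegral Z
  smooth : SmoothOfRelativeDimension 2 p
  projective : ∃ (n : ℕ) (ι : Z ⟶ ProjSp k n), IsClosedImmersion ι ∧ ι ≫ projSpStr k n = p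

/-! ## Self-intersection of a curve -/

/-- Let `i : C ⟶ Z` be the inclusion of an integral closed curve which is a Cartier divisor with
ideal sheaf `I = 𝒪_Z(-C)`. `IsConormalDegree i n` says that the line bundle
`𝒪_Z(-C)|_C = I/I²` on `C` has degree `n`, computed as the degree of the divisor of a rational
section: `f` is a generator of `I` at the generic point of `C`, i.e. a nonzero rational section of
`I/I²`; at a point `x` of `C` the ideal `I` has a generator `g`, with `f = w * g` for a `w` that is
regular at the generic point of `C`; the order of the section at `x` is the order of vanishing
`m x` at `x` of the rational function `w|_C` on `C`. (The points of order `≠ 0` are closed points;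
over an algebraically closed field they have degree one.) -/
def IsConormalDegree {C Z : Scheme.{u}} [IsIntegral C] [IsLocallyNoetherian C] (i : C ⟶ Z)
    (n : ℤ) : Prop :=
  ∃ (f : Z.presheaf.stalk (i (genericPoint C))) (m : C → ℤ),
    RingHom.ker (i.stalkMap (genericPoint C)).hom = Ideal.span {f} ∧
    (∀ x : C, ∃ (g : Z.presheaf.stalk (i x)) (w : Z.presheaf.stalk (i (genericPoint C))),
      RingHom.ker (i.stalkMap x).hom = Ideal.span {g} ∧
      f = w * (Z.presheaf.stalkSpecializes
        (((genericPoint_spec C).specializes (Set.mem_univ x)).map i.continuous)).hom g ∧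
      m x = Scheme.ord ((i.stalkMap (genericPoint C)).hom w : C.functionField) x) ∧
    m.support.Finite ∧
    ∑ᶠ x, m x = n

/-- The curve `i : C ⟶ Z` on the surface `Z` has self-intersection number `C² = n`, i.e. its
normal bundle `𝒪_Z(C)|_C` has degree `n`. -/
def HasSelfIntersection {C Z : Scheme.{u}} [IsIntegral C] [IsLocallyNoetherian C] (i : C ⟶ Z)
    (n : ℤ) : Prop :=
  IsConormalDegree i (-n)

/-- The double curve `2C`: the closed subscheme of `Z` with ideal sheaf `I_C²`. -/
def doubleCurve {C Z : Scheme.{u}} (i : C ⟶ Z) : Scheme.{u} :=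
  (i.ker ^ 2).subscheme

/-- The inclusion `2C ⟶ Z`. -/
def doubleCurveι {C Z : Scheme.{u}} (i : C ⟶ Z) : doubleCurve i ⟶ Z :=
  (i.ker ^ 2).subschemeι

/-! ## Families of surjections `𝒪_Z² → 𝒪_D` -/

section Families

variable {S Z D : Scheme.{u}} (j : D ⟶ Z) (p : Z ⟶ S)

/-- The structure sheaf as a sheaf of modules over itself. -/
abbrev structureModule (X : Scheme.{u}) : X.Modules := SheafOfModules.unit X.ringCatSheaf

/-- The inclusion `D_T ⟶ Z_T` obtained from `j : D ⟶ Z` by the base change `s : T ⟶ S`. -/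
def baseChangeHom {T : Scheme.{u}} (s : T ⟶ S) : pullback (j ≫ p) s ⟶ pullback p s :=
  pullback.map (j ≫ p) s p s j (𝟙 T) (𝟙 S) (by simp) (by simp)

/-- `𝒪_{D_T}` as a sheaf of modules on `Z_T`. -/
abbrev subschemeModule {T : Scheme.{u}} (s : T ⟶ S) : (pullback p s).Modules :=
  (Scheme.Modules.pushforward (baseChangeHom j p s)).obj (structureModule _)

/-- A family, parametrised by the `S`-scheme `s : T ⟶ S`, of surjections `𝒪_Z² → 𝒪_D`:
a surjective morphism of sheaves of modules `𝒪_{Z_T}² → 𝒪_{D_T}` on `Z_T = Z ×_S T`. -/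
structure SurjFamily {T : Scheme.{u}} (s : T ⟶ S) where
  hom : structureModule (pullback p s) ⊞ structureModule (pullback p s) ⟶ subschemeModule j p s
  epi : Epi hom

variable {j p}

/-- Two families define the same quotient of `𝒪_{Z_T}²` if they differ by an automorphism
of the `𝒪_{Z_T}`-module `𝒪_{D_T}`. -/
def SurjFamily.Equivalent {T : Scheme.{u}} {s : T ⟶ S} (q q' : SurjFamily j p s) : Prop :=
  ∃ α : subschemeModule j p s ≅ subschemeModule j p s, q.hom ≫ α.hom = q'.hom

/-- The image in `Γ(D_T, 𝒪)` of the first basis vector of `𝒪_{Z_T}²`. -/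
def SurjFamily.fst {T : Scheme.{u}} {s : T ⟶ S} (q : SurjFamily j p s) :
    Γ(pullback (j ≫ p) s, ⊤) :=
  (Scheme.Modules.Hom.app (biprod.inl ≫ q.hom) ⊤).hom (1 : Γ(pullback p s, ⊤))

/-- The image in `Γ(D_T, 𝒪)` of the second basis vector of `𝒪_{Z_T}²`. -/
def SurjFamily.snd {T : Scheme.{u}} {s : T ⟶ S} (q : SurjFamily j p s) :
    Γ(pullback (j ≫ p) s, ⊤) :=
  (Scheme.Modules.Hom.app (biprod.inr ≫ q.hom) ⊤).hom (1 : Γ(pullback p s, ⊤))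

/-- `q'` is the pullback of the family `q` along `f : T' ⟶ T`. As `𝒪²` is free, this says that the
two sections of `𝒪_{D_T'}` given by `q'` are the pullbacks of those given by `q`. -/
def SurjFamily.IsPullbackOf {T T' : Scheme.{u}} {s : T ⟶ S} (f : T' ⟶ T)
    (q' : SurjFamily j p (f ≫ s)) (q : SurjFamily j p s) : Prop :=
  let φ : pullback (j ≫ p) (f ≫ s) ⟶ pullback (j ≫ p) s :=
    pullback.map (j ≫ p) (f ≫ s) (j ≫ p) s (𝟙 D) f (𝟙 S) (by simp) (by simp)
  q'.fst = φ.appTop.hom q.fst ∧ q'.snd = φ.appTop.hom q.snd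

variable (j p)

/-- The `S`-scheme `e : E ⟶ S` parametrises the surjections `𝒪_Z² → 𝒪_D` (as quotients of `𝒪_Z²`,
i.e. up to automorphisms of `𝒪_D`): it is a fine moduli space for them, that is, it represents the
Zariski sheaf associated with
`T ↦ {surjections 𝒪_{Z_T}² → 𝒪_{D_T}} / Aut(𝒪_{D_T})` on `S`-schemes. Explicitly, each family `q`
over `T` has a classifying `S`-morphism `c q : T ⟶ E`, compatibly with pullback; two families over
`T` have the same classifying morphism exactly if they are equivalent; and every `S`-morphism
`T ⟶ E` is, Zariski-locally on `T`, the classifying morphism of a family. -/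
def Parametrises {E : Scheme.{u}} (e : E ⟶ S) : Prop :=
  ∃ c : ∀ {T : Scheme.{u}} (s : T ⟶ S), SurjFamily j p s → (T ⟶ E),
    (∀ {T : Scheme.{u}} (s : T ⟶ S) (q : SurjFamily j p s), c s q ≫ e = s) ∧
    (∀ {T T' : Scheme.{u}} (s : T ⟶ S) (f : T' ⟶ T) (q : SurjFamily j p s)
      (q' : SurjFamily j p (f ≫ s)), q'.IsPullbackOf f q → c (f ≫ s) q' = f ≫ c s q) ∧
    (∀ {T : Scheme.{u}} (s : T ⟶ S) (q q' : SurjFamily j p s),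
      c s q = c s q' ↔ q.Equivalent q') ∧
    (∀ {T : Scheme.{u}} (s : T ⟶ S) (g : T ⟶ E), g ≫ e = s →
      ∃ 𝒰 : T.OpenCover.{u}, ∀ a : 𝒰.I₀, ∃ q : SurjFamily j p (𝒰.f a ≫ s),
        c (𝒰.f a ≫ s) q = 𝒰.f a ≫ g)

end Families

/-! ## Total spaces of split vector bundles on `ℙ¹` -/

section TotalSpace

open Polynomial LaurentPolynomial

variable (k : Type u) [Field k] (n : ℤ) (r : ℕ)

/-- The coordinate ring `k[t][b₁, …, b_r]` of `𝔸¹ × 𝔸ʳ`. -/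
abbrev TSChart : Type u := MvPolynomial (Fin r) k[X]

/-- The coordinate ring `k[t, t⁻¹][b₁, …, b_r]` of `(𝔸¹ ∖ 0) × 𝔸ʳ`. -/
abbrev TSOverlap : Type u := MvPolynomial (Fin r) k[T;T⁻¹]

/-- The inclusion `k[t][b] → k[t, t⁻¹][b]`. -/
def tsIncl : TSChart k r →+* TSOverlap k r :=
  MvPolynomial.map (Polynomial.toLaurent (R := k))

/-- The change of coordinates `t ↦ t⁻¹`, `b_i ↦ tⁿ b_i`. -/
def tsTwist : TSOverlap k r →+* TSOverlap k r :=
  MvPolynomial.eval₂Hom (MvPolynomial.C.comp (LaurentPolynomial.invert (R := k)).toRingHom)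
    (fun l => MvPolynomial.C (LaurentPolynomial.T n) * MvPolynomial.X l)

theorem tsTwist_C (a : k[T;T⁻¹]) :
    tsTwist k n r (MvPolynomial.C a) = MvPolynomial.C (LaurentPolynomial.invert a) :=
  MvPolynomial.eval₂Hom_C _ _ _

theorem tsTwist_X (l : Fin r) :
    tsTwist k n r (MvPolynomial.X l) =
      MvPolynomial.C (LaurentPolynomial.T n) * MvPolynomial.X l :=
  MvPolynomial.eval₂Hom_X' _ _ _

theorem tsTwist_tsTwist (x : TSOverlap k r) : tsTwist k n r (tsTwist k n r x) = x := by
  induction x using MvPolynomial.induction_on with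
  | C a =>
    rw [tsTwist_C, tsTwist_C]
    exact congrArg _ (LaurentPolynomial.involutive_invert a)
  | add p q hp hq => rw [map_add, map_add, hp, hq]
  | mul_X p l hp =>
    rw [map_mul, map_mul, hp, tsTwist_X, map_mul, tsTwist_C, tsTwist_X, ← mul_assoc (MvPolynomial.C _),
      ← map_mul, LaurentPolynomial.invert_T, ← LaurentPolynomial.T_add, neg_add_cancel,
      LaurentPolynomial.T_zero, map_one, one_mul]

/-- The overlap `(𝔸¹ ∖ 0) × 𝔸ʳ` as an open subscheme of the chart over `{x₀ ≠ 0}`, with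
coordinate `t = x₁/x₀`. -/
def tsMap₀ : Spec (.of (TSOverlap k r)) ⟶ Spec (.of (TSChart k r)) :=
  Spec.map (CommRingCat.ofHom (tsIncl k r))

/-- The overlap `(𝔸¹ ∖ 0) × 𝔸ʳ` as an open subscheme of the chart over `{x₁ ≠ 0}`: the
coordinates `(t', b')` of that chart are `t' = t⁻¹`, `b'_i = tⁿ b_i`. -/
def tsMap₁ : Spec (.of (TSOverlap k r)) ⟶ Spec (.of (TSChart k r)) :=
  Spec.map (CommRingCat.ofHom (tsTwist k n r)) ≫ tsMap₀ k r

instance tsMap₀_isOpenImmersion : IsOpenImmersion (tsMap₀ k r) := by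
  let _ : Algebra (TSChart k r) (TSOverlap k r) := (tsIncl k r).toAlgebra
  have h1 : IsLocalization ((Submonoid.powers (X : k[X])).map (MvPolynomial.C (σ := Fin r)))
      (TSOverlap k r) := MvPolynomial.isLocalization (Submonoid.powers (X : k[X])) k[T;T⁻¹]
  have h2 : IsLocalization.Away (MvPolynomial.C (X : k[X]) : TSChart k r) (TSOverlap k r) := by
    rw [Submonoid.map_powers] at h1
    exact h1
  exact IsOpenImmersion.of_isLocalization (MvPolynomial.C (X : k[X]) : TSChart k r)

instance tsTwist_isIso : IsIso (Spec.map (CommRingCat.ofHom (tsTwist k n r))) := by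
  refine ⟨Spec.map (CommRingCat.ofHom (tsTwist k n r)), ?_, ?_⟩ <;>
  · rw [← Spec.map_comp, ← CommRingCat.ofHom_comp, ← Spec.map_id]
    exact congrArg (fun h => Spec.map (CommRingCat.ofHom h))
      (RingHom.ext (tsTwist_tsTwist k n r))

instance tsMap₁_isOpenImmersion : IsOpenImmersion (tsMap₁ k n r) := by
  unfold tsMap₁
  infer_instance

/-- The gluing diagram of the total space. -/
instance tsSpan_isOpenImmersion {a b : WalkingSpan} (f : a ⟶ b) :
    IsOpenImmersion ((span (tsMap₀ k r) (tsMap₁ k n r)).map f) := by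
  rcases f with _ | (_ | _)
  · change IsOpenImmersion ((span (tsMap₀ k r) (tsMap₁ k n r)).map (𝟙 _))
    infer_instance
  · exact tsMap₀_isOpenImmersion k r
  · exact tsMap₁_isOpenImmersion k n r

instance tsHasPushout : HasPushout (tsMap₀ k r) (tsMap₁ k n r) := by
  infer_instance

/-- The total space of the vector bundle `𝒪_{ℙ¹}(n)^{⊕r}`, with the convention that the total space
of a locally free sheaf `ℰ` is `𝕍(ℰ) = Spec_{ℙ¹} Sym(ℰ)`. Over the chart `{x₀ ≠ 0}` with coordinate
`t = x₁/x₀` the fibre coordinates `b_i` are the generators `x₀ⁿ` of the summands `𝒪(n)`, over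
`{x₁ ≠ 0}` with coordinate `t' = x₀/x₁` the fibre coordinates `b'_i` are the generators
`x₁ⁿ = tⁿ x₀ⁿ`. So the total space is glued from two copies of `𝔸¹ × 𝔸ʳ` along
`(𝔸¹ ∖ 0) × 𝔸ʳ` by `t' = t⁻¹`, `b'_i = tⁿ b_i`. -/
def totalSpace : Scheme.{u} := pushout (tsMap₀ k r) (tsMap₁ k n r)

/-- The structure morphism of the chart `𝔸¹ × 𝔸ʳ`. -/
def tsChartStr : Spec (.of (TSChart k r)) ⟶ Spec (.of k) :=
  Spec.map (CommRingCat.ofHom (algebraMap k (TSChart k r)))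

/-- The structure morphism of the total space over `Spec k`. -/
def totalSpaceStr : totalSpace k n r ⟶ Spec (.of k) :=
  pushout.desc (tsChartStr k r) (tsChartStr k r) (by
    simp only [tsMap₁, tsMap₀, tsChartStr, ← Spec.map_comp, ← CommRingCat.ofHom_comp]
    congr 2
    refine RingHom.ext fun x => ?_
    have h : tsIncl k r (algebraMap k (TSChart k r) x) =
        MvPolynomial.C (LaurentPolynomial.C x) := by
      rw [IsScalarTower.algebraMap_apply k k[X] (TSChart k r), MvPolynomial.algebraMap_eq, tsIncl,
        MvPolynomial.map_C]
      exact congrArg _ (Polynomial.toLaurent_C x)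
    simp only [RingHom.comp_apply, h, tsTwist_C, LaurentPolynomial.invert_C])

end TotalSpace

/-! ## The quadric `V(xz + y²)` -/

section Quadric

variable (k : Type u) [Field k] (d : ℕ)

/-- The polynomial `xz + y²` in the homogeneous coordinates `x, y, z, u₀, …, u_d` of `ℙ^{d+3}`. -/
def quadricPoly : MvPolynomial (Fin (d + 3 + 1)) k :=
  MvPolynomial.X 0 * MvPolynomial.X 2 + MvPolynomial.X 1 ^ 2

/-- The zero locus of `xz + y²` in `ℙ^{d+3}`. -/
def quadricSet : TopologicalSpace.Closeds (ProjSp k (d + 3)) :=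
  ⟨ProjectiveSpectrum.zeroLocus (MvPolynomial.homogeneousSubmodule (Fin (d + 3 + 1)) k)
      {quadricPoly k d},
    ProjectiveSpectrum.isClosed_zeroLocus _ _⟩

/-- The quadric `V(xz + y²) ⊆ ℙ^{d+3}`, as a closed subvariety (the polynomial is irreducible, so
that the scheme it defines is the reduced one). -/
def quadric : Scheme.{u} :=
  (Scheme.IdealSheafData.vanishingIdeal (quadricSet k d)).subscheme

/-- The structure morphism of the quadric. -/
def quadricStr : quadric k d ⟶ Spec (.of k) :=
  (Scheme.IdealSheafData.vanishingIdeal (quadricSet k d)).subschemeι ≫ projSpStr k (d + 3)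

end Quadric

/-- The smooth locus of `f : X ⟶ Y`: the largest open subscheme of `X` on which `f` is smooth. -/
def smoothOpen {X Y : Scheme.{u}} (f : X ⟶ Y) : X.Opens :=
  sSup {U : X.Opens | Smooth (U.ι ≫ f)}

end

/-! As `𝒪²` is free, a family of surjections over `T` is a pair `(F, G)` of functions on `2C × T`
without common zeros, and an automorphism of the quotient multiplies both by one unit
(`SurjFamily.cover`, `SurjFamily.exists_of_cover`, `SurjFamily.equivalent_iff`). So only the ring of
functions on `2C × T` matters.

The ideal of `C` in `2C` has square zero and is the conormal bundle, of degree `d` on `ℙ¹`. From `0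
→ 𝒪(d) → 𝒪_{2C} → 𝒪_C → 0`, with the constants splitting off, `Γ(2C) = k[ε₀, …, ε_d]/(ε)²`
(`exists_isDualBasis`). Since the degree is given by orders of a rational section `f`, sections of
the conormal bundle are written as `h * f`, and `IsProjectiveLine.exists_twist` identifies the
admissible rational functions `h` with the polynomials of degree at most `d`. Flat base change from
the field `k` then gives `Γ(2C × T) = Γ(T)[ε]` (`IsDualBasis.pullback`).

A pair `(F : G)` over `Γ(T)[ε]`, up to units, is a point of `ℙ¹` with `d + 1` tangent vectors. Where
`F` is invertible its coordinate is `G / F = t + ∑ b_l ε_l`, with `t` and `b` arbitrary; where `G`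
is invertible it is `F / G`. Where both are, the second is the inverse of the first, `t⁻¹ - ∑ t⁻²
b_l ε_l`. After changing the sign of the `ε_l` in the second chart this is the gluing of
`𝕍(𝒪(-2)^{⊕(d+1)})`, which proves `parametrises_totalSpace`.

The quadric is covered outside its vertex `x = y = z = 0` by `{x ≠ 0}` and `{z ≠ 0}`, with
parametrisations `(1 : t : -t² : b)` and `(-t² : -t : 1 : -b)`. On the overlap they are proportional
with `t' = t⁻¹`, `b' = t⁻² b`, so this open part is the same total space
(`exists_totalSpace_quadric`). At the vertex the tangent vector `x = z = 0`, `y = s` does not lift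
to second order, because `xz + y²` becomes `s²` modulo `s³` (`not_mem_smoothOpen_quadric`). The
quadric is a reduced closed subset by definition; its ideal is never computed, and reducedness of
sources and of open parts takes the place of generators. -/

noncomputable section

/-! ### Morphisms from free modules to the structure sheaf of a closed subscheme -/

namespace AlgebraicGeometry.Scheme.Modules

open Opposite TopologicalSpace

/-- The morphism `𝒪_Y ⟶ M` given by a global section of `M`. -/
def ofSection {Y : Scheme.{u}} (M : Y.Modules) (s : Γ(M, ⊤)) : structureModule Y ⟶ M :=
  (SheafOfModules.unitHomEquiv (R := Y.ringCatSheaf) M).symm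
    (PresheafOfModules.sectionsMk (M := M.val)
      (fun U ↦ M.presheaf.map (homOfLE (le_top : U.unop ≤ ⊤)).op s)
      (fun U V f ↦ by
        change (M.presheaf.map _ ≫ M.presheaf.map f) s = _
        rw [← M.presheaf.map_comp]; rfl))

lemma ofSection_app {Y : Scheme.{u}} (M : Y.Modules) (s : Γ(M, ⊤)) (U : Y.Opens) (r : Γ(Y, U)) :
    (Hom.app (ofSection M s) U).hom r =
      r • M.presheaf.map (homOfLE (le_top : U ≤ ⊤)).op s := by
  rfl

lemma app_res {Y : Scheme.{u}} {M N : Y.Modules} (φ : M ⟶ N) {U V : Y.Opens} (h : U ≤ V)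
    (x : Γ(M, V)) :
    (Hom.app φ U).hom (M.presheaf.map (homOfLE h).op x) =
      N.presheaf.map (homOfLE h).op ((Hom.app φ V).hom x) :=
  congr($(φ.mapPresheaf.naturality (homOfLE h).op) x)

lemma unit_app {Y : Scheme.{u}} {M : Y.Modules} (φ : structureModule Y ⟶ M) (U : Y.Opens)
    (r : Γ(Y, U)) :
    (Hom.app φ U).hom r =
      r • M.presheaf.map (homOfLE (le_top : U ≤ ⊤)).op ((Hom.app φ ⊤).hom (1 : Γ(Y, ⊤))) := by
  rw [← app_res φ (le_top : U ≤ ⊤) (1 : Γ(Y, ⊤))]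
  have h : (structureModule Y).presheaf.map (homOfLE (le_top : U ≤ ⊤)).op (1 : Γ(Y, ⊤)) =
    (1 : Γ(Y, U)) := map_one (Y.presheaf.map (homOfLE (le_top : U ≤ ⊤)).op).hom
  rw [h]
  refine Eq.trans ?_ (Hom.app_smul φ r (1 : Γ(Y, U)))
  congr 1
  exact (mul_one r).symm

lemma unit_hom_ext {Y : Scheme.{u}} {M : Y.Modules} {φ ψ : structureModule Y ⟶ M}
    (h : (Hom.app φ ⊤).hom (1 : Γ(Y, ⊤)) = (Hom.app ψ ⊤).hom (1 : Γ(Y, ⊤))) : φ = ψ := by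
  refine hom_ext _ _ fun U ↦ ?_
  ext r
  exact (unit_app φ U r).trans (h ▸ (unit_app ψ U r).symm)

/-- The structure morphism `𝒪_Y ⟶ b_* 𝒪_D`. -/
def unitToPushforward {D Y : Scheme.{u}} (b : D ⟶ Y) :
    structureModule Y ⟶ (pushforward b).obj (structureModule D) :=
  SheafOfModules.unitToPushforwardObjUnit b.toRingCatSheafHom

lemma pushforward_smul {D Y : Scheme.{u}} (b : D ⟶ Y) (U : Y.Opens) (r : Γ(Y, U))
    (x : Γ(D, b ⁻¹ᵁ U)) :
    (r • (show Γ((pushforward b).obj (structureModule D), U) from x)) = (b.app U).hom r * x := rfl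

lemma structureModule_smul {Y : Scheme.{u}} (U : Y.Opens) (r x : Γ(Y, U)) :
    (r • (show Γ(structureModule Y, U) from x)) = r * x := rfl

section Surjections

variable {D Y : Scheme.{u}} (b : D ⟶ Y)

/-- The image of `1` under a morphism `𝒪_Y ⟶ b_* 𝒪_D`. -/
def coord (φ : structureModule Y ⟶ (pushforward b).obj (structureModule D)) : Γ(D, ⊤) :=
  (Hom.app φ ⊤).hom (1 : Γ(Y, ⊤))

/-- The morphism `𝒪_Y ⟶ b_* 𝒪_D` sending `1` to `a`. -/
def ofCoord (a : Γ(D, ⊤)) : structureModule Y ⟶ (pushforward b).obj (structureModule D) :=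
  ofSection ((pushforward b).obj (structureModule D)) a

lemma coord_ofCoord (a : Γ(D, ⊤)) : coord b (ofCoord b a) = a := by
  refine (ofSection_app ((pushforward b).obj (structureModule D)) a ⊤ (1 : Γ(Y, ⊤))).trans ?_
  refine (one_smul _ _).trans ?_
  exact congr($(D.presheaf.map_id _).hom a)

variable {b}

/-- The image of `1` under the composite is the value at `x` of the coordinate function, which is
zero, and a map out of `𝒪_Y` is determined by the image of `1`. -/
lemma coord_comp_residue (φ : structureModule Y ⟶ (pushforward b).obj (structureModule D))
    (x : D) (hx : x ∉ D.basicOpen (coord b φ)) :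
    φ ≫ (pushforward b).map (unitToPushforward (D.fromSpecResidueField x)) = 0 := by
  refine unit_hom_ext ?_
  change ((D.fromSpecResidueField x).app ⊤).hom (coord b φ) = 0
  rw [← basicOpen_eq_bot_iff, ← Scheme.preimage_basicOpen, eq_bot_iff]
  intro z hz
  refine (hx ?_).elim
  rw [← D.fromSpecResidueField_apply x z]
  exact hz

/-- At a common zero `x` of the two coordinate functions, evaluation in the residue field is a
nonzero map that becomes zero after composition with `q`; an epimorphism forbids this. -/
lemma cover_of_epi (q : structureModule Y ⊞ structureModule Y ⟶
    (pushforward b).obj (structureModule D)) [Epi q] :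
    D.basicOpen (coord b (biprod.inl ≫ q)) ⊔ D.basicOpen (coord b (biprod.inr ≫ q)) = ⊤ := by
  refine top_le_iff.mp fun x _ ↦ ?_
  by_contra hx
  have hx' : x ∉ D.basicOpen (coord b (biprod.inl ≫ q)) ∧
      x ∉ D.basicOpen (coord b (biprod.inr ≫ q)) := by
    rwa [← not_or]
  have h : (pushforward b).map (unitToPushforward (D.fromSpecResidueField x)) = 0 := by
    rw [← cancel_epi q]
    refine biprod.hom_ext' _ _ ?_ ?_
    · simpa using coord_comp_residue _ x hx'.1
    · simpa using coord_comp_residue _ x hx'.2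
  have h1 : ((D.fromSpecResidueField x).appTop).hom 1 = 0 :=
    congr((Hom.app $h ⊤).hom (1 : Γ(D, ⊤)))
  rw [map_one] at h1
  have : Nontrivial Γ(Spec (D.residueField x), ⊤) :=
    (Scheme.ΓSpecIso (D.residueField x)).commRingCatIsoToRingEquiv.toEquiv.nontrivial
  exact one_ne_zero h1

/-- Over an affine `U` the two functions generate the unit ideal of `Γ(D, b ⁻¹ᵁ U)`, and the
multipliers lift to `Γ(Y, U)` because `b` is a closed immersion. So `q` is onto over affine opens,
and a map that kills its image vanishes there, hence everywhere. -/
lemma epi_of_cover [IsClosedImmersion b] (q : structureModule Y ⊞ structureModule Y ⟶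
    (pushforward b).obj (structureModule D))
    (h : D.basicOpen (coord b (biprod.inl ≫ q)) ⊔ D.basicOpen (coord b (biprod.inr ≫ q)) = ⊤) :
    Epi q := by
  refine Preadditive.epi_of_cancel_zero _ fun {M} φ hφ ↦ ?_
  set f := coord b (biprod.inl ≫ q) with hf
  set g := coord b (biprod.inr ≫ q) with hg
  have h0 (e : structureModule Y ⟶ (pushforward b).obj (structureModule D)) (he : e ≫ φ = 0)
      (U : Y.Opens) (r : Γ(Y, U)) :
      (Hom.app φ U).hom ((b.app U).hom r *
        D.presheaf.map (homOfLE (le_top : b ⁻¹ᵁ U ≤ ⊤)).op (coord b e)) = 0 := by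
    have := congr((Hom.app $he U).hom r)
    rw [Hom.zero_app] at this
    refine Eq.trans ?_ this
    change _ = (Hom.app φ U).hom ((Hom.app e U).hom r)
    rw [unit_app e U r]
    rfl
  have haff : ∀ U : Y.Opens, IsAffineOpen U → ∀ s : Γ(D, b ⁻¹ᵁ U), (Hom.app φ U).hom s = 0 := by
    intro U hU s
    have hU' : IsAffineOpen (b ⁻¹ᵁ U) := hU.preimage b
    set f' := D.presheaf.map (homOfLE (le_top : b ⁻¹ᵁ U ≤ ⊤)).op f with hf'
    set g' := D.presheaf.map (homOfLE (le_top : b ⁻¹ᵁ U ≤ ⊤)).op g with hg'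
    have hspan : Ideal.span {f', g'} = ⊤ := by
      rw [← hU'.self_le_iSup_basicOpen_iff]
      intro x hx
      simp only [Opens.mem_iSup, Subtype.exists, Set.mem_insert_iff, Set.mem_singleton_iff]
      rcases (h.symm ▸ Opens.mem_top x : x ∈ D.basicOpen f ⊔ D.basicOpen g) with hxf | hxg
      · exact ⟨f', ⟨.inl rfl, by rw [hf', Scheme.basicOpen_res]; exact ⟨hx, hxf⟩⟩⟩
      · exact ⟨g', ⟨.inr rfl, by rw [hg', Scheme.basicOpen_res]; exact ⟨hx, hxg⟩⟩⟩
    obtain ⟨a, c, hac⟩ := Ideal.mem_span_pair.mp (hspan ▸ Submodule.mem_top : (1 : Γ(D, b ⁻¹ᵁ U)) ∈ _)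
    obtain ⟨α, hα⟩ := b.app_surjective U hU (s * a)
    obtain ⟨γ, hγ⟩ := b.app_surjective U hU (s * c)
    have : s = (b.app U).hom α * f' + (b.app U).hom γ * g' := by
      rw [hα, hγ]; linear_combination (-s) * hac
    rw [this]
    refine (map_add (Hom.app φ U).hom _ _).trans ?_
    rw [h0 _ (by rw [Category.assoc, hφ, comp_zero]) U α,
      h0 _ (by rw [Category.assoc, hφ, comp_zero]) U γ, add_zero]
  refine hom_ext _ _ fun U ↦ ?_
  ext s
  change (Hom.app φ U).hom s = 0
  refine TopCat.Sheaf.eq_of_locally_eq' ⟨M.presheaf, M.isSheaf⟩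
    (fun V : {V : Y.affineOpens // V.1 ≤ U} ↦ V.1.1) U (fun V ↦ homOfLE V.2) ?_ _ _ fun V ↦ ?_
  · intro x hx
    obtain ⟨V, hV, hxV, hVU⟩ := Opens.isBasis_iff_nbhd.mp Y.isBasis_affineOpens hx
    exact Opens.mem_iSup.mpr ⟨⟨⟨V, hV⟩, hVU⟩, hxV⟩
  · refine (app_res φ V.2 s).symm.trans ?_
    rw [map_zero]
    exact haff _ V.1.2 _

/-- On affine opens every function on `D` is restricted from `Y`, so `𝒪_Y`-linearity is already
`𝒪_D`-linearity. This is why automorphisms of `b_* 𝒪_D` are multiplications by units. -/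
lemma endo_app_top [IsClosedImmersion b]
    (α : (pushforward b).obj (structureModule D) ⟶ (pushforward b).obj (structureModule D))
    (a : Γ(D, ⊤)) :
    (Hom.app α ⊤).hom a = a * (show Γ(D, ⊤) from (Hom.app α ⊤).hom (1 : Γ(D, ⊤))) := by
  refine TopCat.Sheaf.eq_of_locally_eq' ⟨((pushforward b).obj (structureModule D)).presheaf,
    Modules.isSheaf _⟩ (fun V : Y.affineOpens ↦ V.1) ⊤ (fun V ↦ homOfLE le_top) ?_ _ _ fun V ↦ ?_
  · rw [iSup_affineOpens_eq_top]
  · refine (app_res α (le_top : V.1 ≤ ⊤) a).symm.trans ?_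
    obtain ⟨r, hr⟩ := b.app_surjective V.1 V.2
      (D.presheaf.map (homOfLE (le_top : b ⁻¹ᵁ V.1 ≤ ⊤)).op a)
    have h1 : ((pushforward b).obj (structureModule D)).presheaf.map
        (homOfLE (le_top : V.1 ≤ ⊤)).op a =
        r • (show Γ((pushforward b).obj (structureModule D), V.1) from
          (1 : Γ(D, b ⁻¹ᵁ V.1))) := by
      rw [pushforward_smul, hr, mul_one]; rfl
    rw [h1, Hom.app_smul]
    have h2 : (Hom.app α V.1).hom (1 : Γ(D, b ⁻¹ᵁ V.1)) =
        D.presheaf.map (homOfLE (le_top : b ⁻¹ᵁ V.1 ≤ ⊤)).op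
          (show Γ(D, ⊤) from (Hom.app α ⊤).hom (1 : Γ(D, ⊤))) := by
      refine Eq.trans ?_ (app_res α (le_top : V.1 ≤ ⊤) (1 : Γ(D, ⊤)))
      congr 1
      exact (map_one (D.presheaf.map (homOfLE (le_top : b ⁻¹ᵁ V.1 ≤ ⊤)).op).hom).symm
    refine Eq.trans (congrArg (fun z ↦ r • z) h2) ?_
    refine Eq.trans (pushforward_smul b V.1 r _) ?_
    rw [hr]
    exact (map_mul (D.presheaf.map (homOfLE (le_top : b ⁻¹ᵁ V.1 ≤ ⊤)).op).hom _ _).symm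

lemma exists_unit_of_iso [IsClosedImmersion b]
    (α : (pushforward b).obj (structureModule D) ≅ (pushforward b).obj (structureModule D)) :
    ∃ u : Γ(D, ⊤)ˣ, ∀ φ, coord b (φ ≫ α.hom) = u * coord b φ := by
  refine ⟨⟨(Hom.app α.hom ⊤).hom (1 : Γ(D, ⊤)), (Hom.app α.inv ⊤).hom (1 : Γ(D, ⊤)), ?_, ?_⟩, ?_⟩
  · refine (endo_app_top α.inv _).symm.trans ?_
    exact congr((Hom.app $α.hom_inv_id ⊤).hom (1 : Γ(D, ⊤)))
  · refine (endo_app_top α.hom _).symm.trans ?_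
    exact congr((Hom.app $α.inv_hom_id ⊤).hom (1 : Γ(D, ⊤)))
  · intro φ
    exact (endo_app_top α.hom (coord b φ)).trans (mul_comm (coord b φ) _)

lemma coord_ofSection (φ : structureModule Y ⟶ (pushforward b).obj (structureModule D))
    (u : Γ(D, ⊤)) :
    coord b (φ ≫ (pushforward b).map (ofSection (structureModule D) u)) = u * coord b φ := by
  refine (ofSection_app (structureModule D) u ⊤ (coord b φ)).trans ?_
  refine Eq.trans (structureModule_smul _ _ _) ?_
  rw [mul_comm]
  congr 1
  exact congr($(D.presheaf.map_id _).hom u)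

lemma ofSection_comp (u v : Γ(D, ⊤)) (h : u * v = 1) :
    ofSection (structureModule D) u ≫ ofSection (structureModule D) v = 𝟙 _ := by
  refine unit_hom_ext ?_
  have h1 (w r : Γ(D, ⊤)) : (Hom.app (ofSection (structureModule D) w) ⊤).hom r = r * w := by
    refine (ofSection_app (structureModule D) w ⊤ r).trans ?_
    refine Eq.trans (structureModule_smul _ _ _) ?_
    congr 1
    exact congr($(D.presheaf.map_id _).hom w)
  change (Hom.app (ofSection (structureModule D) v) ⊤).hom
    ((Hom.app (ofSection (structureModule D) u) ⊤).hom (1 : Γ(D, ⊤))) = (1 : Γ(D, ⊤))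
  rw [h1, h1, one_mul, h]

/-- The automorphism of `b_* 𝒪_D` given by a unit. -/
def isoOfUnit (b : D ⟶ Y) (u : Γ(D, ⊤)ˣ) :
    (pushforward b).obj (structureModule D) ≅ (pushforward b).obj (structureModule D) :=
  (pushforward b).mapIso
    { hom := ofSection (structureModule D) (u : Γ(D, ⊤))
      inv := ofSection (structureModule D) ((u⁻¹ : Γ(D, ⊤)ˣ) : Γ(D, ⊤))
      hom_inv_id := ofSection_comp _ _ u.mul_inv
      inv_hom_id := ofSection_comp _ _ u.inv_mul }

end Surjections

end AlgebraicGeometry.Scheme.Modules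

/-! ### Families of surjections as pairs of functions without common zeros -/

namespace SurjFamily

open AlgebraicGeometry.Scheme.Modules

variable {S Z D T : Scheme.{u}} {j : D ⟶ Z} {p : Z ⟶ S} {s : T ⟶ S}

/-- The base change square over `j` is cartesian, by pasting with that of `p` and `s`. -/
instance baseChangeHom_isClosedImmersion [IsClosedImmersion j] :
    IsClosedImmersion (baseChangeHom j p s) := by
  have hb : baseChangeHom j p s ≫ pullback.snd p s = pullback.snd (j ≫ p) s :=
    (pullback.lift_snd _ _ _).trans (Category.comp_id _)
  have h : IsPullback (baseChangeHom j p s) (pullback.fst (j ≫ p) s) (pullback.fst p s) j := by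
    refine IsPullback.of_right (h₁₂ := pullback.snd p s) (v₁₃ := s) (h₂₂ := p) ?_ ?_ ?_
    · rw [hb]; exact (IsPullback.of_hasPullback (j ≫ p) s).flip
    · exact pullback.lift_fst _ _ _
    · exact (IsPullback.of_hasPullback p s).flip
  exact MorphismProperty.of_isPullback h.flip ‹_›

lemma cover [IsClosedImmersion j] (q : SurjFamily j p s) :
    (pullback (j ≫ p) s).basicOpen q.fst ⊔ (pullback (j ≫ p) s).basicOpen q.snd = ⊤ :=
  have := q.epi
  cover_of_epi q.hom

lemma exists_of_cover [IsClosedImmersion j] (f g : Γ(pullback (j ≫ p) s, ⊤))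
    (h : (pullback (j ≫ p) s).basicOpen f ⊔ (pullback (j ≫ p) s).basicOpen g = ⊤) :
    ∃ q : SurjFamily j p s, q.fst = f ∧ q.snd = g := by
  let φ := biprod.desc (ofCoord (baseChangeHom j p s) f) (ofCoord (baseChangeHom j p s) g)
  have h1 : coord (baseChangeHom j p s) (biprod.inl ≫ φ) = f := by
    rw [biprod.inl_desc, coord_ofCoord]
  have h2 : coord (baseChangeHom j p s) (biprod.inr ≫ φ) = g := by
    rw [biprod.inr_desc, coord_ofCoord]
  exact ⟨⟨φ, epi_of_cover φ (by rw [h1, h2]; exact h)⟩, h1, h2⟩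

lemma equivalent_iff [IsClosedImmersion j] (q q' : SurjFamily j p s) :
    q.Equivalent q' ↔
      ∃ u : Γ(pullback (j ≫ p) s, ⊤)ˣ, q'.fst = u * q.fst ∧ q'.snd = u * q.snd := by
  constructor
  · rintro ⟨α, hα⟩
    obtain ⟨u, hu⟩ := exists_unit_of_iso α
    refine ⟨u, ?_, ?_⟩
    · refine Eq.trans ?_ (hu (biprod.inl ≫ q.hom))
      rw [Category.assoc, hα]; rfl
    · refine Eq.trans ?_ (hu (biprod.inr ≫ q.hom))
      rw [Category.assoc, hα]; rfl
  · rintro ⟨u, h1, h2⟩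
    refine ⟨isoOfUnit _ u, ?_⟩
    refine biprod.hom_ext' _ _ (unit_hom_ext ?_) (unit_hom_ext ?_)
    · refine Eq.trans ?_ h1.symm
      rw [← Category.assoc]
      exact coord_ofSection (biprod.inl ≫ q.hom) (u : Γ(pullback (j ≫ p) s, ⊤))
    · refine Eq.trans ?_ h2.symm
      rw [← Category.assoc]
      exact coord_ofSection (biprod.inr ≫ q.hom) (u : Γ(pullback (j ≫ p) s, ⊤))

end SurjFamily

end

/-! ### Base change of a basis of functions -/

noncomputable section

open Opposite TopologicalSpace

section Algebra

variable {r : ℕ}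

lemma bijective_linearCombination_iff {R A : Type*} [CommRing R] [CommRing A] [Algebra R A]
    (ε : Fin r → A) :
    Function.Bijective (Fintype.linearCombination R (Fin.cons 1 ε : Fin (r + 1) → A)) ↔
      Function.Bijective (fun a : R × (Fin r → R) ↦
        algebraMap R A a.1 + ∑ l, algebraMap R A (a.2 l) * ε l) := by
  have h : (fun a : R × (Fin r → R) ↦ algebraMap R A a.1 + ∑ l, algebraMap R A (a.2 l) * ε l) =
      Fintype.linearCombination R (Fin.cons 1 ε : Fin (r + 1) → A) ∘
        (Fin.consEquiv fun _ : Fin (r + 1) ↦ R) := by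
    funext a
    simp [Fintype.linearCombination_apply, Fin.sum_univ_succ, Algebra.smul_def, Fin.consEquiv]
  rw [h]
  exact (Function.Bijective.of_comp_iff _ (Equiv.bijective _)).symm

/-- The hypothesis makes `1, ε₁, …, ε_r` a basis of `R'` over `R`, and extension of scalars turns a
basis into a basis. -/
lemma bijective_of_isPushout {R S R' S' : Type u} [CommRing R] [CommRing S] [CommRing R']
    [CommRing S'] [Algebra R S] [Algebra R R'] [Algebra S S'] [Algebra R' S'] [Algebra R S']
    [IsScalarTower R R' S'] [IsScalarTower R S S'] [Algebra.IsPushout R S R' S'] (ε : Fin r → R')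
    (H : Function.Bijective (fun a : R × (Fin r → R) ↦
        algebraMap R R' a.1 + ∑ l, algebraMap R R' (a.2 l) * ε l)) :
    Function.Bijective (fun a : S × (Fin r → S) ↦
        algebraMap S S' a.1 + ∑ l, algebraMap S S' (a.2 l) * algebraMap R' S' (ε l)) := by
  rw [← bijective_linearCombination_iff] at H
  rw [← bijective_linearCombination_iff (R := S) (fun l ↦ algebraMap R' S' (ε l))]
  let b : Module.Basis (Fin (r + 1)) R R' :=
    Module.Basis.ofEquivFun (LinearEquiv.ofBijective _ H).symm
  have hb : ⇑b = Fin.cons 1 ε := by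
    funext i
    simp [b, Module.Basis.ofEquivFun]
  let c := (Algebra.IsPushout.out (R := R) (S := S) (R' := R') (S' := S')).basis b
  have hc : ⇑c = Fin.cons 1 (fun l ↦ algebraMap R' S' (ε l)) := by
    funext i
    simp only [c, IsBaseChange.basis_apply, hb]
    refine Fin.cases ?_ (fun l ↦ ?_) i <;> simp
  rw [← hc]
  convert c.equivFun.symm.bijective using 1
  ext x
  simp [Fintype.linearCombination_apply, Module.Basis.equivFun_symm_apply]

end Algebra

namespace AlgebraicGeometry.Scheme

variable {r : ℕ} {X T : Scheme.{u}}

/-- For `π : X ⟶ T` and functions `ε_l` on `X`, the map `(a₀, a) ↦ a₀ + ∑ a_l ε_l`. -/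
def dualMap (π : X ⟶ T) (ε : Fin r → Γ(X, ⊤)) (U : T.Opens) (a : Γ(T, U) × (Fin r → Γ(T, U))) :
    Γ(X, π ⁻¹ᵁ U) :=
  (π.app U).hom a.1 +
    ∑ l, (π.app U).hom (a.2 l) * (X.presheaf.map (homOfLE (le_top : π ⁻¹ᵁ U ≤ ⊤)).op).hom (ε l)

/-- Restriction of coefficients. -/
def resCoeff {U V : T.Opens} (h : V ≤ U) (a : Γ(T, U) × (Fin r → Γ(T, U))) :
    Γ(T, V) × (Fin r → Γ(T, V)) :=
  ((T.presheaf.map (homOfLE h).op).hom a.1, fun l ↦ (T.presheaf.map (homOfLE h).op).hom (a.2 l))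

lemma dualMap_res (π : X ⟶ T) (ε : Fin r → Γ(X, ⊤)) {U V : T.Opens} (h : V ≤ U)
    (a : Γ(T, U) × (Fin r → Γ(T, U))) :
    dualMap π ε V (resCoeff h a) =
      (X.presheaf.map (homOfLE (π.preimage_mono h)).op).hom (dualMap π ε U a) := by
  have h1 (x : Γ(T, U)) : (π.app V).hom ((T.presheaf.map (homOfLE h).op).hom x) =
      (X.presheaf.map (homOfLE (π.preimage_mono h)).op).hom ((π.app U).hom x) :=
    congr($(π.naturality (homOfLE h).op).hom x)
  simp only [dualMap, resCoeff, map_add, map_sum, map_mul, h1]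
  congr 1
  refine Finset.sum_congr rfl fun l _ ↦ ?_
  congr 1
  rw [← CommRingCat.comp_apply, ← X.presheaf.map_comp]
  rfl

lemma resCoeff_ext {U : T.Opens} {ι : Type*} (V : ι → T.Opens) (h : ∀ i, V i ≤ U)
    (hU : U ≤ iSup V) {a b : Γ(T, U) × (Fin r → Γ(T, U))}
    (hab : ∀ i, resCoeff (h i) a = resCoeff (h i) b) : a = b := by
  refine Prod.ext ?_ (funext fun l ↦ ?_)
  · exact T.sheaf.eq_of_locally_eq' V U (fun i ↦ homOfLE (h i)) hU _ _
      fun i ↦ congr(($(hab i)).1)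
  · exact T.sheaf.eq_of_locally_eq' V U (fun i ↦ homOfLE (h i)) hU _ _
      fun i ↦ congr(($(hab i)).2 l)

lemma le_iSup_affineOpens (U : T.Opens) :
    U ≤ ⨆ V : {V : T.affineOpens // V.1 ≤ U}, V.1.1 := by
  intro x hx
  obtain ⟨V, hV, hxV, hVU⟩ := Opens.isBasis_iff_nbhd.mp T.isBasis_affineOpens hx
  exact Opens.mem_iSup.mpr ⟨⟨⟨V, hV⟩, hVU⟩, hxV⟩

/-- Needed on all opens before surjectivity: the intersection of two affine opens need not be
affine, and local preimages have to be compared there. -/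
lemma dualMap_injective (π : X ⟶ T) (ε : Fin r → Γ(X, ⊤))
    (H : ∀ U : T.affineOpens, Function.Bijective (dualMap π ε U.1)) (U : T.Opens) :
    Function.Injective (dualMap π ε U) := by
  intro a b hab
  refine resCoeff_ext (fun V : {V : T.affineOpens // V.1 ≤ U} ↦ V.1.1) (fun V ↦ V.2)
    (le_iSup_affineOpens U) fun V ↦ (H V.1).1 ?_
  rw [dualMap_res, dualMap_res, hab]

/-- Both sides are sheaves on `T`; preimages over affine opens agree on overlaps by injectivity, so
they glue. -/
lemma dualMap_bijective (π : X ⟶ T) (ε : Fin r → Γ(X, ⊤))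
    (H : ∀ U : T.affineOpens, Function.Bijective (dualMap π ε U.1)) (U : T.Opens) :
    Function.Bijective (dualMap π ε U) := by
  refine ⟨dualMap_injective π ε H U, fun y ↦ ?_⟩
  let ι := {V : T.affineOpens // V.1 ≤ U}
  choose a ha using fun V : ι ↦
    (H V.1).2 ((X.presheaf.map (homOfLE (π.preimage_mono V.2)).op).hom y)
  have hc (V W : ι) : resCoeff (inf_le_left : V.1.1 ⊓ W.1.1 ≤ _) (a V) =
      resCoeff (inf_le_right : V.1.1 ⊓ W.1.1 ≤ _) (a W) := by
    refine dualMap_injective π ε H _ ?_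
    rw [dualMap_res, dualMap_res, ha, ha, ← CommRingCat.comp_apply, ← CommRingCat.comp_apply,
      ← X.presheaf.map_comp, ← X.presheaf.map_comp]
    rfl
  obtain ⟨s0, hs0, -⟩ := T.sheaf.existsUnique_gluing' (fun V : ι ↦ V.1.1) U
    (fun V ↦ homOfLE V.2) (le_iSup_affineOpens U) (fun V ↦ (a V).1)
    (fun V W ↦ congr(($(hc V W)).1))
  have hex (l : Fin r) := T.sheaf.existsUnique_gluing' (fun V : ι ↦ V.1.1) U
    (fun V ↦ homOfLE V.2) (le_iSup_affineOpens U) (fun V ↦ (a V).2 l)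
    (fun V W ↦ congr(($(hc V W)).2 l))
  choose s hs hs' using hex
  have hres (V : ι) : resCoeff V.2 (s0, s) = a V := by
    refine Prod.ext (hs0 V) (funext fun l ↦ hs l V)
  refine ⟨(s0, s), ?_⟩
  refine X.sheaf.eq_of_locally_eq' (fun V : ι ↦ π ⁻¹ᵁ V.1.1) (π ⁻¹ᵁ U)
    (fun V ↦ homOfLE (π.preimage_mono V.2)) ?_ _ _ fun V ↦ ?_
  · intro x hx
    obtain ⟨V, hV⟩ := Opens.mem_iSup.mp (le_iSup_affineOpens U (show π x ∈ U from hx))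
    exact Opens.mem_iSup.mpr ⟨V, hV⟩
  · exact (dualMap_res π ε V.2 (s0, s)).symm.trans ((congrArg _ (hres V)).trans (ha V))

/-- Flat base change: everything is flat over the field `k`, so for affine `U` the functions on `X ×
U` are `Γ(X) ⊗ Γ(U)`. General `U` follow by gluing. -/
lemma dualMap_pullback_bijective {k : Type u} [Field k] (π : X ⟶ Spec (.of k)) (s : T ⟶ Spec (.of k))
    [QuasiCompact π] [QuasiSeparated π] (ε : Fin r → Γ(X, ⊤))
    (H : Function.Bijective (dualMap π ε ⊤)) (U : T.Opens) :
    Function.Bijective (dualMap (pullback.snd π s)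
      (fun l ↦ (pullback.fst π s).appTop.hom (ε l)) U) := by
  refine dualMap_bijective _ _ (fun U ↦ ?_) U
  have : CompactSpace X := QuasiCompact.compactSpace_of_compactSpace π
  have : QuasiSeparatedSpace X := quasiSeparatedSpace_of_quasiSeparated π
  have h1 := isIso_pushoutSection_of_isQuasiSeparated_of_flat_right
    (IsPullback.of_hasPullback π s) (US := ⊤) (UT := U.1) (UX := ⊤) le_top le_top
    (UY := pullback.snd π s ⁻¹ᵁ U.1) (by simp) (isAffineOpen_top _) U.2
    (isCompact_univ (X := X)) (isQuasiSeparated_univ (α := X))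
  replace h1 := (isIso_pushoutSection_iff ..).mp h1
  let _ := (π.appLE ⊤ ⊤ le_top).hom.toAlgebra
  let _ := (s.appLE ⊤ U.1 le_top).hom.toAlgebra
  let _ := ((pullback.fst π s).appLE ⊤ (pullback.snd π s ⁻¹ᵁ U.1) le_top).hom.toAlgebra
  let _ := ((pullback.snd π s).appLE U.1 (pullback.snd π s ⁻¹ᵁ U.1) le_rfl).hom.toAlgebra
  let _ := (π.appLE ⊤ ⊤ le_top ≫ (pullback.fst π s).appLE ⊤ (pullback.snd π s ⁻¹ᵁ U.1) le_top).hom.toAlgebra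
  have _ : IsScalarTower Γ(Spec (.of k), ⊤) Γ(X, ⊤) Γ(pullback π s, pullback.snd π s ⁻¹ᵁ U.1) :=
    .of_algebraMap_eq' rfl
  have _ : IsScalarTower Γ(Spec (.of k), ⊤) Γ(T, U.1) Γ(pullback π s, pullback.snd π s ⁻¹ᵁ U.1) :=
    .of_algebraMap_eq' (congr($(h1.w).hom))
  have h2 := CommRingCat.isPushout_iff_isPushout.mp h1.flip
  have h3 := fun hh ↦ bijective_of_isPushout (R := Γ(Spec (.of k), ⊤)) (S := Γ(T, U.1)) (R' := Γ(X, ⊤))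
    (S' := Γ(pullback π s, pullback.snd π s ⁻¹ᵁ U.1)) ε hh
  have h4 := h3 (by
    convert! H using 1
    funext a
    have h4 (x : Γ(X, ⊤)) : (X.presheaf.map (homOfLE (le_top : π ⁻¹ᵁ ⊤ ≤ ⊤)).op).hom x = x :=
      congr($(X.presheaf.map_id _).hom x)
    simp only [dualMap, RingHom.algebraMap_toAlgebra, h4]
    rw [show π.appLE ⊤ ⊤ le_top = π.app ⊤ from Hom.appLE_eq_app π]
    rfl)
  convert! h4 using 1
  funext a
  simp only [dualMap, RingHom.algebraMap_toAlgebra, Hom.appLE_eq_app]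
  rfl

end AlgebraicGeometry.Scheme

end

/-! ### The ring `R[ε]/(ε)²` and functions on `D × T` -/

noncomputable section

open Opposite TopologicalSpace

/-- The ring `R[ε₁, …, ε_r]/(ε₁, …, ε_r)²`. -/
abbrev DualRing (r : ℕ) (R : Type*) [CommRing R] := TrivSqZeroExt R (Fin r → R)

namespace DualRing

variable {r : ℕ} {R R' R'' : Type*} [CommRing R] [CommRing R'] [CommRing R'']

lemma snd_mul_apply (x y : DualRing r R) (l : Fin r) :
    (x * y).snd l = x.fst * y.snd l + y.fst * x.snd l := by
  simp [TrivSqZeroExt.snd_mul]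

lemma ext_iff' {x y : DualRing r R} : x = y ↔ x.fst = y.fst ∧ ∀ l, x.snd l = y.snd l :=
  ⟨fun h ↦ h ▸ ⟨rfl, fun _ ↦ rfl⟩, fun h ↦ TrivSqZeroExt.ext h.1 (funext h.2)⟩

/-- Functoriality of the ring of dual numbers. -/
def map (h : R →+* R') : DualRing r R →+* DualRing r R' where
  toFun x := TrivSqZeroExt.inl (h x.fst) + TrivSqZeroExt.inr (fun l ↦ h (x.snd l))
  map_one' := by refine ext_iff'.mpr ⟨?_, fun l ↦ ?_⟩ <;> simp
  map_zero' := by refine ext_iff'.mpr ⟨?_, fun l ↦ ?_⟩ <;> simp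
  map_add' x y := by refine ext_iff'.mpr ⟨?_, fun l ↦ ?_⟩ <;> simp
  map_mul' x y := by
    refine ext_iff'.mpr ⟨by simp, fun l ↦ ?_⟩
    rw [snd_mul_apply]
    simp

@[simp] lemma fst_map (h : R →+* R') (x : DualRing r R) : (map h x).fst = h x.fst := by
  simp [map]

@[simp] lemma snd_map (h : R →+* R') (x : DualRing r R) (l : Fin r) :
    (map h x).snd l = h (x.snd l) := by
  simp [map]

lemma map_map (h : R →+* R') (h' : R' →+* R'') (x : DualRing r R) :
    map h' (map h x) = map (h'.comp h) x := by
  refine ext_iff'.mpr ⟨?_, fun l ↦ ?_⟩ <;> simp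

end DualRing

namespace AlgebraicGeometry.Scheme

variable {r : ℕ} {X T : Scheme.{u}}

/-- The ring homomorphism `Γ(T)[ε] ⟶ Γ(X)` given by functions `ε_l` on `X` with `ε_l ε_m = 0`. -/
def dualHom (π : X ⟶ T) (ε : Fin r → Γ(X, ⊤)) (hε : ∀ l m, ε l * ε m = 0) :
    DualRing r Γ(T, ⊤) →+* Γ(X, ⊤) where
  toFun x := π.appTop.hom x.fst + ∑ l, π.appTop.hom (x.snd l) * ε l
  map_one' := by simp
  map_zero' := by simp
  map_add' x y := by
    simp only [TrivSqZeroExt.fst_add, TrivSqZeroExt.snd_add, Pi.add_apply, map_add, add_mul,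
      Finset.sum_add_distrib]
    ring
  map_mul' x y := by
    have h0 : (∑ l, π.appTop.hom (x.snd l) * ε l) * (∑ l, π.appTop.hom (y.snd l) * ε l) = 0 := by
      rw [Finset.sum_mul_sum]
      refine Finset.sum_eq_zero fun l _ ↦ Finset.sum_eq_zero fun m _ ↦ ?_
      linear_combination (π.appTop.hom (x.snd l) * π.appTop.hom (y.snd m)) * hε l m
    simp only [TrivSqZeroExt.fst_mul, DualRing.snd_mul_apply, map_add, map_mul, add_mul,
      Finset.sum_add_distrib, mul_assoc, ← Finset.mul_sum]
    linear_combination -h0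

lemma dualHom_apply (π : X ⟶ T) (ε : Fin r → Γ(X, ⊤)) (hε : ∀ l m, ε l * ε m = 0)
    (x : DualRing r Γ(T, ⊤)) :
    dualHom π ε hε x = π.appTop.hom x.fst + ∑ l, π.appTop.hom (x.snd l) * ε l := rfl

lemma dualHom_eq_dualMap (π : X ⟶ T) (ε : Fin r → Γ(X, ⊤)) (hε : ∀ l m, ε l * ε m = 0) :
    (dualHom π ε hε : DualRing r Γ(T, ⊤) → Γ(X, ⊤)) = dualMap π ε ⊤ := by
  funext x
  have h4 (x : Γ(X, ⊤)) : (X.presheaf.map (homOfLE (le_top : π ⁻¹ᵁ ⊤ ≤ ⊤)).op).hom x = x :=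
    congr($(X.presheaf.map_id _).hom x)
  simp only [dualMap, h4]
  rfl

/-- The `ε`-part has square zero, and a nilpotent summand does not change where a function is
invertible. -/
lemma basicOpen_dualHom (π : X ⟶ T) (ε : Fin r → Γ(X, ⊤)) (hε : ∀ l m, ε l * ε m = 0)
    (x : DualRing r Γ(T, ⊤)) :
    X.basicOpen (dualHom π ε hε x) = π ⁻¹ᵁ (T.basicOpen x.fst) := by
  have h0 : (∑ l, π.appTop.hom (x.snd l) * ε l) ^ 2 = 0 := by
    rw [sq, Finset.sum_mul_sum]
    refine Finset.sum_eq_zero fun l _ ↦ Finset.sum_eq_zero fun m _ ↦ ?_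
    linear_combination (π.appTop.hom (x.snd l) * π.appTop.hom (x.snd m)) * hε l m
  refine Eq.trans ?_ (Scheme.preimage_basicOpen_top π x.fst).symm
  ext z
  simp only [SetLike.mem_coe, Scheme.mem_basicOpen_top, dualHom_apply, map_add]
  have hn := IsNilpotent.map (⟨2, h0⟩ : IsNilpotent _) (X.presheaf.germ ⊤ z trivial).hom
  refine ⟨fun h ↦ ?_, fun h ↦ IsNilpotent.isUnit_add_left_of_commute hn h (Commute.all _ _)⟩
  have := IsNilpotent.isUnit_add_left_of_commute hn.neg h (Commute.all _ _)
  rwa [add_neg_cancel_right] at this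

/-- Only constant terms matter for the covering condition, and surjectivity of `π` lets it descend
from `X` to `T`. -/
lemma cover_dualHom_iff (π : X ⟶ T) [Surjective π] (ε : Fin r → Γ(X, ⊤))
    (hε : ∀ l m, ε l * ε m = 0) (x y : DualRing r Γ(T, ⊤)) :
    X.basicOpen (dualHom π ε hε x) ⊔ X.basicOpen (dualHom π ε hε y) = ⊤ ↔
      T.basicOpen x.fst ⊔ T.basicOpen y.fst = ⊤ := by
  rw [basicOpen_dualHom, basicOpen_dualHom]
  constructor
  · intro h
    refine top_le_iff.mp fun t _ ↦ ?_
    obtain ⟨z, rfl⟩ := π.surjective t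
    exact (h.symm ▸ Opens.mem_top z :
      z ∈ π ⁻¹ᵁ (T.basicOpen x.fst) ⊔ π ⁻¹ᵁ (T.basicOpen y.fst))
  · intro h
    refine top_le_iff.mp fun z _ ↦ ?_
    exact (h.symm ▸ Opens.mem_top (π z) : π z ∈ T.basicOpen x.fst ⊔ T.basicOpen y.fst)

end AlgebraicGeometry.Scheme

section Families

open AlgebraicGeometry.Scheme

/-- A basis of the functions on `D`, relative to the base `S`, of the form `1, ε_1, …, ε_r`
with `ε_l ε_m = 0`. -/
structure IsDualBasis {r : ℕ} {D S : Scheme.{u}} (π : D ⟶ S) (ε : Fin r → Γ(D, ⊤)) : Prop where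
  mul_eq_zero : ∀ l m, ε l * ε m = 0
  bijective : Function.Bijective (dualHom π ε mul_eq_zero)

variable {k : Type u} [Field k] {r : ℕ} {D T T' : Scheme.{u}} {π : D ⟶ Spec (.of k)}
  {ε : Fin r → Γ(D, ⊤)}

lemma IsDualBasis.pullback [QuasiCompact π] [QuasiSeparated π] (h : IsDualBasis π ε)
    (s : T ⟶ Spec (.of k)) :
    IsDualBasis (pullback.snd π s) (fun l ↦ (pullback.fst π s).appTop.hom (ε l)) where
  mul_eq_zero l m := by rw [← map_mul, h.mul_eq_zero, map_zero]
  bijective := by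
    rw [dualHom_eq_dualMap]
    refine dualMap_pullback_bijective π s ε ?_ ⊤
    rw [← dualHom_eq_dualMap π ε h.mul_eq_zero]
    exact h.bijective

/-- The identification of `Γ(D_T)` with `Γ(T)[ε]`. -/
def IsDualBasis.equiv [QuasiCompact π] [QuasiSeparated π] (h : IsDualBasis π ε)
    (s : T ⟶ Spec (.of k)) : DualRing r Γ(T, ⊤) ≃+* Γ(Limits.pullback π s, ⊤) :=
  RingEquiv.ofBijective _ (h.pullback s).bijective

lemma IsDualBasis.equiv_apply [QuasiCompact π] [QuasiSeparated π] (h : IsDualBasis π ε)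
    (s : T ⟶ Spec (.of k)) (x : DualRing r Γ(T, ⊤)) :
    h.equiv s x = dualHom (pullback.snd π s) (fun l ↦ (pullback.fst π s).appTop.hom (ε l))
      (h.pullback s).mul_eq_zero x := rfl

/-- Turns pullback of families along `f` into `DualRing.map`, coefficient by coefficient. -/
lemma IsDualBasis.equiv_map [QuasiCompact π] [QuasiSeparated π] (h : IsDualBasis π ε)
    (s : T ⟶ Spec (.of k)) (f : T' ⟶ T) (φ : Limits.pullback π (f ≫ s) ⟶ Limits.pullback π s)
    (h1 : φ ≫ pullback.fst π s = pullback.fst π (f ≫ s))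
    (h2 : φ ≫ pullback.snd π s = pullback.snd π (f ≫ s) ≫ f) (x : DualRing r Γ(T, ⊤)) :
    φ.appTop.hom (h.equiv s x) = h.equiv (f ≫ s) (DualRing.map f.appTop.hom x) := by
  have e1 (y : Γ(D, ⊤)) : φ.appTop.hom ((pullback.fst π s).appTop.hom y) =
      (pullback.fst π (f ≫ s)).appTop.hom y := by
    rw [← h1, Scheme.Hom.comp_appTop]; rfl
  have e2 (y : Γ(T, ⊤)) : φ.appTop.hom ((pullback.snd π s).appTop.hom y) =
      (pullback.snd π (f ≫ s)).appTop.hom (f.appTop.hom y) := by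
    rw [← CommRingCat.comp_apply, ← Scheme.Hom.comp_appTop, h2, Scheme.Hom.comp_appTop]; rfl
  simp only [IsDualBasis.equiv_apply, dualHom_apply, map_add, map_sum, map_mul, e1, e2,
    DualRing.fst_map, DualRing.snd_map]

end Families

end

/-! ### Morphisms to affine charts as dual numbers -/

noncomputable section

open Opposite TopologicalSpace

namespace AlgebraicGeometry.Scheme

section ToSpec

variable {U V : Scheme.{u}} {R R' : Type u} [CommRing R] [CommRing R']

/-- The morphism to `Spec R` given by a ring homomorphism `R ⟶ Γ(U)`. -/
def homOfRingHom (φ : R →+* Γ(U, ⊤)) : U ⟶ Spec (.of R) :=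
  U.toSpecΓ ≫ Spec.map (CommRingCat.ofHom φ)

/-- The ring homomorphism `R ⟶ Γ(U)` given by a morphism to `Spec R`. -/
def ringHomOfHom (a : U ⟶ Spec (.of R)) : R →+* Γ(U, ⊤) :=
  ((ΓSpecIso (.of R)).inv ≫ a.appTop).hom

lemma comp_homOfRingHom (f : V ⟶ U) (φ : R →+* Γ(U, ⊤)) :
    f ≫ homOfRingHom φ = homOfRingHom (f.appTop.hom.comp φ) := by
  rw [homOfRingHom, homOfRingHom, toSpecΓ_naturality_assoc, ← Spec.map_comp]
  rfl

lemma homOfRingHom_comp (φ : R →+* Γ(U, ⊤)) (ψ : R' →+* R) :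
    homOfRingHom φ ≫ Spec.map (CommRingCat.ofHom ψ) = homOfRingHom (φ.comp ψ) := by
  rw [homOfRingHom, homOfRingHom, Category.assoc, ← Spec.map_comp]
  rfl

lemma ringHomOfHom_homOfRingHom (φ : R →+* Γ(U, ⊤)) : ringHomOfHom (homOfRingHom φ) = φ := by
  rw [ringHomOfHom, homOfRingHom, Scheme.Hom.comp_appTop, ← Scheme.ΓSpecIso_inv_naturality_assoc]
  simp

lemma homOfRingHom_ringHomOfHom (a : U ⟶ Spec (.of R)) : homOfRingHom (ringHomOfHom a) = a := by
  rw [ringHomOfHom, homOfRingHom, CommRingCat.ofHom_hom, Spec.map_comp,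
    ← toSpecΓ_naturality_assoc]
  simp

lemma homOfRingHom_injective : Function.Injective (homOfRingHom : (R →+* Γ(U, ⊤)) → _) :=
  Function.LeftInverse.injective ringHomOfHom_homOfRingHom

lemma ringHomOfHom_comp (f : V ⟶ U) (a : U ⟶ Spec (.of R)) :
    ringHomOfHom (f ≫ a) = f.appTop.hom.comp (ringHomOfHom a) :=
  homOfRingHom_injective (by
    rw [homOfRingHom_ringHomOfHom, ← comp_homOfRingHom, homOfRingHom_ringHomOfHom])

end ToSpec

end AlgebraicGeometry.Scheme

open AlgebraicGeometry.Scheme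

section Charts

variable {k : Type u} [Field k] {r : ℕ} {U V : Scheme.{u}}

/-- The ring homomorphism `k[t][b] ⟶ Γ(U)` with `t + ∑ b_l ε_l ↦ H`. -/
def chartRingHom (s : U ⟶ Spec (.of k)) (H : DualRing r Γ(U, ⊤)) : TSChart k r →+* Γ(U, ⊤) :=
  MvPolynomial.eval₂Hom (Polynomial.eval₂RingHom (ringHomOfHom s) H.fst) H.snd

/-- The morphism to the chart `Spec k[t][b]` with `t + ∑ b_l ε_l ↦ H`. -/
def chartHom (s : U ⟶ Spec (.of k)) (H : DualRing r Γ(U, ⊤)) : U ⟶ Spec (.of (TSChart k r)) :=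
  homOfRingHom (chartRingHom s H)

lemma ringHom_tsChart_ext {A : Type*} [CommRing A] {φ ψ : TSChart k r →+* A}
    (h1 : ∀ c : k, φ (algebraMap k _ c) = ψ (algebraMap k _ c))
    (h2 : φ (MvPolynomial.C Polynomial.X) = ψ (MvPolynomial.C Polynomial.X))
    (h3 : ∀ l, φ (MvPolynomial.X l) = ψ (MvPolynomial.X l)) : φ = ψ :=
  MvPolynomial.ringHom_ext' (Polynomial.ringHom_ext (fun c ↦ h1 c) h2) h3

lemma chartRingHom_algebraMap (s : U ⟶ Spec (.of k)) (H : DualRing r Γ(U, ⊤)) (c : k) :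
    chartRingHom s H (algebraMap k _ c) = ringHomOfHom s c := by
  refine (MvPolynomial.eval₂Hom_C _ _ (Polynomial.C c)).trans ?_
  simp

lemma chartRingHom_t (s : U ⟶ Spec (.of k)) (H : DualRing r Γ(U, ⊤)) :
    chartRingHom s H (MvPolynomial.C Polynomial.X) = H.fst := by
  simp [chartRingHom]

lemma chartRingHom_b (s : U ⟶ Spec (.of k)) (H : DualRing r Γ(U, ⊤)) (l : Fin r) :
    chartRingHom s H (MvPolynomial.X l) = H.snd l := by
  simp [chartRingHom]

lemma chartHom_str (s : U ⟶ Spec (.of k)) (H : DualRing r Γ(U, ⊤)) :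
    chartHom s H ≫ tsChartStr k r = s := by
  rw [chartHom, tsChartStr, homOfRingHom_comp]
  refine Eq.trans ?_ (homOfRingHom_ringHomOfHom s)
  congr 1
  exact RingHom.ext fun c ↦ chartRingHom_algebraMap s H c

lemma comp_chartHom (f : V ⟶ U) (s : U ⟶ Spec (.of k)) (H : DualRing r Γ(U, ⊤)) :
    f ≫ chartHom s H = chartHom (f ≫ s) (DualRing.map f.appTop.hom H) := by
  rw [chartHom, comp_homOfRingHom, chartHom]
  congr 1
  refine ringHom_tsChart_ext (fun c ↦ ?_) ?_ fun l ↦ ?_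
  · rw [RingHom.comp_apply, chartRingHom_algebraMap, chartRingHom_algebraMap, ringHomOfHom_comp]
    rfl
  · rw [RingHom.comp_apply, chartRingHom_t, chartRingHom_t, DualRing.fst_map]
  · rw [RingHom.comp_apply, chartRingHom_b, chartRingHom_b, DualRing.snd_map]

/-- With `exists_eq_chartHom`, this makes `k`-morphisms to the chart `𝔸¹ × 𝔸ʳ` the same as elements
`t + ∑ b_l ε_l` of the dual ring. -/
lemma chartHom_injective (s : U ⟶ Spec (.of k)) :
    Function.Injective (chartHom (r := r) s) := by
  intro H H' h
  have h' := homOfRingHom_injective h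
  refine DualRing.ext_iff'.mpr ⟨?_, fun l ↦ ?_⟩
  · rw [← chartRingHom_t s H, h', chartRingHom_t]
  · rw [← chartRingHom_b s H, h', chartRingHom_b]

lemma exists_eq_chartHom (a : U ⟶ Spec (.of (TSChart k r))) :
    ∃ H, a = chartHom (a ≫ tsChartStr k r) H := by
  refine ⟨TrivSqZeroExt.inl (ringHomOfHom a (MvPolynomial.C Polynomial.X)) +
    TrivSqZeroExt.inr (fun l ↦ ringHomOfHom a (MvPolynomial.X l)), ?_⟩
  rw [← homOfRingHom_ringHomOfHom a, chartHom]
  congr 1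
  refine ringHom_tsChart_ext (fun c ↦ ?_) ?_ fun l ↦ ?_
  · rw [chartRingHom_algebraMap, tsChartStr, homOfRingHom_comp, ringHomOfHom_homOfRingHom]
    rfl
  · rw [chartRingHom_t, homOfRingHom_ringHomOfHom]; simp
  · rw [chartRingHom_b, homOfRingHom_ringHomOfHom]; simp

end Charts

/-! ### The two charts of the total space and their overlap -/

section TotalSpace

variable {k : Type u} [Field k] {n : ℤ} {r : ℕ} {U V : Scheme.{u}}

variable (k n r) in
/-- The chart of the total space over `{x₀ ≠ 0}`. -/
def tsι₀ : Spec (.of (TSChart k r)) ⟶ totalSpace k n r := pushout.inl _ _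

variable (k n r) in
/-- The chart of the total space over `{x₁ ≠ 0}`. -/
def tsι₁ : Spec (.of (TSChart k r)) ⟶ totalSpace k n r := pushout.inr _ _

lemma tsι_condition : tsMap₀ k r ≫ tsι₀ k n r = tsMap₁ k n r ≫ tsι₁ k n r :=
  pushout.condition

lemma tsι₀_str : tsι₀ k n r ≫ totalSpaceStr k n r = tsChartStr k r := pushout.inl_desc _ _ _

lemma tsι₁_str : tsι₁ k n r ≫ totalSpaceStr k n r = tsChartStr k r := pushout.inr_desc _ _ _

instance : IsOpenImmersion (tsι₀ k n r) :=
  inferInstanceAs (IsOpenImmersion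
    (colimit.ι (span (tsMap₀ k r) (tsMap₁ k n r)) WalkingSpan.left))

instance : IsOpenImmersion (tsι₁ k n r) :=
  inferInstanceAs (IsOpenImmersion
    (colimit.ι (span (tsMap₀ k r) (tsMap₁ k n r)) WalkingSpan.right))

lemma tsι_jointly_surjective (x : totalSpace k n r) :
    (∃ y, tsι₀ k n r y = x) ∨ ∃ y, tsι₁ k n r y = x := by
  obtain ⟨i, y, hy⟩ :=
    IsLocallyDirected.ι_jointly_surjective (span (tsMap₀ k r) (tsMap₁ k n r)) x
  rcases i with _ | (_ | _)
  · refine .inl ⟨tsMap₀ k r y, ?_⟩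
    rw [← hy, ← colimit.w (span (tsMap₀ k r) (tsMap₁ k n r)) WalkingSpan.Hom.fst]
    rfl
  · exact .inl ⟨y, hy⟩
  · exact .inr ⟨y, hy⟩

/-- A coincidence of points in a colimit along open immersions comes from an object mapping to both
charts; `WalkingSpan` has no arrow between its two legs, so that object is the overlap. -/
lemma exists_of_tsι_eq {x y : Spec (.of (TSChart k r))} (h : tsι₀ k n r x = tsι₁ k n r y) :
    ∃ z, tsMap₀ k r z = x ∧ tsMap₁ k n r z = y := by
  obtain ⟨i, f, g, z, h1, h2⟩ := (IsLocallyDirected.ι_eq_ι_iff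
    (span (tsMap₀ k r) (tsMap₁ k n r)) (i := WalkingSpan.left) (j := WalkingSpan.right)).mp h
  rcases i with _ | (_ | _)
  · obtain rfl : f = WalkingSpan.Hom.fst := Subsingleton.elim _ _
    obtain rfl : g = WalkingSpan.Hom.snd := Subsingleton.elim _ _
    exact ⟨z, h1, h2⟩
  · exact nomatch (show WidePushoutShape.Hom _ _ from g)
  · exact nomatch (show WidePushoutShape.Hom _ _ from f)

/-- Existence half of the fact that the overlap is the fibre product of the charts over the total
space. -/
lemma exists_lift_overlap (a b : U ⟶ Spec (.of (TSChart k r)))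
    (h : a ≫ tsι₀ k n r = b ≫ tsι₁ k n r) :
    ∃ c : U ⟶ Spec (.of (TSOverlap k r)), c ≫ tsMap₀ k r = a ∧ c ≫ tsMap₁ k n r = b := by
  have hr : Set.range a ⊆ Set.range (tsMap₀ k r) := by
    rintro _ ⟨u, rfl⟩
    have h1 : tsι₀ k n r (a u) = tsι₁ k n r (b u) := congr($h u)
    obtain ⟨z, hz, -⟩ := exists_of_tsι_eq h1
    exact ⟨z, hz⟩
  refine ⟨IsOpenImmersion.lift (tsMap₀ k r) a hr, IsOpenImmersion.lift_fac _ _ _, ?_⟩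
  rw [← cancel_mono (tsι₁ k n r), ← h, Category.assoc, ← tsι_condition,
    IsOpenImmersion.lift_fac_assoc]

end TotalSpace

/-! ### Change of chart as inversion of dual numbers -/

namespace DualRing

variable {r : ℕ} {R R' : Type*} [CommRing R] [CommRing R']

/-- The involution `ε_l ↦ -ε_l`. -/
def conj : DualRing r R →+* DualRing r R where
  toFun x := TrivSqZeroExt.inl x.fst - TrivSqZeroExt.inr x.snd
  map_one' := by refine ext_iff'.mpr ⟨?_, fun l ↦ ?_⟩ <;> simp
  map_zero' := by refine ext_iff'.mpr ⟨?_, fun l ↦ ?_⟩ <;> simp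
  map_add' x y := by
    refine ext_iff'.mpr ⟨by simp, fun l ↦ ?_⟩
    simp
    ring
  map_mul' x y := by
    refine ext_iff'.mpr ⟨by simp, fun l ↦ ?_⟩
    rw [snd_mul_apply]
    simp
    ring

@[simp] lemma fst_conj (x : DualRing r R) : (conj x).fst = x.fst := by simp [conj]

@[simp] lemma snd_conj (x : DualRing r R) (l : Fin r) : (conj x).snd l = -x.snd l := by
  simp [conj]

@[simp] lemma conj_conj (x : DualRing r R) : conj (conj x) = x :=
  ext_iff'.mpr ⟨by simp, fun l ↦ by simp⟩

lemma map_conj (h : R →+* R') (x : DualRing r R) : map h (conj x) = conj (map h x) :=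
  ext_iff'.mpr ⟨by simp, fun l ↦ by simp⟩

lemma isUnit_iff {x : DualRing r R} : IsUnit x ↔ IsUnit x.fst := TrivSqZeroExt.isUnit_iff_isUnit_fst

end DualRing

section Overlap

open LaurentPolynomial

variable {k : Type u} [Field k] {r : ℕ} {U V : Scheme.{u}}

lemma tsIncl_t : tsIncl k r (MvPolynomial.C Polynomial.X) = MvPolynomial.C (T 1) := by
  simp [tsIncl]

lemma tsIncl_b (l : Fin r) : tsIncl k r (MvPolynomial.X l) = MvPolynomial.X l := by
  simp [tsIncl]

lemma tsIncl_algebraMap (c : k) :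
    tsIncl k r (algebraMap k _ c) = MvPolynomial.C (LaurentPolynomial.C c) := by
  rw [tsIncl, IsScalarTower.algebraMap_apply k (Polynomial k) (TSChart k r),
    MvPolynomial.algebraMap_eq, MvPolynomial.map_C]
  exact congrArg _ (Polynomial.toLaurent_C c)

lemma homOfRingHom_tsMap₀ (τ : TSOverlap k r →+* Γ(U, ⊤)) :
    homOfRingHom τ ≫ tsMap₀ k r = homOfRingHom (τ.comp (tsIncl k r)) :=
  homOfRingHom_comp _ _

lemma homOfRingHom_tsMap₁ (n : ℤ) (τ : TSOverlap k r →+* Γ(U, ⊤)) :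
    homOfRingHom τ ≫ tsMap₁ k n r = homOfRingHom (τ.comp ((tsTwist k n r).comp (tsIncl k r))) := by
  rw [tsMap₁, tsMap₀, ← Category.assoc, homOfRingHom_comp, homOfRingHom_comp]
  rfl

/-- This is where the twist `-2` comes from: the inverse of `t + ∑ b_l ε_l` is `t⁻¹ - ∑ t⁻² b_l
ε_l`, and `DualRing.conj` in the second chart removes the sign. -/
lemma mul_eq_one_of_tsι_eq (s s' : U ⟶ Spec (.of k)) (H K : DualRing r Γ(U, ⊤))
    (h : chartHom s H ≫ tsι₀ k (-2) r = chartHom s' (DualRing.conj K) ≫ tsι₁ k (-2) r) :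
    H * K = 1 := by
  obtain ⟨c, h0, h1⟩ := exists_lift_overlap _ _ h
  rw [← homOfRingHom_ringHomOfHom c] at h0 h1
  rw [homOfRingHom_tsMap₀] at h0
  rw [homOfRingHom_tsMap₁] at h1
  replace h0 := homOfRingHom_injective h0
  replace h1 := homOfRingHom_injective h1
  set τ := ringHomOfHom c
  have e1 : τ (MvPolynomial.C (T 1)) = H.fst := by
    rw [← chartRingHom_t s H, ← h0, RingHom.comp_apply, tsIncl_t]
  have e2 (l) : τ (MvPolynomial.X l) = H.snd l := by
    rw [← chartRingHom_b s H, ← h0, RingHom.comp_apply, tsIncl_b]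
  have e3 : τ (MvPolynomial.C (T (-1))) = K.fst := by
    rw [← DualRing.fst_conj, ← chartRingHom_t s' (DualRing.conj K), ← h1, RingHom.comp_apply,
      RingHom.comp_apply, tsIncl_t, tsTwist_C, invert_T]
  have e4 (l) : τ (MvPolynomial.C (T (-2))) * H.snd l = -K.snd l := by
    rw [← DualRing.snd_conj, ← chartRingHom_b s' (DualRing.conj K), ← h1, RingHom.comp_apply,
      RingHom.comp_apply, tsIncl_b, tsTwist_X, map_mul, e2]
  have e5 : H.fst * K.fst = 1 := by
    rw [← e1, ← e3, ← map_mul, ← map_mul, ← T_add]; simp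
  have e6 : τ (MvPolynomial.C (T (-2))) = K.fst * K.fst := by
    rw [← e3, ← map_mul, ← map_mul, ← T_add]; norm_num
  refine DualRing.ext_iff'.mpr ⟨by simpa using e5, fun l ↦ ?_⟩
  rw [DualRing.snd_mul_apply]
  simp only [TrivSqZeroExt.snd_one, Pi.zero_apply]
  have := e4 l
  rw [e6] at this
  linear_combination H.fst * this - K.fst * H.snd l * e5

/-- The constant term of an invertible `H` is a unit, so the chart map of `H` extends to `k[t,
t⁻¹][b]` and factors through the overlap; the formula for the inverse identifies it in the other
chart. -/
lemma tsι_eq_of_mul_eq_one (s : U ⟶ Spec (.of k)) (H K : DualRing r Γ(U, ⊤)) (h : H * K = 1) :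
    chartHom s H ≫ tsι₀ k (-2) r = chartHom s (DualRing.conj K) ≫ tsι₁ k (-2) r := by
  have e5 : H.fst * K.fst = 1 := by
    simpa using (DualRing.ext_iff'.mp h).1
  have e6 (l) : H.fst * K.snd l + K.fst * H.snd l = 0 := by
    simpa [DualRing.snd_mul_apply] using (DualRing.ext_iff'.mp h).2 l
  let t : Γ(U, ⊤)ˣ := ⟨H.fst, K.fst, e5, by rw [mul_comm, e5]⟩
  let τ : TSOverlap k r →+* Γ(U, ⊤) :=
    MvPolynomial.eval₂Hom (LaurentPolynomial.eval₂ (ringHomOfHom s) t) H.snd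
  have e0 : homOfRingHom τ ≫ tsMap₀ k r = chartHom s H := by
    rw [homOfRingHom_tsMap₀, chartHom]
    congr 1
    refine ringHom_tsChart_ext (fun c ↦ ?_) ?_ fun l ↦ ?_
    · rw [RingHom.comp_apply, tsIncl_algebraMap, chartRingHom_algebraMap]; simp [τ]
    · rw [RingHom.comp_apply, tsIncl_t, chartRingHom_t]; simp [τ, t]
    · rw [RingHom.comp_apply, tsIncl_b, chartRingHom_b]; simp [τ]
  have e1 : homOfRingHom τ ≫ tsMap₁ k (-2) r = chartHom s (DualRing.conj K) := by
    rw [homOfRingHom_tsMap₁, chartHom]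
    congr 1
    refine ringHom_tsChart_ext (fun c ↦ ?_) ?_ fun l ↦ ?_
    · rw [RingHom.comp_apply, RingHom.comp_apply, tsIncl_algebraMap, chartRingHom_algebraMap,
        tsTwist_C]
      simp [τ]
    · rw [RingHom.comp_apply, RingHom.comp_apply, tsIncl_t, chartRingHom_t, tsTwist_C]
      simp [τ, t]
    · rw [RingHom.comp_apply, RingHom.comp_apply, tsIncl_b, chartRingHom_b, tsTwist_X,
        map_mul]
      have : τ (MvPolynomial.C (T (-2))) = K.fst ^ 2 := by
        simp [τ, t]
      rw [this]
      simp [τ]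
      linear_combination K.fst * e6 l - K.snd l * e5
  rw [← e0, ← e1, Category.assoc, Category.assoc, tsι_condition]

end Overlap

end

/-! ### The classifying morphism of a pair `(F : G)` -/

noncomputable section

open Opposite TopologicalSpace AlgebraicGeometry.Scheme

section Classifying

variable {k : Type u} [Field k] {r : ℕ} {T U V : Scheme.{u}}

lemma DualRing.map_appTop_comp (f : U ⟶ V) (g : V ⟶ T) (x : DualRing r Γ(T, ⊤)) :
    DualRing.map f.appTop.hom (DualRing.map g.appTop.hom x) =
      DualRing.map (f ≫ g).appTop.hom x := by
  rw [DualRing.map_map, Scheme.Hom.comp_appTop]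
  rfl

/-- `m` is the morphism `T ⟶ E` to the total space with homogeneous coordinates `(F : G)`:
in the first chart it is `G / F`, in the second chart `F / G`. -/
structure IsClassifying (s : T ⟶ Spec (.of k)) (F G : DualRing r Γ(T, ⊤))
    (m : T ⟶ totalSpace k (-2) r) : Prop where
  left : ∀ (U : Scheme.{u}) (h : U ⟶ T) (H : DualRing r Γ(U, ⊤)),
    IsUnit (DualRing.map h.appTop.hom F) →
    DualRing.map h.appTop.hom F * H = DualRing.map h.appTop.hom G →
    h ≫ m = chartHom (h ≫ s) H ≫ tsι₀ k (-2) r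
  right : ∀ (U : Scheme.{u}) (h : U ⟶ T) (K : DualRing r Γ(U, ⊤)),
    IsUnit (DualRing.map h.appTop.hom G) →
    DualRing.map h.appTop.hom G * K = DualRing.map h.appTop.hom F →
    h ≫ m = chartHom (h ≫ s) (DualRing.conj K) ≫ tsι₁ k (-2) r

lemma IsClassifying.comp {s : T ⟶ Spec (.of k)} {F G : DualRing r Γ(T, ⊤)}
    {m : T ⟶ totalSpace k (-2) r} (hm : IsClassifying s F G m) (f : V ⟶ T) :
    IsClassifying (f ≫ s) (DualRing.map f.appTop.hom F) (DualRing.map f.appTop.hom G) (f ≫ m) where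
  left U h H h1 h2 := by
    rw [DualRing.map_appTop_comp] at h1 h2
    rw [DualRing.map_appTop_comp] at h2
    rw [← Category.assoc, ← Category.assoc]
    exact hm.left U (h ≫ f) H h1 h2
  right U h H h1 h2 := by
    rw [DualRing.map_appTop_comp] at h1 h2
    rw [DualRing.map_appTop_comp] at h2
    rw [← Category.assoc, ← Category.assoc]
    exact hm.right U (h ≫ f) H h1 h2

lemma isUnit_of_basicOpen_eq_top {f : Γ(T, ⊤)} (h : T.basicOpen f = ⊤) : IsUnit f :=
  T.toRingedSpace.isUnit_of_isUnit_germ ⊤ f fun x _ ↦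
    (T.mem_basicOpen_top f x).mp (h.symm ▸ Opens.mem_top x)

lemma isUnit_appTop_basicOpen (f : Γ(T, ⊤)) : IsUnit ((T.basicOpen f).ι.appTop.hom f) := by
  refine isUnit_of_basicOpen_eq_top ?_
  refine (Scheme.preimage_basicOpen_top (T.basicOpen f).ι f).symm.trans ?_
  exact top_le_iff.mp fun x _ ↦ x.2

lemma isUnit_map_basicOpen (F : DualRing r Γ(T, ⊤)) :
    IsUnit (DualRing.map (T.basicOpen F.fst).ι.appTop.hom F) := by
  rw [DualRing.isUnit_iff, DualRing.fst_map]
  exact isUnit_appTop_basicOpen F.fst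

lemma exists_lift_of_isUnit {f : Γ(T, ⊤)} (h : U ⟶ T) (hf : IsUnit (h.appTop.hom f)) :
    ∃ h' : U ⟶ T.basicOpen f, h' ≫ (T.basicOpen f).ι = h := by
  refine ⟨IsOpenImmersion.lift (T.basicOpen f).ι h ?_, IsOpenImmersion.lift_fac _ _ _⟩
  rintro _ ⟨u, rfl⟩
  have : h ⁻¹ᵁ T.basicOpen f = ⊤ := by
    rw [Scheme.preimage_basicOpen_top]
    exact Scheme.basicOpen_of_isUnit _ hf
  rw [Scheme.Opens.range_ι]
  exact (this.symm ▸ Opens.mem_top u : u ∈ h ⁻¹ᵁ T.basicOpen f)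

lemma hom_ext_of_cover {E : Scheme.{u}} (f g : Γ(T, ⊤)) (h : T.basicOpen f ⊔ T.basicOpen g = ⊤)
    {a b : T ⟶ E} (h1 : (T.basicOpen f).ι ≫ a = (T.basicOpen f).ι ≫ b)
    (h2 : (T.basicOpen g).ι ≫ a = (T.basicOpen g).ι ≫ b) : a = b := by
  refine Scheme.hom_ext_of_forall _ _ fun x ↦ ?_
  rcases (h.symm ▸ Opens.mem_top x : x ∈ T.basicOpen f ⊔ T.basicOpen g) with hx | hx
  · exact ⟨_, hx, h1⟩
  · exact ⟨_, hx, h2⟩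

lemma exists_hom_of_iSup_eq_top {E : Scheme.{u}} {ι : Type*} (U : ι → T.Opens) (hU : ⨆ i, U i = ⊤)
    (a : ∀ i, (U i).toScheme ⟶ E)
    (ha : ∀ i j {V : Scheme.{u}} (v : V ⟶ U i) (w : V ⟶ U j), v ≫ (U i).ι = w ≫ (U j).ι →
      v ≫ a i = w ≫ a j) :
    ∃ c : T ⟶ E, ∀ i, (U i).ι ≫ c = a i := by
  let 𝒰 := T.openCoverOfIsOpenCover U hU
  have h : ∀ x y : ι, pullback.fst (𝒰.f x) (𝒰.f y) ≫ a x = pullback.snd (𝒰.f x) (𝒰.f y) ≫ a y :=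
    fun x y ↦ ha x y _ _ pullback.condition
  exact ⟨Cover.glueMorphisms 𝒰 a h, fun i ↦ Cover.ι_glueMorphisms 𝒰 a h i⟩

lemma exists_hom_of_cover {E : Scheme.{u}} (f g : Γ(T, ⊤))
    (h : T.basicOpen f ⊔ T.basicOpen g = ⊤)
    (a : (T.basicOpen f).toScheme ⟶ E) (b : (T.basicOpen g).toScheme ⟶ E)
    (hab : ∀ {V : Scheme.{u}} (v : V ⟶ T.basicOpen f) (w : V ⟶ T.basicOpen g),
      v ≫ (T.basicOpen f).ι = w ≫ (T.basicOpen g).ι → v ≫ a = w ≫ b) :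
    ∃ c : T ⟶ E, (T.basicOpen f).ι ≫ c = a ∧ (T.basicOpen g).ι ≫ c = b := by
  obtain ⟨c, hc⟩ := exists_hom_of_iSup_eq_top (T := T) (E := E)
    (fun i : Bool ↦ Bool.rec (T.basicOpen g) (T.basicOpen f) i)
    (iSup_bool_eq.trans h) (fun i ↦ Bool.rec b a i) (by
      rintro (_ | _) (_ | _) V v w hvw
      · rw [(cancel_mono (T.basicOpen g).ι).mp hvw]
      · exact (hab _ _ hvw.symm).symm
      · exact hab _ _ hvw
      · rw [(cancel_mono (T.basicOpen f).ι).mp hvw])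
  exact ⟨c, hc true, hc false⟩

/-- The second clause concerns test schemes on which `F` and `G` are both invertible; there the two
ratios are inverse to each other and the gluing relation applies. -/
lemma isClassifying_left (s : T ⟶ Spec (.of k)) {F G : DualRing r Γ(T, ⊤)} (hF : IsUnit F)
    {H : DualRing r Γ(T, ⊤)} (hH : F * H = G) :
    IsClassifying s F G (chartHom s H ≫ tsι₀ k (-2) r) where
  left U h H' h1 h2 := by
    have : DualRing.map h.appTop.hom H = H' := by
      refine h1.mul_left_cancel ?_
      rw [h2, ← hH, map_mul]
    rw [← Category.assoc, comp_chartHom, this]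
  right U h K h1 h2 := by
    rw [← Category.assoc, comp_chartHom]
    refine tsι_eq_of_mul_eq_one _ _ _ (h1.mul_left_cancel ?_)
    have hF' := hF.map (DualRing.map h.appTop.hom)
    refine hF'.mul_left_cancel ?_
    rw [← hH, map_mul] at h2 ⊢
    linear_combination (DualRing.map h.appTop.hom F * DualRing.map h.appTop.hom H) * h2

lemma isClassifying_right (s : T ⟶ Spec (.of k)) {F G : DualRing r Γ(T, ⊤)} (hG : IsUnit G)
    {K : DualRing r Γ(T, ⊤)} (hK : G * K = F) :
    IsClassifying s F G (chartHom s (DualRing.conj K) ≫ tsι₁ k (-2) r) where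
  right U h K' h1 h2 := by
    have : DualRing.map h.appTop.hom K = K' := by
      refine h1.mul_left_cancel ?_
      rw [h2, ← hK, map_mul]
    rw [← Category.assoc, comp_chartHom, DualRing.map_conj, this]
  left U h H h1 h2 := by
    rw [← Category.assoc, comp_chartHom, DualRing.map_conj]
    refine (tsι_eq_of_mul_eq_one _ _ _ (h1.mul_left_cancel ?_)).symm
    have hG' := hG.map (DualRing.map h.appTop.hom)
    refine hG'.mul_left_cancel ?_
    rw [← hK, map_mul] at h2 ⊢
    linear_combination (DualRing.map h.appTop.hom G * DualRing.map h.appTop.hom K) * h2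

lemma exists_mul_eq_of_isUnit {A : Type*} [CommRing A] {F : A} (hF : IsUnit F) (G : A) :
    ∃ H, F * H = G := hF.dvd.imp fun _ h ↦ h.symm

lemma IsClassifying.unique {s : T ⟶ Spec (.of k)} {F G : DualRing r Γ(T, ⊤)}
    (hFG : T.basicOpen F.fst ⊔ T.basicOpen G.fst = ⊤) {m m' : T ⟶ totalSpace k (-2) r}
    (hm : IsClassifying s F G m) (hm' : IsClassifying s F G m') : m = m' := by
  refine hom_ext_of_cover _ _ hFG ?_ ?_
  · obtain ⟨H, hH⟩ := exists_mul_eq_of_isUnit (isUnit_map_basicOpen F)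
      (DualRing.map (T.basicOpen F.fst).ι.appTop.hom G)
    rw [hm.left _ _ H (isUnit_map_basicOpen F) hH, hm'.left _ _ H (isUnit_map_basicOpen F) hH]
  · obtain ⟨H, hH⟩ := exists_mul_eq_of_isUnit (isUnit_map_basicOpen G)
      (DualRing.map (T.basicOpen G.fst).ι.appTop.hom F)
    rw [hm.right _ _ H (isUnit_map_basicOpen G) hH, hm'.right _ _ H (isUnit_map_basicOpen G) hH]

lemma exists_isClassifying (s : T ⟶ Spec (.of k)) (F G : DualRing r Γ(T, ⊤))
    (hFG : T.basicOpen F.fst ⊔ T.basicOpen G.fst = ⊤) :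
    ∃ m : T ⟶ totalSpace k (-2) r, IsClassifying s F G m := by
  obtain ⟨H, hH⟩ := exists_mul_eq_of_isUnit (isUnit_map_basicOpen F)
    (DualRing.map (T.basicOpen F.fst).ι.appTop.hom G)
  obtain ⟨K, hK⟩ := exists_mul_eq_of_isUnit (isUnit_map_basicOpen G)
    (DualRing.map (T.basicOpen G.fst).ι.appTop.hom F)
  have h0 := isClassifying_left ((T.basicOpen F.fst).ι ≫ s) (isUnit_map_basicOpen F) hH
  have h1 := isClassifying_right ((T.basicOpen G.fst).ι ≫ s) (isUnit_map_basicOpen G) hK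
  -- On the overlap both candidates classify the same pair, and `F` is invertible, so they agree by
  -- uniqueness.
  obtain ⟨m, hm0, hm1⟩ := exists_hom_of_cover F.fst G.fst hFG _ _ fun {V} v w hvw ↦ by
    have h0' := h0.comp v
    have h1' := h1.comp w
    rw [DualRing.map_appTop_comp, DualRing.map_appTop_comp] at h0' h1'
    rw [← Category.assoc, ← hvw] at h1'
    rw [← Category.assoc] at h0'
    have hu := (isUnit_map_basicOpen F).map (DualRing.map v.appTop.hom)
    rw [DualRing.map_appTop_comp] at hu
    refine h0'.unique ?_ h1'
    rw [Scheme.basicOpen_of_isUnit _ (DualRing.isUnit_iff.mp hu)]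
    exact top_sup_eq _
  refine ⟨m, ⟨fun U h H' h2 h3 ↦ ?_, fun U h H' h2 h3 ↦ ?_⟩⟩
  · obtain ⟨h', rfl⟩ := exists_lift_of_isUnit h (f := F.fst)
      (by rw [← DualRing.fst_map]; exact DualRing.isUnit_iff.mp h2)
    rw [← DualRing.map_appTop_comp] at h2 h3
    rw [← DualRing.map_appTop_comp] at h3
    rw [Category.assoc, hm0, h0.left U h' H' h2 h3, Category.assoc]
  · obtain ⟨h', rfl⟩ := exists_lift_of_isUnit h (f := G.fst)
      (by rw [← DualRing.fst_map]; exact DualRing.isUnit_iff.mp h2)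
    rw [← DualRing.map_appTop_comp] at h2 h3
    rw [← DualRing.map_appTop_comp] at h3
    rw [Category.assoc, hm1, h1.right U h' H' h2 h3, Category.assoc]

lemma IsClassifying.str {s : T ⟶ Spec (.of k)} {F G : DualRing r Γ(T, ⊤)}
    (hFG : T.basicOpen F.fst ⊔ T.basicOpen G.fst = ⊤) {m : T ⟶ totalSpace k (-2) r}
    (hm : IsClassifying s F G m) : m ≫ totalSpaceStr k (-2) r = s := by
  refine hom_ext_of_cover _ _ hFG ?_ ?_
  · obtain ⟨H, hH⟩ := exists_mul_eq_of_isUnit (isUnit_map_basicOpen F)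
      (DualRing.map (T.basicOpen F.fst).ι.appTop.hom G)
    rw [← Category.assoc, hm.left _ _ H (isUnit_map_basicOpen F) hH, Category.assoc, tsι₀_str,
      chartHom_str]
  · obtain ⟨H, hH⟩ := exists_mul_eq_of_isUnit (isUnit_map_basicOpen G)
      (DualRing.map (T.basicOpen G.fst).ι.appTop.hom F)
    rw [← Category.assoc, hm.right _ _ H (isUnit_map_basicOpen G) hH, Category.assoc, tsι₁_str,
      chartHom_str]

/-- A common unit cancels in the ratios `G / F` and `F / G`. -/
lemma IsClassifying.of_unit_mul {s : T ⟶ Spec (.of k)} {F G : DualRing r Γ(T, ⊤)}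
    {m : T ⟶ totalSpace k (-2) r} (hm : IsClassifying s F G m) {u : DualRing r Γ(T, ⊤)}
    (hu : IsUnit u) : IsClassifying s (u * F) (u * G) m where
  left U h H h1 h2 := by
    rw [map_mul] at h1 h2
    rw [map_mul, mul_assoc] at h2
    exact hm.left U h H (isUnit_of_mul_isUnit_right h1)
      ((hu.map (DualRing.map h.appTop.hom)).mul_left_cancel h2)
  right U h H h1 h2 := by
    rw [map_mul] at h1 h2
    rw [map_mul, mul_assoc] at h2
    exact hm.right U h H (isUnit_of_mul_isUnit_right h1)
      ((hu.map (DualRing.map h.appTop.hom)).mul_left_cancel h2)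

end Classifying

end

noncomputable section

open Opposite TopologicalSpace AlgebraicGeometry.Scheme

section Classifying

variable {k : Type u} [Field k] {r : ℕ} {T U V : Scheme.{u}}

lemma le_basicOpen_of_isUnit (W : T.Opens) {f : Γ(T, ⊤)} (h : IsUnit (W.ι.appTop.hom f)) :
    W ≤ T.basicOpen f := by
  obtain ⟨h', e⟩ := exists_lift_of_isUnit W.ι h
  intro x hx
  have := congr($e ⟨x, hx⟩)
  exact (show (T.basicOpen f).ι (h' ⟨x, hx⟩) = x from this) ▸ (h' ⟨x, hx⟩).2

/-- Dual numbers are morphisms to the chart `𝔸¹ × 𝔸ʳ`, so they can be glued as morphisms. -/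
lemma exists_dualRing_of_cover (s : T ⟶ Spec (.of k)) (f g : Γ(T, ⊤))
    (h : T.basicOpen f ⊔ T.basicOpen g = ⊤)
    (a : DualRing r Γ(T.basicOpen f, ⊤)) (b : DualRing r Γ(T.basicOpen g, ⊤))
    (hab : ∀ {V : Scheme.{u}} (v : V ⟶ T.basicOpen f) (w : V ⟶ T.basicOpen g),
      v ≫ (T.basicOpen f).ι = w ≫ (T.basicOpen g).ι →
        DualRing.map v.appTop.hom a = DualRing.map w.appTop.hom b) :
    ∃ c : DualRing r Γ(T, ⊤), DualRing.map (T.basicOpen f).ι.appTop.hom c = a ∧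
      DualRing.map (T.basicOpen g).ι.appTop.hom c = b := by
  obtain ⟨m, hm0, hm1⟩ := exists_hom_of_cover f g h (chartHom ((T.basicOpen f).ι ≫ s) a)
    (chartHom ((T.basicOpen g).ι ≫ s) b) fun v w hvw ↦ by
      rw [comp_chartHom, comp_chartHom, hab v w hvw, ← Category.assoc, hvw, Category.assoc]
  have hs : m ≫ tsChartStr k r = s := hom_ext_of_cover f g h
    (by rw [← Category.assoc, hm0, chartHom_str]) (by rw [← Category.assoc, hm1, chartHom_str])
  obtain ⟨c, hc⟩ := exists_eq_chartHom m
  rw [hs] at hc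
  rw [hc, comp_chartHom] at hm0 hm1
  exact ⟨c, chartHom_injective _ hm0, chartHom_injective _ hm1⟩

lemma dualRing_ext_of_cover (s : T ⟶ Spec (.of k)) (f g : Γ(T, ⊤))
    (h : T.basicOpen f ⊔ T.basicOpen g = ⊤) {a b : DualRing r Γ(T, ⊤)}
    (h1 : DualRing.map (T.basicOpen f).ι.appTop.hom a =
      DualRing.map (T.basicOpen f).ι.appTop.hom b)
    (h2 : DualRing.map (T.basicOpen g).ι.appTop.hom a =
      DualRing.map (T.basicOpen g).ι.appTop.hom b) : a = b := by
  refine chartHom_injective s (hom_ext_of_cover f g h ?_ ?_)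
  · rw [comp_chartHom, comp_chartHom, h1]
  · rw [comp_chartHom, comp_chartHom, h2]

lemma cover_map (h : U ⟶ T) {F G : DualRing r Γ(T, ⊤)}
    (hFG : T.basicOpen F.fst ⊔ T.basicOpen G.fst = ⊤) :
    U.basicOpen (DualRing.map h.appTop.hom F).fst ⊔
      U.basicOpen (DualRing.map h.appTop.hom G).fst = ⊤ := by
  rw [DualRing.fst_map, DualRing.fst_map, ← Scheme.preimage_basicOpen_top,
    ← Scheme.preimage_basicOpen_top]
  refine top_le_iff.mp fun x _ ↦ ?_
  exact (hFG.symm ▸ Opens.mem_top (h x) : h x ∈ T.basicOpen F.fst ⊔ T.basicOpen G.fst)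

namespace IsClassifying

variable {s : T ⟶ Spec (.of k)} {F G F' G' : DualRing r Γ(T, ⊤)} {m : T ⟶ totalSpace k (-2) r}

/-- `F'` is invertible on its own basic open. Where `G'` is invertible, `G / F` in the first chart
and `F' / G'` in the second describe the same morphism, so their product is `1` and `F'` is
invertible there too. -/
lemma isUnit_left (hm : IsClassifying s F G m) (hm' : IsClassifying s F' G' m)
    (hFG' : T.basicOpen F'.fst ⊔ T.basicOpen G'.fst = ⊤) (hF : IsUnit F) : IsUnit F' := by
  refine DualRing.isUnit_iff.mpr (isUnit_of_basicOpen_eq_top ?_)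
  refine top_le_iff.mp (hFG'.symm.le.trans ?_)
  refine sup_le le_rfl (le_basicOpen_of_isUnit _ ?_)
  rw [← DualRing.fst_map]
  refine DualRing.isUnit_iff.mp ?_
  set ι := (T.basicOpen G'.fst).ι
  have hF1 := hF.map (DualRing.map ι.appTop.hom)
  have hG1 : IsUnit (DualRing.map ι.appTop.hom G') := isUnit_map_basicOpen G'
  obtain ⟨H, hH⟩ := exists_mul_eq_of_isUnit hF1 (DualRing.map ι.appTop.hom G)
  obtain ⟨K, hK⟩ := exists_mul_eq_of_isUnit hG1 (DualRing.map ι.appTop.hom F')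
  have := mul_eq_one_of_tsι_eq _ _ _ _ ((hm.left _ ι H hF1 hH).symm.trans (hm'.right _ ι K hG1 hK))
  rw [← hK]
  exact hG1.mul (.of_mul_eq_one_right _ this)

lemma isUnit_right (hm : IsClassifying s F G m) (hm' : IsClassifying s F' G' m)
    (hFG' : T.basicOpen F'.fst ⊔ T.basicOpen G'.fst = ⊤) (hG : IsUnit G) : IsUnit G' := by
  refine DualRing.isUnit_iff.mpr (isUnit_of_basicOpen_eq_top ?_)
  refine top_le_iff.mp (hFG'.symm.le.trans ?_)
  refine sup_le (le_basicOpen_of_isUnit _ ?_) le_rfl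
  rw [← DualRing.fst_map]
  refine DualRing.isUnit_iff.mp ?_
  set ι := (T.basicOpen F'.fst).ι
  have hG1 := hG.map (DualRing.map ι.appTop.hom)
  have hF1 : IsUnit (DualRing.map ι.appTop.hom F') := isUnit_map_basicOpen F'
  obtain ⟨H, hH⟩ := exists_mul_eq_of_isUnit hF1 (DualRing.map ι.appTop.hom G')
  obtain ⟨K, hK⟩ := exists_mul_eq_of_isUnit hG1 (DualRing.map ι.appTop.hom F)
  have := mul_eq_one_of_tsι_eq _ _ _ _ ((hm'.left _ ι H hF1 hH).symm.trans (hm.right _ ι K hG1 hK))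
  rw [← hH]
  exact hF1.mul (.of_mul_eq_one _ this)

/-- Both pairs live in the first chart, where coordinates are unique, so `G / F = G' / F'`; the
factor is `u = F' / F`. -/
lemma exists_unit_of_isUnit_left (hm : IsClassifying s F G m) (hm' : IsClassifying s F' G' m)
    (hFG' : T.basicOpen F'.fst ⊔ T.basicOpen G'.fst = ⊤) (hF : IsUnit F) :
    ∃ u, IsUnit u ∧ F' = u * F ∧ G' = u * G := by
  have hF' := hm.isUnit_left hm' hFG' hF
  obtain ⟨H, hH⟩ := exists_mul_eq_of_isUnit hF G
  obtain ⟨H', hH'⟩ := exists_mul_eq_of_isUnit hF' G'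
  have := (hm.comp (𝟙 T)).unique (by
    rw [DualRing.fst_map, Scheme.basicOpen_of_isUnit _ ((DualRing.isUnit_iff.mp hF).map _)]
    exact top_sup_eq _) ((isClassifying_left s hF hH).comp (𝟙 T))
  have := (hm'.comp (𝟙 T)).unique (cover_map _ hFG') ((isClassifying_left s hF' hH').comp (𝟙 T))
  simp only [Category.id_comp] at *
  obtain rfl : H = H' := chartHom_injective s <| (cancel_mono (tsι₀ k (-2) r)).mp
    (by simp_all)
  obtain ⟨u, hu⟩ := exists_mul_eq_of_isUnit hF F'
  refine ⟨u, isUnit_of_mul_isUnit_right (hu ▸ hF'), by rw [mul_comm, hu], ?_⟩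
  rw [← hH', ← hu, ← hH]
  ring

lemma exists_unit_of_isUnit_right (hm : IsClassifying s F G m) (hm' : IsClassifying s F' G' m)
    (hFG' : T.basicOpen F'.fst ⊔ T.basicOpen G'.fst = ⊤) (hG : IsUnit G) :
    ∃ u, IsUnit u ∧ F' = u * F ∧ G' = u * G := by
  have hG' := hm.isUnit_right hm' hFG' hG
  obtain ⟨K, hK⟩ := exists_mul_eq_of_isUnit hG F
  obtain ⟨K', hK'⟩ := exists_mul_eq_of_isUnit hG' F'
  have := hm.unique (by
    rw [Scheme.basicOpen_of_isUnit _ (DualRing.isUnit_iff.mp hG)]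
    exact sup_top_eq _) (isClassifying_right s hG hK)
  have := hm'.unique hFG' (isClassifying_right s hG' hK')
  have e : DualRing.conj K = DualRing.conj K' :=
    chartHom_injective s <| (cancel_mono (tsι₁ k (-2) r)).mp (by simp_all)
  obtain rfl : K = K' := by rw [← DualRing.conj_conj K, e, DualRing.conj_conj]
  obtain ⟨u, hu⟩ := exists_mul_eq_of_isUnit hG G'
  refine ⟨u, isUnit_of_mul_isUnit_right (hu ▸ hG'), ?_, by rw [mul_comm, hu]⟩
  rw [← hK', ← hu, ← hK]
  ring

/-- The factors found on the two basic opens agree on the overlap, where `F` can be cancelled, so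
they glue to a global unit. Equality of classifying morphisms therefore gives equivalence without
passing to a cover. -/
lemma exists_unit (hm : IsClassifying s F G m) (hm' : IsClassifying s F' G' m)
    (hFG : T.basicOpen F.fst ⊔ T.basicOpen G.fst = ⊤)
    (hFG' : T.basicOpen F'.fst ⊔ T.basicOpen G'.fst = ⊤) :
    ∃ u, IsUnit u ∧ F' = u * F ∧ G' = u * G := by
  obtain ⟨a, ha, ha1, ha2⟩ := (hm.comp (T.basicOpen F.fst).ι).exists_unit_of_isUnit_left
    (hm'.comp _) (cover_map _ hFG') (isUnit_map_basicOpen F)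
  obtain ⟨b, hb, hb1, hb2⟩ := (hm.comp (T.basicOpen G.fst).ι).exists_unit_of_isUnit_right
    (hm'.comp _) (cover_map _ hFG') (isUnit_map_basicOpen G)
  obtain ⟨u, hu1, hu2⟩ := exists_dualRing_of_cover s F.fst G.fst hFG a b fun v w hvw ↦ by
    have h1 := congrArg (DualRing.map v.appTop.hom) ha1
    have h2 := congrArg (DualRing.map w.appTop.hom) hb1
    have hu := (isUnit_map_basicOpen F).map (DualRing.map v.appTop.hom)
    simp only [map_mul, DualRing.map_appTop_comp] at h1 h2 hu
    rw [← hvw, h1] at h2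
    exact hu.mul_right_cancel h2
  have h (x) : T.basicOpen F.fst ≤ x → T.basicOpen G.fst ≤ x → x = ⊤ := fun h1 h2 ↦
    top_le_iff.mp (hFG ▸ sup_le h1 h2)
  refine ⟨u, DualRing.isUnit_iff.mpr (isUnit_of_basicOpen_eq_top (h _ ?_ ?_)), ?_, ?_⟩
  · refine le_basicOpen_of_isUnit _ ?_
    rw [← DualRing.fst_map, hu1]
    exact DualRing.isUnit_iff.mp ha
  · refine le_basicOpen_of_isUnit _ ?_
    rw [← DualRing.fst_map, hu2]
    exact DualRing.isUnit_iff.mp hb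
  · refine dualRing_ext_of_cover s _ _ hFG ?_ ?_
    · exact (ha1.trans (congrArg (· * _) hu1.symm)).trans (map_mul _ _ _).symm
    · exact (hb1.trans (congrArg (· * _) hu2.symm)).trans (map_mul _ _ _).symm
  · refine dualRing_ext_of_cover s _ _ hFG ?_ ?_
    · exact (ha2.trans (congrArg (· * _) hu1.symm)).trans (map_mul _ _ _).symm
    · exact (hb2.trans (congrArg (· * _) hu2.symm)).trans (map_mul _ _ _).symm

end IsClassifying

lemma exists_isClassifying_of_chart₀ (s : T ⟶ Spec (.of k)) (g : T ⟶ Spec (.of (TSChart k r)))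
    (hg : g ≫ tsChartStr k r = s) : ∃ F G : DualRing r Γ(T, ⊤),
      T.basicOpen F.fst ⊔ T.basicOpen G.fst = ⊤ ∧ IsClassifying s F G (g ≫ tsι₀ k (-2) r) := by
  obtain ⟨H, hH⟩ := exists_eq_chartHom g
  refine ⟨1, H, ?_, ?_⟩
  · rw [TrivSqZeroExt.fst_one, Scheme.basicOpen_of_isUnit _ isUnit_one]
    exact top_sup_eq _
  · rw [hH, hg]
    exact isClassifying_left s isUnit_one (one_mul H)

lemma exists_isClassifying_of_chart₁ (s : T ⟶ Spec (.of k)) (g : T ⟶ Spec (.of (TSChart k r)))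
    (hg : g ≫ tsChartStr k r = s) : ∃ F G : DualRing r Γ(T, ⊤),
      T.basicOpen F.fst ⊔ T.basicOpen G.fst = ⊤ ∧ IsClassifying s F G (g ≫ tsι₁ k (-2) r) := by
  obtain ⟨K, hK⟩ := exists_eq_chartHom g
  -- The coordinate of the second chart is `F / G` with the sign of the `ε_l` reversed.
  refine ⟨DualRing.conj K, 1, ?_, ?_⟩
  · rw [TrivSqZeroExt.fst_one, Scheme.basicOpen_of_isUnit _ isUnit_one]
    exact sup_top_eq _
  · have := isClassifying_right s isUnit_one (one_mul (DualRing.conj K))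
    rw [DualRing.conj_conj] at this
    rw [hK, hg]
    exact this

/-- On the preimage of a chart one of `F`, `G` can be taken to be `1`. A global pair need not exist:
for the zero section over `T = ℙ¹` the functions `F`, `G` would have constant terms in `k`. -/
lemma exists_cover_isClassifying (s : T ⟶ Spec (.of k)) (g : T ⟶ totalSpace k (-2) r)
    (hg : g ≫ totalSpaceStr k (-2) r = s) :
    ∃ 𝒰 : T.OpenCover.{u}, ∀ a : 𝒰.I₀, ∃ F G : DualRing r Γ(𝒰.X a, ⊤),
      (𝒰.X a).basicOpen F.fst ⊔ (𝒰.X a).basicOpen G.fst = ⊤ ∧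
      IsClassifying (𝒰.f a ≫ s) F G (𝒰.f a ≫ g) := by
  let W : ULift.{u} Bool → T.Opens := fun i ↦
    bif i.down then g ⁻¹ᵁ (tsι₀ k (-2) r).opensRange else g ⁻¹ᵁ (tsι₁ k (-2) r).opensRange
  have hW : ⨆ i, W i = ⊤ := by
    refine top_le_iff.mp fun x _ ↦ Opens.mem_iSup.mpr ?_
    rcases tsι_jointly_surjective (g x) with h | h
    · exact ⟨⟨true⟩, h⟩
    · exact ⟨⟨false⟩, h⟩
  have key : ∀ i, ∃ F G : DualRing r Γ(W i, ⊤),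
      (W i).toScheme.basicOpen F.fst ⊔ (W i).toScheme.basicOpen G.fst = ⊤ ∧
      IsClassifying ((W i).ι ≫ s) F G ((W i).ι ≫ g) := by
    rintro ⟨_ | _⟩
    · have e := IsOpenImmersion.lift_fac (tsι₁ k (-2) r) ((W ⟨false⟩).ι ≫ g) (by
        rintro _ ⟨x, rfl⟩
        exact x.2)
      rw [← e]
      refine exists_isClassifying_of_chart₁ _ _ ?_
      rw [← tsι₁_str (n := -2), reassoc_of% e, hg]
    · have e := IsOpenImmersion.lift_fac (tsι₀ k (-2) r) ((W ⟨true⟩).ι ≫ g) (by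
        rintro _ ⟨x, rfl⟩
        exact x.2)
      rw [← e]
      refine exists_isClassifying_of_chart₀ _ _ ?_
      rw [← tsι₀_str (n := -2), reassoc_of% e, hg]
  exact ⟨T.openCoverOfIsOpenCover W hW, key⟩

end Classifying

/-! ### The moduli problem for a subscheme with a dual basis -/

section Moduli

variable {k : Type u} [Field k] {r : ℕ} {D Z : Scheme.{u}} (j : D ⟶ Z) [IsClosedImmersion j]
  (p : Z ⟶ Spec (.of k))

/-- A closed subscheme `D` with `Γ(D) = k[ε₁, …, ε_r]`, `ε_l ε_m = 0`: the surjections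
`𝒪² → 𝒪_D` are parametrised by the total space of `𝒪(-2)^r` on `ℙ¹`. -/
theorem parametrises_totalSpace [QuasiCompact (j ≫ p)] [QuasiSeparated (j ≫ p)]
    [Surjective (j ≫ p)] {ε : Fin r → Γ(D, ⊤)} (h : IsDualBasis (j ≫ p) ε) :
    Parametrises j p (totalSpaceStr k (-2) r) := by
  have hcov {T : Scheme.{u}} (s : T ⟶ Spec (.of k)) (x y : DualRing r Γ(T, ⊤)) :
      (pullback (j ≫ p) s).basicOpen (h.equiv s x) ⊔
        (pullback (j ≫ p) s).basicOpen (h.equiv s y) = ⊤ ↔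
      T.basicOpen x.fst ⊔ T.basicOpen y.fst = ⊤ :=
    cover_dualHom_iff _ _ (h.pullback s).mul_eq_zero _ _
  have hq {T : Scheme.{u}} (s : T ⟶ Spec (.of k)) (q : SurjFamily j p s) :
      T.basicOpen ((h.equiv s).symm q.fst).fst ⊔ T.basicOpen ((h.equiv s).symm q.snd).fst = ⊤ := by
    rw [← hcov, RingEquiv.apply_symm_apply, RingEquiv.apply_symm_apply]
    exact q.cover
  -- The classifying morphism of a family is that of the two dual numbers over `T` which correspond
  -- to its functions on `D_T`.
  choose c hc using fun {T : Scheme.{u}} (s : T ⟶ Spec (.of k)) (q : SurjFamily j p s) ↦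
    exists_isClassifying s _ _ (hq s q)
  refine ⟨c, fun s q ↦ (hc s q).str (hq s q), fun {T T'} s f q q' hqq ↦ ?_,
    fun {T} s q q' ↦ ?_, fun {T} s g hg ↦ ?_⟩
  · refine (hc (f ≫ s) q').unique (hq _ q') ?_
    have hm (x : Γ(pullback (j ≫ p) s, ⊤)) (y : Γ(pullback (j ≫ p) (f ≫ s), ⊤))
        (hxy : y = (pullback.map (j ≫ p) (f ≫ s) (j ≫ p) s (𝟙 D) f (𝟙 _)
          (by simp) (by simp)).appTop.hom x) :
        DualRing.map f.appTop.hom ((h.equiv s).symm x) = (h.equiv (f ≫ s)).symm y := by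
      have := h.equiv_map s f (pullback.map (j ≫ p) (f ≫ s) (j ≫ p) s (𝟙 D) f (𝟙 _)
        (by simp) (by simp)) (pullback.lift_fst _ _ _ |>.trans (Category.comp_id _))
        (pullback.lift_snd _ _ _) ((h.equiv s).symm x)
      rw [RingEquiv.eq_symm_apply, hxy, ← this, RingEquiv.apply_symm_apply]
    rw [← hm _ _ hqq.1, ← hm _ _ hqq.2]
    exact (hc s q).comp f
  · rw [SurjFamily.equivalent_iff]
    constructor
    · intro e
      replace e : c s q = c s q' := e
      obtain ⟨u, hu, h1, h2⟩ := (hc s q).exists_unit (e.symm ▸ hc s q' : IsClassifying s _ _ (c s q))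
        (hq s q) (hq s q')
      refine ⟨(hu.map (h.equiv s)).unit, ?_, ?_⟩
      · rw [IsUnit.unit_spec, ← RingEquiv.apply_symm_apply (h.equiv s) q'.fst, h1, map_mul,
          RingEquiv.apply_symm_apply]
      · rw [IsUnit.unit_spec, ← RingEquiv.apply_symm_apply (h.equiv s) q'.snd, h2, map_mul,
          RingEquiv.apply_symm_apply]
    · rintro ⟨u, h1, h2⟩
      have := (hc s q).of_unit_mul (u.isUnit.map (h.equiv s).symm)
      rw [← map_mul, ← map_mul, ← h1, ← h2] at this
      exact this.unique (hq s q') (hc s q')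
  · obtain ⟨𝒰, h𝒰⟩ := exists_cover_isClassifying s g hg
    refine ⟨𝒰, fun a ↦ ?_⟩
    obtain ⟨F, G, hFG, hm⟩ := h𝒰 a
    obtain ⟨q, h1, h2⟩ := SurjFamily.exists_of_cover (j := j) (p := p) (s := 𝒰.f a ≫ s)
      (h.equiv _ F) (h.equiv _ G) ((hcov _ _ _).mpr hFG)
    refine ⟨q, (hc _ q).unique (hq _ q) ?_⟩
    rw [h1, h2, RingEquiv.symm_apply_apply, RingEquiv.symm_apply_apply]
    exact hm

end Moduli

section Transport

lemma Parametrises.of_iso {S D Z E E' : Scheme.{u}} {j : D ⟶ Z} {p : Z ⟶ S} {e : E ⟶ S} {e' : E' ⟶ S}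
    (h : Parametrises j p e) (ψ : E ≅ E') (hψ : ψ.hom ≫ e' = e) : Parametrises j p e' := by
  obtain ⟨c, h1, h2, h3, h4⟩ := h
  refine ⟨fun s q ↦ c s q ≫ ψ.hom, fun s q ↦ ?_, fun s f q q' hq ↦ ?_, fun s q q' ↦ ?_,
    fun s g hg ↦ ?_⟩
  · rw [Category.assoc, hψ, h1]
  · dsimp only
    rw [h2 s f q q' hq, Category.assoc]
  · rw [cancel_mono, h3]
  · obtain ⟨𝒰, h𝒰⟩ := h4 s (g ≫ ψ.inv) (by rw [← hψ]; simpa using hg)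
    refine ⟨𝒰, fun a ↦ (h𝒰 a).imp fun q hq ↦ ?_⟩
    dsimp only
    rw [hq]; simp

end Transport

end

/-! ### Sections of the ideal of `C` in a square-zero thickening -/

noncomputable section

open Opposite TopologicalSpace AlgebraicGeometry.Scheme

section Thickening

variable {C D : Scheme.{u}}

variable [IsIntegral C]

/-- `c : C ⟶ D` is the inclusion of an integral closed subscheme whose ideal `N` is locally
generated by an element `g x` with annihilator `N`. Moreover `f` is a generator of `N` at the
generic point, with `f = w x * g x`. -/
structure IsInvertibleThickening (c : C ⟶ D) (f : D.presheaf.stalk (c (genericPoint C)))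
    (g : ∀ x : C, D.presheaf.stalk (c x)) (w : C → D.presheaf.stalk (c (genericPoint C))) :
    Prop where
  surjective : Function.Surjective c
  stalkMap_surjective (x : C) : Function.Surjective (c.stalkMap x).hom
  mul_gen_eq_zero_iff (a) : a * f = 0 ↔ (c.stalkMap (genericPoint C)).hom a = 0
  exists_mul_gen (a) : (c.stalkMap (genericPoint C)).hom a = 0 → ∃ b, a = b * f
  mul_eq_zero_iff (x a) : a * g x = 0 ↔ (c.stalkMap x).hom a = 0
  exists_mul (x a) : (c.stalkMap x).hom a = 0 → ∃ b, a = b * g x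
  stalkMap_eq_zero (x) : (c.stalkMap x).hom (g x) = 0
  gen_eq (x) : f = w x * (D.presheaf.stalkSpecializes
    ((genericPoint_specializes x).map c.continuous)).hom (g x)

namespace IsInvertibleThickening

variable {c : C ⟶ D} {f : D.presheaf.stalk (c (genericPoint C))}
  {g : ∀ x : C, D.presheaf.stalk (c x)} {w : C → D.presheaf.stalk (c (genericPoint C))}

lemma stalkMap_stalkSpecializes (c : C ⟶ D) (x : C) (a : D.presheaf.stalk (c x)) :
    (c.stalkMap (genericPoint C)).hom ((D.presheaf.stalkSpecializes
      ((genericPoint_specializes x).map c.continuous)).hom a) =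
    (C.presheaf.stalkSpecializes (genericPoint_specializes x)).hom ((c.stalkMap x).hom a) :=
  Scheme.Hom.stalkSpecializes_stalkMap_apply c _ _ (genericPoint_specializes x) a

lemma stalkSpecializes_injective (x : C) :
    Function.Injective (C.presheaf.stalkSpecializes (genericPoint_specializes x)).hom :=
  IsFractionRing.injective (C.presheaf.stalk x) C.functionField

lemma stalkSpecializes_germ {X : Scheme.{u}} {U : X.Opens} {y : X} (hy : y ∈ U) {x : X}
    (h : x ⤳ y) (s : Γ(X, U)) :
    (X.presheaf.stalkSpecializes h).hom ((X.presheaf.germ U y hy).hom s) =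
      (X.presheaf.germ U x (h.mem_open U.isOpen hy)).hom s :=
  congr($(X.presheaf.germ_stalkSpecializes hy h).hom s)

lemma gen_mem (c : C ⟶ D) (x : C) (U : D.Opens) (hx : c x ∈ U) :
    c (genericPoint C) ∈ U :=
  ((genericPoint_specializes x).map c.continuous).mem_open U.isOpen hx

/-- A germ at `x` in the ideal of `C` is `a * g x`; its germ at the generic point is `b * f`,
where `b = a * w x` on `C`. -/
lemma stalkMap_mul_eq (h : IsInvertibleThickening c f g w) (x : C) (a : D.presheaf.stalk (c x))
    (b : D.presheaf.stalk (c (genericPoint C)))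
    (hab : (D.presheaf.stalkSpecializes
      ((genericPoint_specializes x).map c.continuous)).hom (a * g x) = b * f) :
    (C.presheaf.stalkSpecializes (genericPoint_specializes x)).hom ((c.stalkMap x).hom a) =
      (c.stalkMap (genericPoint C)).hom b * (c.stalkMap (genericPoint C)).hom (w x) := by
  rw [← stalkMap_stalkSpecializes, ← map_mul, ← sub_eq_zero, ← map_sub,
    ← h.mul_gen_eq_zero_iff, h.gen_eq x, ← mul_assoc, sub_mul, sub_mul]
  rw [map_mul] at hab
  linear_combination w x * hab + w x * b * h.gen_eq x

/-- The ideal of `C` is an invertible sheaf on an integral scheme, hence torsion-free: at `x` the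
section is `a * g x`, and its generic germ determines `a` on `C`. -/
lemma eq_zero_of_germ_eq_zero (h : IsInvertibleThickening c f g w) {U : D.Opens} (v : Γ(D, U))
    (hv : (c.app U).hom v = 0) (hη : c (genericPoint C) ∈ U)
    (hv' : (D.presheaf.germ U _ hη).hom v = 0) : v = 0 := by
  refine TopCat.Presheaf.section_ext D.sheaf U v 0 fun y hy ↦ ?_
  obtain ⟨x, rfl⟩ := h.surjective y
  change (D.presheaf.germ U _ hy).hom v = (D.presheaf.germ U _ hy).hom 0
  rw [map_zero]
  have h1 : (c.stalkMap x).hom ((D.presheaf.germ U _ hy).hom v) = 0 := by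
    refine (Scheme.Hom.germ_stalkMap_apply c U x hy v).trans ?_
    exact (congrArg _ hv).trans (map_zero (C.presheaf.germ _ x hy).hom)
  obtain ⟨a, ha⟩ := h.exists_mul x _ h1
  have h2 := h.stalkMap_mul_eq x a 0 (by rw [← ha, stalkSpecializes_germ, hv', zero_mul])
  rw [map_zero, zero_mul, ← map_zero (C.presheaf.stalkSpecializes (genericPoint_specializes x)).hom] at h2
  rw [ha, h.mul_eq_zero_iff]
  exact stalkSpecializes_injective x h2

lemma eq_of_germ_eq (h : IsInvertibleThickening c f g w) {U : D.Opens} {v v' : Γ(D, U)}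
    (hv : (c.app U).hom v = 0) (hv' : (c.app U).hom v' = 0) (hη : c (genericPoint C) ∈ U)
    (h' : (D.presheaf.germ U _ hη).hom v = (D.presheaf.germ U _ hη).hom v') : v = v' :=
  sub_eq_zero.mp (h.eq_zero_of_germ_eq_zero _ (by rw [map_sub, hv, hv', sub_zero]) hη
    (by rw [map_sub, h', sub_self]))

lemma stalkMap_gen (h : IsInvertibleThickening c f g w) :
    (c.stalkMap (genericPoint C)).hom f = 0 := by
  rw [h.gen_eq (genericPoint C), map_mul, stalkMap_stalkSpecializes, h.stalkMap_eq_zero, map_zero,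
    mul_zero]

/-- The coefficient, with respect to the generator `f`, of a section of the ideal of `C`. -/
lemma exists_coeff (h : IsInvertibleThickening c f g w) (v : Γ(D, ⊤))
    (hv : (c.app ⊤).hom v = 0) : ∃ b : D.presheaf.stalk (c (genericPoint C)),
      (D.presheaf.germ ⊤ _ (Opens.mem_top _)).hom v = b * f ∧
      ∀ x, ∃ a : C.presheaf.stalk x,
        (C.presheaf.stalkSpecializes (genericPoint_specializes x)).hom a =
          (c.stalkMap (genericPoint C)).hom b * (c.stalkMap (genericPoint C)).hom (w x) := by
  have h1 (x : C) : (c.stalkMap x).hom ((D.presheaf.germ ⊤ (c x) (Opens.mem_top _)).hom v) = 0 := by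
    refine (Scheme.Hom.germ_stalkMap_apply c ⊤ x (Opens.mem_top _) v).trans ?_
    exact (congrArg _ hv).trans (map_zero (C.presheaf.germ _ x (Opens.mem_top _)).hom)
  obtain ⟨b, hb⟩ := h.exists_mul_gen _ (h1 _)
  refine ⟨b, hb, fun x ↦ ?_⟩
  obtain ⟨a, ha⟩ := h.exists_mul x _ (h1 x)
  exact ⟨_, h.stalkMap_mul_eq x a b (by rw [← ha, stalkSpecializes_germ, hb])⟩

/-- Near `x` the section `a * g x` works: at the generic point `a` and `b * w x` differ by a
multiple of `f`, and `f * g x = 0`. -/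
lemma exists_local_section (h : IsInvertibleThickening c f g w)
    (b : D.presheaf.stalk (c (genericPoint C))) (x : C) (a : C.presheaf.stalk x)
    (ha : (C.presheaf.stalkSpecializes (genericPoint_specializes x)).hom a =
      (c.stalkMap (genericPoint C)).hom b * (c.stalkMap (genericPoint C)).hom (w x)) :
    ∃ (U : D.Opens) (hx : c x ∈ U) (v : Γ(D, U)), (c.app U).hom v = 0 ∧
      (D.presheaf.germ U _ (gen_mem c x U hx)).hom v = b * f := by
  obtain ⟨a, rfl⟩ := h.stalkMap_surjective x a
  obtain ⟨U, hx, v, hv⟩ := D.presheaf.exists_germ_eq (a * g x)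
  replace hv : (D.presheaf.germ U (c x) hx).hom v = a * g x := hv
  refine ⟨U, hx, v, ?_, ?_⟩
  · refine germ_injective_of_isIntegral C (U := c ⁻¹ᵁ U) x hx ?_
    refine (Scheme.Hom.germ_stalkMap_apply c U x hx v).symm.trans ?_
    refine (congrArg (c.stalkMap x).hom hv).trans ?_
    rw [map_mul, h.stalkMap_eq_zero, mul_zero]
    exact (map_zero (C.presheaf.germ _ x hx).hom).symm
  · rw [← stalkSpecializes_germ hx ((genericPoint_specializes x).map c.continuous), hv, map_mul]
    rw [← stalkMap_stalkSpecializes, ← map_mul, ← sub_eq_zero, ← map_sub] at ha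
    obtain ⟨e, he⟩ := h.exists_mul_gen _ ha
    have h0 : f * (D.presheaf.stalkSpecializes
        ((genericPoint_specializes x).map c.continuous)).hom (g x) = 0 := by
      rw [mul_comm, h.mul_gen_eq_zero_iff, stalkMap_stalkSpecializes, h.stalkMap_eq_zero, map_zero]
    linear_combination (D.presheaf.stalkSpecializes
      ((genericPoint_specializes x).map c.continuous)).hom (g x) * he + e * h0 - b * h.gen_eq x

/-- Local sections with the same generic germ agree, so they glue. With `exists_coeff` this
describes global sections of the ideal by rational functions `b` on `C` such that every `b * w x` is
regular. -/
lemma exists_section (h : IsInvertibleThickening c f g w)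
    (b : D.presheaf.stalk (c (genericPoint C)))
    (hb : ∀ x, ∃ a : C.presheaf.stalk x,
      (C.presheaf.stalkSpecializes (genericPoint_specializes x)).hom a =
        (c.stalkMap (genericPoint C)).hom b * (c.stalkMap (genericPoint C)).hom (w x)) :
    ∃ v : Γ(D, ⊤), (c.app ⊤).hom v = 0 ∧ (D.presheaf.germ ⊤ _ (Opens.mem_top _)).hom v = b * f := by
  choose a ha using hb
  choose U hU v hv hv' using fun x ↦ h.exists_local_section b x (a x) (ha x)
  have hcov : ⊤ ≤ iSup U := by
    intro y _
    obtain ⟨x, rfl⟩ := h.surjective y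
    exact Opens.mem_iSup.mpr ⟨x, hU x⟩
  have hres {V W : D.Opens} (i : V ≤ W) (s : Γ(D, W)) (hs : (c.app W).hom s = 0) :
      (c.app V).hom ((D.presheaf.map (homOfLE i).op).hom s) = 0 := by
    have := congr($(c.naturality (homOfLE i).op).hom s)
    refine this.trans ?_
    exact (congrArg _ hs).trans (map_zero (C.presheaf.map _).hom)
  obtain ⟨s, hs, -⟩ := D.sheaf.existsUnique_gluing' U ⊤ (fun x ↦ homOfLE le_top) hcov v (by
    intro x y
    have hη : c (genericPoint C) ∈ U x ⊓ U y := ⟨gen_mem c x _ (hU x), gen_mem c y _ (hU y)⟩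
    refine h.eq_of_germ_eq (U := U x ⊓ U y) (hres inf_le_left _ (hv x)) (hres inf_le_right _ (hv y))
      hη ?_
    refine (D.presheaf.germ_res_apply (homOfLE inf_le_left) _ hη (v x)).trans ?_
    refine Eq.trans ?_ (D.presheaf.germ_res_apply (homOfLE inf_le_right) _ hη (v y)).symm
    exact (hv' x).trans (hv' y).symm)
  have hη : c (genericPoint C) ∈ U (genericPoint C) := hU _
  have hs' : (D.presheaf.germ ⊤ _ (Opens.mem_top _)).hom s = b * f := by
    refine (D.presheaf.germ_res_apply (homOfLE le_top) _ hη s).symm.trans ?_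
    exact (congrArg _ (hs _)).trans (hv' _)
  refine ⟨s, ?_, hs'⟩
  refine germ_injective_of_isIntegral C (U := c ⁻¹ᵁ ⊤) (genericPoint C) (Opens.mem_top _) ?_
  refine (Scheme.Hom.germ_stalkMap_apply c ⊤ _ (Opens.mem_top _) s).symm.trans ?_
  refine (congrArg (c.stalkMap (genericPoint C)).hom hs').trans ?_
  rw [map_mul, h.stalkMap_gen, mul_zero]
  exact (map_zero (C.presheaf.germ _ _ (Opens.mem_top _)).hom).symm

/-- At the generic point the ideal is generated by `f`, which it annihilates; the product is a
section of the ideal, so torsion-freeness gives the rest. -/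
lemma mul_eq_zero (h : IsInvertibleThickening c f g w) {v v' : Γ(D, ⊤)}
    (hv : (c.app ⊤).hom v = 0) (hv' : (c.app ⊤).hom v' = 0) : v * v' = 0 := by
  have h1 {v : Γ(D, ⊤)} (hv : (c.app ⊤).hom v = 0) : (c.stalkMap (genericPoint C)).hom
      ((D.presheaf.germ ⊤ _ (Opens.mem_top _)).hom v) = 0 := by
    refine (Scheme.Hom.germ_stalkMap_apply c ⊤ _ (Opens.mem_top _) v).trans ?_
    exact (congrArg _ hv).trans (map_zero (C.presheaf.germ _ _ (Opens.mem_top _)).hom)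
  refine h.eq_zero_of_germ_eq_zero _ (by rw [map_mul, hv, zero_mul]) trivial ?_
  obtain ⟨b, hb⟩ := h.exists_mul_gen _ (h1 hv')
  rw [map_mul, hb, mul_left_comm, (h.mul_gen_eq_zero_iff _).mpr (h1 hv), mul_zero]

end IsInvertibleThickening

end Thickening

end

/-! ### Stalks of ideal sheaves and the thickening defined by `I²` -/

noncomputable section

open Opposite TopologicalSpace AlgebraicGeometry.Scheme

section Stalks

variable {C D Z : Scheme.{u}}

lemma AlgebraicGeometry.IsAffineOpen.exists_mul_germ {X : Scheme.{u}} {U : X.Opens}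
    (hU : IsAffineOpen U) {x : X} (hx : x ∈ U) (a : X.presheaf.stalk x) :
    ∃ s t : Γ(X, U), IsUnit ((X.presheaf.germ U x hx).hom t) ∧
      a * (X.presheaf.germ U x hx).hom t = (X.presheaf.germ U x hx).hom s := by
  let _ := X.presheaf.algebra_section_stalk ⟨x, hx⟩
  have := hU.isLocalization_stalk ⟨x, hx⟩
  obtain ⟨⟨s, t⟩, h⟩ := IsLocalization.surj (hU.primeIdealOf ⟨x, hx⟩).asIdeal.primeCompl a
  exact ⟨s, t.1, IsLocalization.map_units (X.presheaf.stalk x) t, h⟩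

lemma AlgebraicGeometry.IsAffineOpen.exists_mul_eq_zero {X : Scheme.{u}} {U : X.Opens}
    (hU : IsAffineOpen U) {x : X} (hx : x ∈ U) (s : Γ(X, U))
    (h : (X.presheaf.germ U x hx).hom s = 0) :
    ∃ t : Γ(X, U), IsUnit ((X.presheaf.germ U x hx).hom t) ∧ t * s = 0 := by
  let _ := X.presheaf.algebra_section_stalk ⟨x, hx⟩
  have := hU.isLocalization_stalk ⟨x, hx⟩
  obtain ⟨t, ht⟩ := (IsLocalization.map_eq_zero_iff (hU.primeIdealOf ⟨x, hx⟩).asIdeal.primeCompl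
    (X.presheaf.stalk x) s).mp h
  exact ⟨t.1, IsLocalization.map_units (X.presheaf.stalk x) t, ht⟩

/-- Kernels commute with localisation: after clearing denominators, a germ in the kernel is a
section whose image is killed by a function invertible at `x`, and this function lifts along the
closed immersion. -/
lemma ker_stalkMap (j : D ⟶ Z) [IsClosedImmersion j] (x : D) (U : Z.affineOpens) (hx : j x ∈ U.1) :
    RingHom.ker (j.stalkMap x).hom =
      (j.ker.ideal U).map (Z.presheaf.germ U.1 (j x) hx).hom := by
  rw [Scheme.Hom.ker_apply]
  apply le_antisymm
  · intro a ha
    obtain ⟨s, t, ht, hst⟩ := U.2.exists_mul_germ hx a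
    have h1 : (D.presheaf.germ (j ⁻¹ᵁ U.1) x hx).hom ((j.app U.1).hom s) = 0 := by
      refine (Scheme.Hom.germ_stalkMap_apply j U.1 x hx s).symm.trans ?_
      change (j.stalkMap x).hom ((Z.presheaf.germ U.1 (j x) hx).hom s) = 0
      rw [← hst, map_mul, RingHom.mem_ker.mp ha, zero_mul]
    obtain ⟨t', ht', hts⟩ := (U.2.preimage j).exists_mul_eq_zero hx _ h1
    obtain ⟨t', rfl⟩ := j.app_surjective U.1 U.2 t'
    have h2 : IsUnit ((Z.presheaf.germ U.1 (j x) hx).hom t') := by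
      refine isUnit_of_map_unit (j.stalkMap x).hom _ ?_
      exact (Scheme.Hom.germ_stalkMap_apply j U.1 x hx t').symm ▸ ht'
    have h3 : a * ((Z.presheaf.germ U.1 (j x) hx).hom t * (Z.presheaf.germ U.1 (j x) hx).hom t') ∈
        (RingHom.ker (j.app U.1).hom).map (Z.presheaf.germ U.1 (j x) hx).hom := by
      rw [← mul_assoc, hst, ← map_mul, mul_comm]
      refine Ideal.mem_map_of_mem _ ?_
      rw [RingHom.mem_ker, map_mul]
      exact hts
    exact (Ideal.mul_unit_mem_iff_mem _ (ht.mul h2)).mp h3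
  · rw [Ideal.map_le_iff_le_comap]
    intro s hs
    rw [Ideal.mem_comap, RingHom.mem_ker]
    refine (Scheme.Hom.germ_stalkMap_apply j U.1 x hx s).trans ?_
    exact (congrArg _ (RingHom.mem_ker.mp hs)).trans
      (map_zero (D.presheaf.germ (j ⁻¹ᵁ U.1) x hx).hom)

lemma ker_stalkMap_of_ker_eq_sq (c : C ⟶ D) (j : D ⟶ Z) [IsClosedImmersion c]
    [IsClosedImmersion j] (h : (c ≫ j).ker ^ 2 = j.ker) (x : C) :
    RingHom.ker (j.stalkMap (c x)).hom =
      RingHom.ker (j.stalkMap (c x) ≫ c.stalkMap x).hom ^ 2 := by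
  obtain ⟨_, ⟨U, hU, rfl⟩, hx, -⟩ :=
    Z.isBasis_affineOpens.exists_subset_of_mem_open (Set.mem_univ (j (c x))) isOpen_univ
  have h1 : RingHom.ker (j.stalkMap (c x) ≫ c.stalkMap x).hom =
      ((c ≫ j).ker.ideal ⟨U, hU⟩).map (Z.presheaf.germ U (j (c x)) hx).hom := by
    rw [← Scheme.Hom.stalkMap_comp]
    exact ker_stalkMap (c ≫ j) x ⟨U, hU⟩ hx
  rw [h1, ker_stalkMap j (c x) ⟨U, hU⟩ hx, ← h, IdealSheafData.ideal_pow, Pi.pow_apply,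
    Ideal.map_pow]

/-- An ideal sheaf and its square have the same support. -/
lemma surjective_of_ker_eq_sq (c : C ⟶ D) (j : D ⟶ Z) [IsClosedImmersion c]
    [IsClosedImmersion j] (h : (c ≫ j).ker ^ 2 = j.ker) : Function.Surjective c := by
  intro y
  have h1 : j y ∈ (j.ker.support : Set Z) := by
    rw [Scheme.Hom.support_ker]
    exact subset_closure ⟨y, rfl⟩
  rw [← h, IdealSheafData.support_pow_succ, Scheme.Hom.support_ker,
    (c ≫ j).isClosedEmbedding.isClosed_range.closure_eq] at h1
  obtain ⟨x, hx⟩ := h1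
  exact ⟨x, j.isClosedEmbedding.injective hx⟩

/-- In the local ring of `Z`, a domain, the ideal of `C` is `(y)` with `y ≠ 0` and that of `D` is
`(y²)`; hence `a * y ∈ (y²)` exactly if `a ∈ (y)`. -/
theorem isInvertibleThickening_of_ker_eq_sq [IsIntegral C] [IsIntegral Z] (c : C ⟶ D) (j : D ⟶ Z)
    [IsClosedImmersion c] [IsClosedImmersion j] (h : (c ≫ j).ker ^ 2 = j.ker)
    (f : Z.presheaf.stalk (j (c (genericPoint C)))) (hf0 : f ≠ 0)
    (hf : RingHom.ker (j.stalkMap (c (genericPoint C)) ≫ c.stalkMap (genericPoint C)).hom =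
      Ideal.span {f})
    (g : ∀ x : C, Z.presheaf.stalk (j (c x)))
    (hg : ∀ x, RingHom.ker (j.stalkMap (c x) ≫ c.stalkMap x).hom = Ideal.span {g x})
    (w : C → Z.presheaf.stalk (j (c (genericPoint C))))
    (hw : ∀ x, f = w x * (Z.presheaf.stalkSpecializes
      (((genericPoint_specializes x).map c.continuous).map j.continuous)).hom (g x)) :
    IsInvertibleThickening c ((j.stalkMap (c (genericPoint C))).hom f)
      (fun x ↦ (j.stalkMap (c x)).hom (g x))
      (fun x ↦ (j.stalkMap (c (genericPoint C))).hom (w x)) := by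
  have hg0 (x) : g x ≠ 0 := fun h0 ↦ hf0 (by rw [hw x, h0, map_zero, mul_zero])
  have key (x : C) (y : Z.presheaf.stalk (j (c x))) (hy0 : y ≠ 0)
      (hy : RingHom.ker (j.stalkMap (c x) ≫ c.stalkMap x).hom = Ideal.span {y}) (a : D.presheaf.stalk (c x)) :
      (a * (j.stalkMap (c x)).hom y = 0 ↔ (c.stalkMap x).hom a = 0) ∧
      ((c.stalkMap x).hom a = 0 → ∃ b, a = b * (j.stalkMap (c x)).hom y) := by
    obtain ⟨a, rfl⟩ := j.stalkMap_surjective (c x) a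
    have hy' := hy
    replace hy (b) : (c.stalkMap x).hom ((j.stalkMap (c x)).hom b) = 0 ↔ y ∣ b := by
      rw [← Ideal.mem_span_singleton, ← hy, RingHom.mem_ker]
      rfl
    have hy2 (b) : (j.stalkMap (c x)).hom b = 0 ↔ y ^ 2 ∣ b := by
      rw [← RingHom.mem_ker, ker_stalkMap_of_ker_eq_sq c j h x, hy',
        Ideal.span_singleton_pow, Ideal.mem_span_singleton]
    refine ⟨?_, fun ha ↦ ?_⟩
    · rw [hy, ← map_mul, hy2, pow_two]
      exact mul_dvd_mul_iff_right hy0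
    · obtain ⟨b, rfl⟩ := (hy a).mp ha
      exact ⟨(j.stalkMap (c x)).hom b, by rw [map_mul, mul_comm]⟩
  exact
  { surjective := surjective_of_ker_eq_sq c j h
    stalkMap_surjective := c.stalkMap_surjective
    mul_gen_eq_zero_iff := fun a ↦ (key _ f hf0 hf a).1
    exists_mul_gen := fun a ↦ (key _ f hf0 hf a).2
    mul_eq_zero_iff := fun x a ↦ (key x _ (hg0 x) (hg x) a).1
    exists_mul := fun x a ↦ (key x _ (hg0 x) (hg x) a).2
    stalkMap_eq_zero := fun x ↦ by
      have : g x ∈ RingHom.ker (j.stalkMap (c x) ≫ c.stalkMap x).hom :=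
        hg x ▸ Ideal.mem_span_singleton_self _
      exact RingHom.mem_ker.mp this
    gen_eq := fun x ↦ by
      have := congrArg (j.stalkMap (c (genericPoint C))).hom (hw x)
      rw [map_mul] at this
      refine this.trans (congrArg (_ * ·) ?_)
      exact Scheme.Hom.stalkSpecializes_stalkMap_apply j _ _
        ((genericPoint_specializes x).map c.continuous) (g x) }

end Stalks

end

/-! ### Affine charts, the function field and orders of vanishing -/

noncomputable section

open Opposite TopologicalSpace AlgebraicGeometry.Scheme

section Chart

variable {R : Type u} [CommRing R] {C : Scheme.{u}} (c : Spec (.of R) ⟶ C) [IsOpenImmersion c]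

/-- The functions on the image of an affine chart `c : Spec R ⟶ C`. -/
def chartEquiv : R ≃+* Γ(C, c ''ᵁ ⊤) :=
  ((Scheme.ΓSpecIso (.of R)).symm ≪≫ (c.appIso ⊤).symm).commRingCatIsoToRingEquiv

lemma mem_chart (y : Spec (.of R)) : c y ∈ c ''ᵁ ⊤ := ⟨y, trivial, rfl⟩

/-- The germ at a point `c y` of a function on the chart `c`. -/
def chartGerm (y : Spec (.of R)) : R →+* C.presheaf.stalk (c y) :=
  (C.presheaf.germ (c ''ᵁ ⊤) (c y) (mem_chart c y)).hom.comp (chartEquiv c).toRingHom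

lemma isUnit_chartGerm_iff (y : Spec (.of R)) (b : R) :
    IsUnit (chartGerm c y b) ↔ b ∉ y.asIdeal := by
  have h1 : IsUnit (chartGerm c y b) ↔ c y ∈ C.basicOpen (chartEquiv c b) :=
    (C.mem_basicOpen _ _ (mem_chart c y)).symm
  have h2 : C.basicOpen (chartEquiv c b) =
      c ''ᵁ (Spec (.of R)).basicOpen ((Scheme.ΓSpecIso (.of R)).inv.hom b) :=
    (Scheme.image_basicOpen c ((Scheme.ΓSpecIso (.of R)).inv.hom b)).symm
  rw [h1, h2]
  have h3 := basicOpen_eq_of_affine' (R := .of R) ((Scheme.ΓSpecIso (.of R)).inv.hom b)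
  rw [h3]
  have h4 : (Scheme.ΓSpecIso (.of R)).hom ((Scheme.ΓSpecIso (.of R)).inv.hom b) = b :=
    congr($((Scheme.ΓSpecIso (.of R)).inv_hom_id).hom b)
  rw [h4]
  exact c.isOpenEmbedding.injective.mem_set_image

lemma exists_mul_chartGerm (y : Spec (.of R)) (a : C.presheaf.stalk (c y)) :
    ∃ s t : R, t ∉ y.asIdeal ∧ a * chartGerm c y t = chartGerm c y s := by
  have hU : IsAffineOpen (c ''ᵁ ⊤) := (isAffineOpen_top _).image_of_isOpenImmersion c
  obtain ⟨s, t, ht, hst⟩ := hU.exists_mul_germ (mem_chart c y) a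
  obtain ⟨s, rfl⟩ := (chartEquiv c).surjective s
  obtain ⟨t, rfl⟩ := (chartEquiv c).surjective t
  exact ⟨s, t, (isUnit_chartGerm_iff c y t).mp ht, hst⟩

variable [IsIntegral C] [IsDomain R]

instance nonempty_chart : Nonempty (c ''ᵁ ⊤ : C.Opens) :=
  ⟨⟨c (⊥ : PrimeSpectrum R), mem_chart c _⟩⟩

/-- The function field as a field of fractions of the functions on a chart. -/
def chartToFunctionField : R →+* C.functionField :=
  (C.germToFunctionField (c ''ᵁ ⊤)).hom.comp (chartEquiv c).toRingHom

lemma algebraMap_chartGerm (y : Spec (.of R)) (b : R) :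
    algebraMap (C.presheaf.stalk (c y)) C.functionField (chartGerm c y b) =
      chartToFunctionField c b :=
  Scheme.algebraMap_germ_eq_germToFunctionField C (mem_chart c y) _

lemma chartToFunctionField_injective : Function.Injective (chartToFunctionField c) :=
  (Scheme.germToFunctionField_injective C _).comp (chartEquiv c).injective

lemma chart_bot : c (⊥ : PrimeSpectrum R) = genericPoint C := by
  rw [← genericPoint_eq_of_isOpenImmersion c]
  exact congrArg c (genericPoint_eq_bot_of_affine (.of R)).symm

/-- The local ring at `x` is the localisation of `R` at the prime `y`, so regularity at `x` becomes
a condition on fractions over `R`. -/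
lemma mem_range_stalk_iff {x : C} {y : Spec (.of R)} (hy : c y = x) (h : C.functionField) :
    (∃ a : C.presheaf.stalk x, algebraMap _ C.functionField a = h) ↔
      ∃ s t : R, t ∉ y.asIdeal ∧ h * chartToFunctionField c t = chartToFunctionField c s := by
  subst hy
  constructor
  · rintro ⟨a, rfl⟩
    obtain ⟨s, t, ht, hst⟩ := exists_mul_chartGerm c y a
    refine ⟨s, t, ht, ?_⟩
    rw [← algebraMap_chartGerm c y, ← algebraMap_chartGerm c y, ← map_mul, hst]
  · rintro ⟨s, t, ht, hst⟩
    obtain ⟨u, hu⟩ := (isUnit_chartGerm_iff c y t).mpr ht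
    refine ⟨chartGerm c y s * ↑u⁻¹, ?_⟩
    have ht0 : chartToFunctionField c t ≠ 0 := by
      rw [Ne, map_eq_zero_iff _ (chartToFunctionField_injective c)]
      rintro rfl
      exact ht (zero_mem _)
    refine mul_right_cancel₀ ht0 ?_
    rw [hst, ← algebraMap_chartGerm c y, ← algebraMap_chartGerm c y, ← map_mul, ← hu, mul_assoc,
      Units.inv_mul, mul_one]

lemma exists_mul_eq_chart (h : C.functionField) :
    ∃ s t : R, t ≠ 0 ∧ h * chartToFunctionField c t = chartToFunctionField c s := by
  -- The generic point is the zero prime and its local ring is the whole function field, so the only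
  -- condition left is `t ≠ 0`.
  obtain ⟨s, t, ht, hst⟩ := (mem_range_stalk_iff c (chart_bot c) h).mp
    ⟨h, congr($(TopCat.Presheaf.stalkSpecializes_refl C.presheaf (genericPoint C)).hom h)⟩
  exact ⟨s, t, ht, hst⟩

variable [IsLocallyNoetherian C]

lemma ord_chart_eq_zero (y : Spec (.of R)) (b : R) (hb : b ∉ y.asIdeal) :
    Scheme.ord (chartToFunctionField c b) (c y) = 0 := by
  by_cases hx : Order.coheight (c y) = 1
  · have : Ring.KrullDimLE 1 (C.presheaf.stalk (c y)) := krullDimLE_of_coheight_le hx.le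
    have hu := (isUnit_chartGerm_iff c y b).mpr hb
    have h0 : chartToFunctionField c b ≠ 0 := by
      rw [Ne, map_eq_zero_iff _ (chartToFunctionField_injective c)]
      rintro rfl
      exact hb (zero_mem _)
    rw [Scheme.ord_eq_iff hx h0, ← algebraMap_chartGerm c y]
    exact Ring.ordFrac_of_isUnit hu
  · exact Scheme.ord_eq_zero_of_coheight_neq_one hx _

/-- A prime generated by a nonzero element has height one, and the germ of `ϖ` generates the maximal
ideal of the local ring, so the quotient by it has length one. -/
lemma ord_chart_eq_one [IsNoetherianRing R] (y : Spec (.of R)) (ϖ : R) (h0 : ϖ ≠ 0)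
    (hϖ : y.asIdeal = Ideal.span {ϖ}) :
    Scheme.ord (chartToFunctionField c ϖ) (c y) = 1 := by
  have hx : Order.coheight (c y) = 1 := by
    refine (coheight_eq_of_isOpenImmersion c).trans ?_
    rw [← idealHeight_eq_coheight, hϖ]
    refine Ideal.height_span_singleton_eq_one_of_mem_nonZeroDivisors
      (mem_nonZeroDivisors_of_ne_zero h0) fun hu ↦ ?_
    exact y.isPrime.ne_top (hϖ.trans (Ideal.span_singleton_eq_top.mpr hu))
  have : Ring.KrullDimLE 1 (C.presheaf.stalk (c y)) := krullDimLE_of_coheight_le hx.le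
  have hne : chartToFunctionField c ϖ ≠ 0 := by
    rwa [Ne, map_eq_zero_iff _ (chartToFunctionField_injective c)]
  have hg0 : chartGerm c y ϖ ≠ 0 := by
    intro h
    rw [← algebraMap_chartGerm c y, h, map_zero] at hne
    exact hne rfl
  have hmax : IsLocalRing.maximalIdeal (C.presheaf.stalk (c y)) = Ideal.span {chartGerm c y ϖ} := by
    apply le_antisymm
    · intro a ha
      obtain ⟨s, t, ht, hst⟩ := exists_mul_chartGerm c y a
      have hs : s ∈ y.asIdeal := by
        by_contra hs
        have := (isUnit_chartGerm_iff c y s).mpr hs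
        rw [← hst] at this
        exact (IsLocalRing.mem_maximalIdeal a).mp ha (isUnit_of_mul_isUnit_left this)
      rw [hϖ, Ideal.mem_span_singleton] at hs
      refine (Ideal.mul_unit_mem_iff_mem _ ((isUnit_chartGerm_iff c y t).mpr ht)).mp ?_
      rw [hst, Ideal.mem_span_singleton]
      exact map_dvd _ hs
    · rw [Ideal.span_singleton_le_iff_mem, IsLocalRing.mem_maximalIdeal, mem_nonunits_iff,
        isUnit_chartGerm_iff, not_not, hϖ]
      exact Ideal.mem_span_singleton_self _
  have hord : Ring.ord (C.presheaf.stalk (c y)) (chartGerm c y ϖ) = (1 : ℕ) := by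
    rw [Ring.ord, Nat.cast_one, Module.length_eq_one_iff, isSimpleModule_iff_isCoatom, ← hmax,
      ← Ideal.isMaximal_def]
    infer_instance
  rw [Scheme.ord_eq_iff hx hne, ← algebraMap_chartGerm c y]
  refine (Ring.ordFrac_eq_ord _ hg0).trans ?_
  exact Ring.ordMonoidWithZeroHom_eq_coe _ (mem_nonZeroDivisors_of_ne_zero hg0) hord

end Chart

end

/-! ### Fractions of polynomials: zeros and poles on the affine line and at infinity -/

noncomputable section

open Opposite TopologicalSpace AlgebraicGeometry.Scheme

section Fractions

variable {R K : Type*} [CommRing R] [Field K] (κ : R →+* K) (P : Ideal R)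

/-- `h` is a fraction with denominator outside of `P`. -/
def IsRegularAt (h : K) : Prop := ∃ s t : R, t ∉ P ∧ h * κ t = κ s

/-- `h` is a fraction with numerator and denominator outside of `P`. -/
def IsUnitAt (h : K) : Prop := ∃ s t : R, s ∉ P ∧ t ∉ P ∧ h * κ t = κ s

variable {κ P} [P.IsPrime]

lemma IsRegularAt.mul {h h' : K} (a : IsRegularAt κ P h) (b : IsRegularAt κ P h') :
    IsRegularAt κ P (h * h') := by
  obtain ⟨s, t, ht, e⟩ := a
  obtain ⟨s', t', ht', e'⟩ := b
  refine ⟨s * s', t * t', fun hm ↦ (Ideal.IsPrime.mem_or_mem ‹_› hm).elim ht ht', ?_⟩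
  rw [map_mul, map_mul, ← e, ← e']
  ring

lemma IsUnitAt.mul {h h' : K} (a : IsUnitAt κ P h) (b : IsUnitAt κ P h') :
    IsUnitAt κ P (h * h') := by
  obtain ⟨s, t, hs, ht, e⟩ := a
  obtain ⟨s', t', hs', ht', e'⟩ := b
  refine ⟨s * s', t * t', fun hm ↦ (Ideal.IsPrime.mem_or_mem ‹_› hm).elim hs hs',
    fun hm ↦ (Ideal.IsPrime.mem_or_mem ‹_› hm).elim ht ht', ?_⟩
  rw [map_mul, map_mul, ← e, ← e']
  ring

omit [P.IsPrime] in
lemma IsUnitAt.isRegularAt {h : K} (a : IsUnitAt κ P h) : IsRegularAt κ P h :=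
  let ⟨s, t, _, ht, e⟩ := a
  ⟨s, t, ht, e⟩

lemma IsUnitAt.one : IsUnitAt κ P 1 :=
  ⟨1, 1, Ideal.IsPrime.one_notMem ‹_›, Ideal.IsPrime.one_notMem ‹_›, by simp⟩

lemma isUnitAt_of_notMem {s : R} (hs : s ∉ P) : IsUnitAt κ P (κ s) :=
  ⟨s, 1, hs, Ideal.IsPrime.one_notMem ‹_›, by simp⟩

lemma isRegularAt_map (s : R) : IsRegularAt κ P (κ s) :=
  ⟨s, 1, Ideal.IsPrime.one_notMem ‹_›, by simp⟩

section

variable (hκ : Function.Injective κ)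

include hκ

omit [P.IsPrime] in
lemma map_ne_zero_of_notMem {t : R} (ht : t ∉ P) : κ t ≠ 0 := by
  rw [Ne, map_eq_zero_iff κ hκ]
  rintro rfl
  exact ht (zero_mem _)

omit [P.IsPrime] in
lemma IsUnitAt.ne_zero {h : K} (a : IsUnitAt κ P h) : h ≠ 0 := by
  obtain ⟨s, t, hs, ht, e⟩ := a
  rintro rfl
  rw [zero_mul] at e
  exact map_ne_zero_of_notMem hκ hs e.symm

omit [P.IsPrime] in
lemma IsUnitAt.inv {h : K} (a : IsUnitAt κ P h) : IsUnitAt κ P h⁻¹ := by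
  have h0 := a.ne_zero hκ
  obtain ⟨s, t, hs, ht, e⟩ := a
  refine ⟨t, s, ht, hs, ?_⟩
  rw [← e, inv_mul_cancel_left₀ h0]

lemma IsUnitAt.zpow {h : K} (a : IsUnitAt κ P h) (n : ℤ) : IsUnitAt κ P (h ^ n) := by
  have hp (n : ℕ) : IsUnitAt κ P (h ^ n) := by
    induction n with
    | zero => rw [pow_zero]; exact .one
    | succ n ih => rw [pow_succ]; exact ih.mul a
  cases n with
  | ofNat n => rw [Int.ofNat_eq_natCast, zpow_natCast]; exact hp n
  | negSucc n =>
    rw [zpow_negSucc]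
    exact (hp _).inv hκ

omit hκ in
lemma IsUnitAt.prod {ι : Type*} (S : Finset ι) (h : ι → K) (H : ∀ i ∈ S, IsUnitAt κ P (h i)) :
    IsUnitAt κ P (∏ i ∈ S, h i) :=
  Finset.prod_induction h _ (fun _ _ ↦ .mul) .one H

/-- Regularity does not change if `h` is multiplied by a unit. -/
lemma isRegularAt_mul_iff {h a b : K} {z : K} (hz : z ≠ 0) (ha : IsUnitAt κ P (a * z))
    (hb : IsUnitAt κ P (b * z)) : IsRegularAt κ P (h * a) ↔ IsRegularAt κ P (h * b) := by
  have ha0 := left_ne_zero_of_mul (ha.ne_zero hκ)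
  have hb0 := left_ne_zero_of_mul (hb.ne_zero hκ)
  constructor
  · intro H
    have := H.mul ((hb.mul (ha.inv hκ)).isRegularAt)
    convert this using 1
    field_simp
  · intro H
    have := H.mul ((ha.mul (hb.inv hκ)).isRegularAt)
    convert this using 1
    field_simp

end

end Fractions

section PolynomialFractions

open Polynomial

variable {k K : Type*} [Field k] [Field K] {κ : k[X] →+* K} (hκ : Function.Injective κ)

/-- The maximal ideal of polynomials vanishing at `α`. -/
abbrev vanishingAt (α : k) : Ideal k[X] := Ideal.span {X - C α}

instance (α : k) : (vanishingAt α).IsPrime :=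
  (Ideal.span_singleton_prime (X_sub_C_ne_zero α)).mpr (prime_X_sub_C α)

lemma mem_vanishingAt {α : k} {p : k[X]} : p ∈ vanishingAt α ↔ p.eval α = 0 := by
  rw [Ideal.mem_span_singleton, dvd_iff_isRoot, IsRoot]

include hκ

/-- Split the power of `X - α` off numerator and denominator; `n` is the difference of the
multiplicities. -/
lemma exists_isUnitAt_mul_zpow (α : k) {h : K} (h0 : h ≠ 0)
    (hf : ∃ s t : k[X], t ≠ 0 ∧ h * κ t = κ s) :
    ∃ n : ℤ, IsUnitAt κ (vanishingAt α) (h * κ (X - C α) ^ (-n)) := by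
  obtain ⟨s, t, ht, e⟩ := hf
  have hκ0 {p : k[X]} : κ p ≠ 0 ↔ p ≠ 0 := (map_ne_zero_iff κ hκ)
  have hs : s ≠ 0 := hκ0.mp (e ▸ mul_ne_zero h0 (hκ0.mpr ht))
  obtain ⟨s', hs', hds⟩ := exists_eq_pow_rootMultiplicity_mul_and_not_dvd s hs α
  obtain ⟨t', ht', hdt⟩ := exists_eq_pow_rootMultiplicity_mul_and_not_dvd t ht α
  generalize rootMultiplicity α s = a at hs'
  generalize rootMultiplicity α t = b at ht'
  have hx : κ (X - C α) ≠ 0 := hκ0.mpr (X_sub_C_ne_zero α)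
  refine ⟨a - b, s', t', fun hm ↦ hds (Ideal.mem_span_singleton.mp hm),
    fun hm ↦ hdt (Ideal.mem_span_singleton.mp hm), ?_⟩
  rw [hs', ht', map_mul, map_mul, map_pow, map_pow] at e
  rw [neg_sub, zpow_sub₀ hx, zpow_natCast, zpow_natCast]
  field_simp
  linear_combination e

omit hκ [Field K] in
lemma eq_bot_or_eq_vanishingAt [IsAlgClosed k] (P : Ideal k[X]) [P.IsPrime] :
    P = ⊥ ∨ ∃ α, P = vanishingAt α := by
  by_cases hP : P = ⊥
  · exact .inl hP
  obtain ⟨g, hg⟩ := (IsPrincipalIdealRing.principal P).principal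
  rw [Ideal.submodule_span_eq] at hg
  have hg0 : g ≠ 0 := by
    rintro rfl
    exact hP (by simpa using hg)
  have hg1 : Irreducible g :=
    ((Ideal.span_singleton_prime hg0).mp (hg ▸ ‹P.IsPrime›)).irreducible
  obtain ⟨α, hα⟩ := IsAlgClosed.exists_root g
    (by rw [IsAlgClosed.degree_eq_one_of_irreducible k hg1]; exact one_ne_zero)
  refine .inr ⟨α, ?_⟩
  have hmax : P.IsMaximal := Ideal.IsPrime.isMaximal ‹_› hP
  refine hmax.eq_of_le (Ideal.IsPrime.ne_top inferInstance) ?_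
  rw [hg, Ideal.span_singleton_le_iff_mem, mem_vanishingAt]
  exact hα

omit hκ in
-- The denominators of `h` form an ideal that lies in no maximal ideal, so `1` is a denominator.
lemma mem_range_of_isRegularAt [IsAlgClosed k] {h : K}
    (H : ∀ α, IsRegularAt κ (vanishingAt α) h) : ∃ p, h = κ p := by
  let I : Ideal k[X] :=
    { carrier := {t | ∃ s, h * κ t = κ s}
      zero_mem' := ⟨0, by simp⟩
      add_mem' := by
        rintro a b ⟨s, hs⟩ ⟨t, ht⟩
        exact ⟨s + t, by rw [map_add, map_add, mul_add, hs, ht]⟩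
      smul_mem' := by
        rintro c a ⟨s, hs⟩
        exact ⟨c * s, by rw [smul_eq_mul, map_mul, map_mul, ← hs]; ring⟩ }
  have hI : I = ⊤ := by
    by_contra hI
    obtain ⟨M, hM, hIM⟩ := Ideal.exists_le_maximal I hI
    have : ∃ α, M ≤ vanishingAt α := by
      rcases eq_bot_or_eq_vanishingAt M with h | ⟨α, h⟩
      · exact ⟨0, h ▸ bot_le⟩
      · exact ⟨α, h.le⟩
    obtain ⟨α, hα⟩ := this
    obtain ⟨s, t, ht, e⟩ := H α
    exact ht (hα (hIM ⟨s, e⟩))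
  obtain ⟨s, hs⟩ : (1 : k[X]) ∈ I := hI ▸ Submodule.mem_top
  exact ⟨s, by simpa using hs⟩

variable {κ' : k[X] →+* K} (hκ' : Function.Injective κ') (hX : κ X * κ' X = 1)
  (hC : ∀ a, κ (C a) = κ' (C a))

include hX hC

omit hκ in
-- Since `κ' X` is the inverse of `κ X`, dividing `p` by the power of the variable of exponent `deg
-- p` reverses its coefficients.
lemma mul_pow_eq_reverse (p : k[X]) : κ p * κ' X ^ p.natDegree = κ' p.reverse := by
  have h0 : κ X ≠ 0 := left_ne_zero_of_mul_eq_one hX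
  let _ : Invertible (κ X) := invertibleOfNonzero h0
  have h1 : ⅟(κ X) = κ' X := invOf_eq_right_inv hX
  have h2 (q : k[X]) : eval₂ (κ.comp C) (κ X) q = κ q := by
    rw [← Polynomial.hom_eval₂, eval₂_C_X]
  have h3 (q : k[X]) : eval₂ (κ.comp C) (κ' X) q = κ' q := by
    rw [show κ.comp C = κ'.comp C from RingHom.ext hC, ← Polynomial.hom_eval₂, eval₂_C_X]
  have h4 := eval₂_reverse_mul_pow (κ.comp C) (κ X) p
  rw [h1, h2, h3] at h4
  rw [← h4, mul_assoc, ← mul_pow, hX, one_pow, mul_one]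

include hκ'

omit hκ in
-- The pole of `p` at infinity has order `deg p`: multiplied by `κ' X ^ deg p`, it becomes the
-- reversed polynomial, whose value at `0` is the leading coefficient of `p`.
lemma isRegularAt_infty_iff (p : k[X]) (d : ℕ) :
    IsRegularAt κ' (vanishingAt 0) (κ p * κ' X ^ d) ↔ p.natDegree ≤ d := by
  have hr := mul_pow_eq_reverse hX hC p
  constructor
  · rintro ⟨s, t, ht, e⟩
    by_contra! hd
    have hp : p ≠ 0 := by
      rintro rfl
      simp at hd
    obtain ⟨n, hn⟩ := Nat.exists_eq_add_of_lt hd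
    have h1 : p.reverse * t = s * X ^ (n + 1) := by
      refine hκ' ?_
      rw [map_mul, map_mul, ← hr, ← e, map_pow, hn, add_assoc, pow_add]
      ring
    have h2 := congrArg (eval 0) h1
    rw [eval_mul, eval_mul, eval_pow, eval_X, zero_pow (Nat.succ_ne_zero n), mul_zero] at h2
    rcases mul_eq_zero.mp h2 with h | h
    · rw [← coeff_zero_eq_eval_zero, coeff_zero_reverse] at h
      exact hp (leadingCoeff_eq_zero.mp h)
    · exact ht (mem_vanishingAt.mpr h)
  · intro hd
    obtain ⟨n, rfl⟩ := Nat.exists_eq_add_of_le hd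
    rw [pow_add, ← mul_assoc, hr, ← map_pow, ← map_mul]
    exact isRegularAt_map _

omit hκ hκ' in
lemma isUnitAt_infty_mul (α : k) : IsUnitAt κ' (vanishingAt 0) (κ (X - C α) * κ' X) := by
  have : κ (X - C α) * κ' X = κ' (1 - C α * X) := by
    rw [map_sub, sub_mul, hX, hC, map_sub, map_one, map_mul]
  rw [this]
  refine isUnitAt_of_notMem ?_
  rw [mem_vanishingAt]
  simp

end PolynomialFractions

end

/-! ### Divisors and rational functions on the projective line -/

noncomputable section

open Opposite TopologicalSpace AlgebraicGeometry.Scheme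

section ProjectiveLine

open Polynomial

variable {k : Type u} [Field k] {C : Scheme.{u}}

/-- The point of the affine line with coordinate `α`. -/
def linePoint (α : k) : Spec (.of k[X]) := ⟨vanishingAt α, inferInstance⟩

/-- `c₀` and `c₁` are the standard charts, with inverse coordinates, of a projective line. -/
structure IsProjectiveLine [IsIntegral C] (s : C ⟶ Spec (.of k)) (c₀ c₁ : Spec (.of k[X]) ⟶ C)
    [IsOpenImmersion c₀] [IsOpenImmersion c₁] : Prop where
  str₀ : c₀ ≫ s = Spec.map (CommRingCat.ofHom Polynomial.C)
  str₁ : c₁ ≫ s = Spec.map (CommRingCat.ofHom Polynomial.C)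
  cover (x : C) : (∃ y, c₀ y = x) ∨ ∃ y, c₁ y = x
  overlap (y : Spec (.of k[X])) : (X : k[X]) ∉ y.asIdeal → ∃ y', c₀ y' = c₁ y
  mul_eq_one : chartToFunctionField c₀ X * chartToFunctionField c₁ X = 1

lemma chartToFunctionField_of_comp_eq {R A : Type u} [CommRing R] [IsDomain R] [CommRing A]
    [IsIntegral C] (c : Spec (.of R) ⟶ C) [IsOpenImmersion c] (s : C ⟶ Spec (.of A))
    (φ : A →+* R) (h : c ≫ s = Spec.map (CommRingCat.ofHom φ)) (a : A) :
    chartToFunctionField c (φ a) =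
      (C.presheaf.germ ⊤ (genericPoint C) (Opens.mem_top _)).hom (ringHomOfHom s a) := by
  have h1 : chartEquiv c (φ a) = (C.presheaf.map (homOfLE le_top).op).hom (ringHomOfHom s a) := by
    rw [← RingEquiv.eq_symm_apply]
    have h2 : C.presheaf.map (homOfLE le_top).op ≫ (c.appIso ⊤).hom = c.appTop := by
      rw [Scheme.Hom.appIso_hom', Scheme.Hom.map_appLE]
      exact (Scheme.Hom.app_eq_appLE c).symm
    have h3 : (ΓSpecIso (.of A)).inv ≫ s.appTop ≫ C.presheaf.map (homOfLE le_top).op ≫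
        (c.appIso ⊤).hom ≫ (ΓSpecIso (.of R)).hom = CommRingCat.ofHom φ := by
      rw [reassoc_of% h2, ← Scheme.Hom.comp_appTop_assoc, h, Scheme.ΓSpecIso_naturality,
        Iso.inv_hom_id_assoc]
    exact congr($(h3.symm).hom a)
  refine (congrArg (C.germToFunctionField (c ''ᵁ ⊤)).hom h1).trans ?_
  exact C.presheaf.germ_res_apply (homOfLE le_top) (genericPoint C) _ (ringHomOfHom s a)

variable [IsIntegral C] {s : C ⟶ Spec (.of k)} {c₀ c₁ : Spec (.of k[X]) ⟶ C}
    [IsOpenImmersion c₀] [IsOpenImmersion c₁]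

namespace IsProjectiveLine

lemma map_C_eq (h : IsProjectiveLine s c₀ c₁) (a : k) :
    chartToFunctionField c₀ (Polynomial.C a) = chartToFunctionField c₁ (Polynomial.C a) := by
  rw [chartToFunctionField_of_comp_eq c₀ s _ h.str₀, chartToFunctionField_of_comp_eq c₁ s _ h.str₁]

/-- The first chart misses only the origin of the second, and over an algebraically closed field a
prime of `k[X]` is zero or belongs to a point. -/
lemma point_cases [IsAlgClosed k] (h : IsProjectiveLine s c₀ c₁) (x : C) :
    x = genericPoint C ∨ x = c₁ (linePoint 0) ∨ ∃ α, x = c₀ (linePoint α) := by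
  have hcase {c : Spec (.of k[X]) ⟶ C} [IsOpenImmersion c] (y : Spec (.of k[X])) :
      c y = genericPoint C ∨ ∃ α, y = linePoint α := by
    have := y.isPrime
    rcases eq_bot_or_eq_vanishingAt y.asIdeal with hy | ⟨α, hy⟩
    · left
      rw [← chart_bot c]
      exact congrArg c (PrimeSpectrum.ext hy)
    · exact .inr ⟨α, PrimeSpectrum.ext hy⟩
  have h0 (y) : c₀ y = genericPoint C ∨ ∃ α, c₀ y = c₀ (linePoint α) :=
    (hcase y).imp_right fun ⟨α, e⟩ ↦ ⟨α, e ▸ rfl⟩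
  rcases h.cover x with ⟨y, rfl⟩ | ⟨y, rfl⟩
  · exact (h0 y).imp_right .inr
  · rcases hcase (c := c₁) y with hy | ⟨α, rfl⟩
    · exact .inl hy
    · by_cases hα : α = 0
      · exact .inr (.inl (hα ▸ rfl))
      · obtain ⟨y', hy'⟩ := h.overlap (linePoint α) fun hm ↦ hα (by
          simpa using mem_vanishingAt.mp hm)
        rw [← hy']
        exact (h0 y').imp_right .inr

/-- The coordinate of the first chart is regular at `α` and has a pole at infinity. -/
lemma linePoint_ne (h : IsProjectiveLine s c₀ c₁) (α : k) : c₀ (linePoint α) ≠ c₁ (linePoint 0) := by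
  intro e
  obtain ⟨p, q, hq, hpq⟩ := (mem_range_stalk_iff c₁ (x := c₀ (linePoint α)) e.symm _).mp
    ((mem_range_stalk_iff c₀ rfl (chartToFunctionField c₀ X)).mpr
      ⟨X, 1, Ideal.IsPrime.one_notMem (linePoint α).isPrime, by simp⟩)
  refine hq (Ideal.mem_span_singleton.mpr ⟨p, chartToFunctionField_injective c₁ ?_⟩)
  rw [map_zero, sub_zero, map_mul, ← hpq, ← mul_assoc, mul_comm (chartToFunctionField c₁ X),
    h.mul_eq_one, one_mul]

variable [IsLocallyNoetherian C]

lemma ord_zpow {x : C} {f : C.functionField} (hf : f ≠ 0) (n : ℤ) :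
    Scheme.ord (f ^ n) x = n * Scheme.ord f x := by
  have h1 : Scheme.ord (1 : C.functionField) x = 0 := by
    have := Scheme.ord_mul (x := x) (one_ne_zero (α := C.functionField)) one_ne_zero
    rw [mul_one] at this
    linarith
  induction n with
  | zero => simpa using h1
  | succ n ih => rw [zpow_add_one₀ hf, Scheme.ord_mul (zpow_ne_zero _ hf) hf, ih]; ring
  | pred n ih =>
    have := Scheme.ord_mul (x := x) (zpow_ne_zero (-(n : ℤ) - 1) hf) hf
    rw [← zpow_add_one₀ hf, sub_add_cancel, ih] at this
    linear_combination -this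

/-- Some exponent makes `h` a unit at `α`; taking orders shows that it is the order of `h`, as `X -
α` has order one and units have order zero. -/
lemma isUnitAt_mul_zpow_ord (c : Spec (.of k[X]) ⟶ C) [IsOpenImmersion c] (α : k)
    {h : C.functionField} (h0 : h ≠ 0) :
    IsUnitAt (chartToFunctionField c) (vanishingAt α) (h *
      chartToFunctionField c (X - Polynomial.C α) ^ (-(Scheme.ord h (c (linePoint α))))) := by
  have hκ := chartToFunctionField_injective c
  obtain ⟨n, hn⟩ := exists_isUnitAt_mul_zpow hκ α h0 (exists_mul_eq_chart c h)
  have hx : chartToFunctionField c (X - Polynomial.C α) ≠ 0 :=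
    (map_ne_zero_iff _ hκ).mpr (X_sub_C_ne_zero α)
  suffices Scheme.ord h (c (linePoint α)) = n by rwa [this]
  obtain ⟨p, q, hp, hq, e⟩ := hn
  have hp0 := map_ne_zero_of_notMem hκ hp
  have hq0 := map_ne_zero_of_notMem hκ hq
  have e' := congrArg (fun z ↦ Scheme.ord z (c (linePoint α))) e
  simp only at e'
  rw [Scheme.ord_mul (mul_ne_zero h0 (zpow_ne_zero _ hx)) hq0, Scheme.ord_mul h0 (zpow_ne_zero _ hx),
    ord_chart_eq_zero c (linePoint α) p hp, ord_chart_eq_zero c (linePoint α) q hq, ord_zpow hx,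
    ord_chart_eq_one c (linePoint α) _ (X_sub_C_ne_zero α) rfl] at e'
  linarith

/-- The rational functions `h` with `h * w x` regular at all `x`, where the `w x` are local
equations of a divisor of degree `-d`, are identified with the polynomials of degree `≤ d`. -/
theorem exists_twist [IsAlgClosed k] (H : IsProjectiveLine s c₀ c₁) (w : C → C.functionField)
    (hw : ∀ x, w x ≠ 0) (hfin : (fun x ↦ Scheme.ord (w x) x).support.Finite) (d : ℕ)
    (hsum : ∑ᶠ x, Scheme.ord (w x) x = d) :
    ∃ W : C.functionField, W ≠ 0 ∧ ∀ h : C.functionField,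
      (∀ x, ∃ a : C.presheaf.stalk x, algebraMap _ C.functionField a = h * w x) ↔
        ∃ p : k[X], p.natDegree ≤ d ∧ h * W = chartToFunctionField c₀ p := by
  classical
  set κ := chartToFunctionField c₀ with hκdef
  set κ' := chartToFunctionField c₁ with hκ'def
  have hκ : Function.Injective κ := chartToFunctionField_injective c₀
  have hκ' : Function.Injective κ' := chartToFunctionField_injective c₁
  have hX : κ X * κ' X = 1 := H.mul_eq_one
  have hC : ∀ a, κ (Polynomial.C a) = κ' (Polynomial.C a) := H.map_C_eq
  set m : C → ℤ := fun x ↦ Scheme.ord (w x) x with hm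
  set infty : C := c₁ (linePoint 0) with hinfty
  -- The generic point has coheight zero, so it does not contribute to the divisor.
  have hmη : m (genericPoint C) = 0 := by
    refine Scheme.ord_eq_zero_of_coheight_neq_one ?_ _
    have : Order.coheight (genericPoint C) = 0 :=
      Order.coheight_eq_zero.mpr fun b _ ↦ (genericPoint_spec C).specializes (Set.mem_univ b)
    exact this ▸ zero_ne_one
  let S := hfin.toFinset.erase infty
  have hS (x : C) : x ∈ S ↔ x ≠ infty ∧ m x ≠ 0 := by
    simp [S, Function.mem_support]
  have hα (x : C) : ∃ α, x ∈ S → x = c₀ (linePoint α) := by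
    by_cases hx : x ∈ S
    · rcases H.point_cases x with rfl | rfl | ⟨α, hα⟩
      · exact (((hS _).mp hx).2 hmη).elim
      · exact (((hS _).mp hx).1 rfl).elim
      · exact ⟨α, fun _ ↦ hα⟩
    · exact ⟨0, fun h ↦ (hx h).elim⟩
  choose α hα using hα
  have hpt {a b : k} (e : c₀ (linePoint a) = c₀ (linePoint b)) : a = b := by
    have h1 : vanishingAt a = vanishingAt b :=
      congrArg PrimeSpectrum.asIdeal (c₀.isOpenEmbedding.injective e)
    have h2 : (X - Polynomial.C a) ∈ vanishingAt b := h1 ▸ Ideal.mem_span_singleton_self _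
    have h3 := mem_vanishingAt.mp h2
    rw [eval_sub, eval_X, eval_C, sub_eq_zero] at h3
    exact h3.symm
  have hx0 (a : k) : κ (X - Polynomial.C a) ≠ 0 := (map_ne_zero_iff _ hκ).mpr (X_sub_C_ne_zero a)
  have hX1 : κ' X ≠ 0 := right_ne_zero_of_mul_eq_one hX
  have hdeg : ∑ x ∈ S, m x = d - m infty := by
    rw [← hsum, finsum_eq_sum_of_support_subset m (s := insert infty hfin.toFinset) (by
      simp [Set.subset_insert]), ← Finset.add_sum_erase _ _ (Finset.mem_insert_self _ _),
      Finset.erase_insert_eq_erase]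
    ring
  -- `W` has the prescribed order `m` at every finite point. Each `X - α` has a simple pole at
  -- infinity, so the order of `W` there is `m infty - d`; the degree bound `d` is this discrepancy.
  let W := ∏ x ∈ S, κ (X - Polynomial.C (α x)) ^ m x
  have hunit (a : k) : IsUnitAt κ (vanishingAt a)
      (W * κ (X - Polynomial.C a) ^ (-(m (c₀ (linePoint a))))) := by
    have hother (T : Finset C) (hT : ∀ x ∈ T, x ∈ S ∧ x ≠ c₀ (linePoint a)) :
        IsUnitAt κ (vanishingAt a) (∏ x ∈ T, κ (X - Polynomial.C (α x)) ^ m x) := by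
      refine IsUnitAt.prod _ _ fun x hx ↦ (isUnitAt_of_notMem fun hm ↦ ?_).zpow hκ _
      have h3 := mem_vanishingAt.mp hm
      rw [eval_sub, eval_X, eval_C, sub_eq_zero] at h3
      exact (hT x hx).2 (h3 ▸ hα x (hT x hx).1)
    by_cases ha : c₀ (linePoint a) ∈ S
    · have haa : α (c₀ (linePoint a)) = a := hpt (hα _ ha).symm
      have : W * κ (X - Polynomial.C a) ^ (-(m (c₀ (linePoint a)))) =
          ∏ x ∈ S.erase (c₀ (linePoint a)), κ (X - Polynomial.C (α x)) ^ m x := by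
        simp only [W]
        rw [← Finset.mul_prod_erase S (fun x ↦ κ (X - Polynomial.C (α x)) ^ m x) ha, haa, mul_right_comm, ← zpow_add₀ (hx0 a), add_neg_cancel,
          zpow_zero, one_mul]
      rw [this]
      exact hother _ fun x hx ↦ ⟨Finset.mem_of_mem_erase hx, Finset.ne_of_mem_erase hx⟩
    · have h0 : m (c₀ (linePoint a)) = 0 := by
        by_contra h0
        exact ha ((hS _).mpr ⟨H.linePoint_ne a, h0⟩)
      rw [h0, neg_zero, zpow_zero, mul_one]
      exact hother _ fun x hx ↦ ⟨hx, fun e ↦ ha (e ▸ hx)⟩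
  have hunit' : IsUnitAt κ' (vanishingAt 0) (W * κ' X ^ d * κ' X ^ (-(m infty))) := by
    have hpow (T : Finset C) : ∏ x ∈ T, κ' X ^ m x = κ' X ^ ∑ x ∈ T, m x := by
      induction T using Finset.induction_on with
      | empty => simp
      | insert a T ha ih => rw [Finset.prod_insert ha, Finset.sum_insert ha, zpow_add₀ hX1, ih]
    have : W * κ' X ^ d * κ' X ^ (-(m infty)) =
        ∏ x ∈ S, (κ (X - Polynomial.C (α x)) * κ' X) ^ m x := by
      simp_rw [mul_zpow]
      rw [Finset.prod_mul_distrib, hpow, hdeg, mul_assoc, sub_eq_add_neg,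
        zpow_add₀ hX1, zpow_natCast]
    rw [this]
    exact IsUnitAt.prod _ _ fun x _ ↦ (isUnitAt_infty_mul hX hC _).zpow hκ' _
  refine ⟨W, Finset.prod_ne_zero_iff.mpr fun x _ ↦ zpow_ne_zero _ (hx0 _), fun h ↦ ?_⟩
  -- At a finite point `w x` and `W` have the same order and impose the same condition on `h`; at
  -- infinity `W` has to be corrected by `κ' X ^ d`.
  have key1 (a : k) : (∃ b : C.presheaf.stalk (c₀ (linePoint a)),
      algebraMap _ C.functionField b = h * w (c₀ (linePoint a))) ↔
      IsRegularAt κ (vanishingAt a) (h * W) :=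
    (mem_range_stalk_iff c₀ rfl _).trans (isRegularAt_mul_iff (P := vanishingAt a) hκ (zpow_ne_zero _ (hx0 a))
      (isUnitAt_mul_zpow_ord c₀ a (hw _)) (hunit a))
  have key2 : (∃ b : C.presheaf.stalk infty, algebraMap _ C.functionField b = h * w infty) ↔
      IsRegularAt κ' (vanishingAt 0) (h * (W * κ' X ^ d)) := by
    refine (mem_range_stalk_iff c₁ (y := linePoint 0) rfl _).trans
      (isRegularAt_mul_iff (P := vanishingAt 0) hκ' (zpow_ne_zero _ hX1) ?_ hunit')
    have := isUnitAt_mul_zpow_ord c₁ 0 (hw infty)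
    rwa [map_zero, sub_zero] at this
  constructor
  · intro hh
    obtain ⟨p, hp⟩ := mem_range_of_isRegularAt (κ := κ) (h := h * W) fun a ↦ (key1 a).mp (hh _)
    refine ⟨p, ?_, hp⟩
    rw [← isRegularAt_infty_iff hκ' hX hC, ← hp, mul_assoc]
    exact key2.mp (hh _)
  · rintro ⟨p, hp, e⟩ x
    rcases H.point_cases x with rfl | rfl | ⟨a, rfl⟩
    · exact ⟨h * w _, congr($(TopCat.Presheaf.stalkSpecializes_refl C.presheaf
        (genericPoint C)).hom (h * w _))⟩
    · rw [key2, ← mul_assoc, e]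
      exact (isRegularAt_infty_iff hκ' hX hC p d).mpr hp
    · rw [key1, e]
      exact isRegularAt_map p

end IsProjectiveLine

end ProjectiveLine

end

/-! ### Projective space by homogeneous coordinates -/

noncomputable section

open Opposite TopologicalSpace AlgebraicGeometry.Scheme

attribute [local instance] MvPolynomial.gradedAlgebra

section ProjectiveSpace

open MvPolynomial HomogeneousLocalization

variable {k : Type u} [Field k] {n : ℕ}

/-- The homogeneous coordinate ring of projective space. -/
abbrev ProjPoly (k : Type u) [Field k] (n : ℕ) : Type u := MvPolynomial (Fin (n + 1)) k

lemma X_mem_homogeneousSubmodule (j : Fin (n + 1)) :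
    (X j : ProjPoly k n) ∈ homogeneousSubmodule (Fin (n + 1)) k 1 :=
  isHomogeneous_X k j

/-- The degree zero part of `k[x₀, …, xₙ]` localised at `f`. -/
abbrev ProjAway (f : ProjPoly k n) : Type u :=
  Away (homogeneousSubmodule (Fin (n + 1)) k) f

/-- The inclusion of the constants in the coordinate ring of `{f ≠ 0}`. -/
def projAwayC (f : ProjPoly k n) : k →+* ProjAway f :=
  (fromZeroRingHom _ _).comp (algebraMap k (homogeneousSubmodule (Fin (n + 1)) k 0))

/-- The function `x_i / x_j` on `{x_j ≠ 0}`. -/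
def projCoord (j i : Fin (n + 1)) : ProjAway (X j : ProjPoly k n) :=
  Away.mk _ (X_mem_homogeneousSubmodule j) 1 (X i) (X_mem_homogeneousSubmodule i)

lemma val_projAwayC (f : ProjPoly k n) (c : k) :
    (projAwayC f c).val = algebraMap (ProjPoly k n) _ (C c) := by
  change Localization.mk _ _ = _
  rw [Localization.mk_eq_mk']
  exact IsLocalization.mk'_one _ _

lemma algebraMap_mul_val_projCoord (j i : Fin (n + 1)) :
    algebraMap (ProjPoly k n) (Localization.Away (X j : ProjPoly k n)) (X j) * (projCoord j i).val =
      algebraMap (ProjPoly k n) (Localization.Away (X j : ProjPoly k n)) (X i) := by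
  rw [projCoord, Away.val_mk, Localization.mk_eq_mk', mul_comm]
  convert! IsLocalization.mk'_spec (Localization.Away (X j : ProjPoly k n)) (X i)
    (⟨X j ^ 1, 1, rfl⟩ : Submonoid.powers (X j : ProjPoly k n))
  simp

lemma eval₂_mul_of_isHomogeneous {σ R S : Type*} [CommSemiring R] [CommSemiring S] (ρ : R →+* S)
    (c : S) (a : σ → S) {F : MvPolynomial σ R} {m : ℕ} (hF : F.IsHomogeneous m) :
    eval₂ ρ (fun i ↦ c * a i) F = c ^ m * eval₂ ρ a F := by
  rw [eval₂_eq, eval₂_eq, Finset.mul_sum]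
  refine Finset.sum_congr rfl fun d hd ↦ ?_
  simp_rw [mul_pow]
  rw [Finset.prod_mul_distrib, Finset.prod_pow_eq_pow_sum,
    show ∑ i ∈ d.support, d i = m from hF.degree_eq_sum_deg_support hd |>.symm]
  ring

lemma eval₂_congr_of_eq {σ R S : Type*} [CommSemiring R] [CommSemiring S] {ρ ρ' : R →+* S}
    {a a' : σ → S} (hρ : ρ = ρ') (ha : ∀ i, a i = a' i) (F : MvPolynomial σ R) :
    eval₂ ρ a F = eval₂ ρ' a' F := by
  obtain rfl := hρ
  obtain rfl := funext ha
  rfl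

/-- Dehomogenisation, `F / x_j^m = F(x₀/x_j, …, xₙ/x_j)`. It shows that the constants and the `x_i /
x_j` generate the coordinate ring of `{x_j ≠ 0}`. -/
lemma eval₂_projCoord (j : Fin (n + 1)) {F : ProjPoly k n} {m : ℕ}
    (hF : F ∈ homogeneousSubmodule (Fin (n + 1)) k (m • 1)) :
    Away.mk _ (X_mem_homogeneousSubmodule j) m F hF = eval₂ (projAwayC _) (projCoord j) F := by
  have hF' : F.IsHomogeneous m := by simpa using hF
  apply HomogeneousLocalization.val_injective
  have h1 : algebraMap (ProjPoly k n) (Localization.Away (X j)) F =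
      algebraMap (ProjPoly k n) _ (X j) ^ m * (eval₂ (projAwayC _) (projCoord j) F).val := by
    rw [← HomogeneousLocalization.algebraMap_apply, hom_eval₂,
      ← eval₂_mul_of_isHomogeneous _ _ _ hF']
    conv_lhs => rw [← eval₂_eta F, hom_eval₂]
    exact eval₂_congr_of_eq (RingHom.ext fun c ↦ (val_projAwayC (X j) c).symm)
      (fun i ↦ (algebraMap_mul_val_projCoord j i).symm) F
  rw [Away.val_mk, Localization.mk_eq_mk', IsLocalization.mk'_eq_iff_eq_mul, h1, map_pow, mul_comm]

/-- A ring homomorphism from the coordinate ring of `{f ≠ 0}`, given by homogeneous coordinates. -/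
def projEval {R : Type*} [CommRing R] {f : ProjPoly k n} (ρ : k →+* R)
    (a : Fin (n + 1) → R) (h : IsUnit (eval₂Hom ρ a f)) : ProjAway f →+* R :=
  (Localization.awayLift (eval₂Hom ρ a) f h).comp (algebraMap (ProjAway f) (Localization.Away f))

section

variable {R : Type*} [CommRing R] {f : ProjPoly k n} (ρ : k →+* R)
    (a : Fin (n + 1) → R)

lemma projEval_C (h : IsUnit (eval₂Hom ρ a f)) (c : k) : projEval ρ a h (projAwayC f c) = ρ c := by
  rw [projEval, RingHom.comp_apply, HomogeneousLocalization.algebraMap_apply, val_projAwayC]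
  exact (IsLocalization.Away.lift_eq _ h _).trans (eval₂_C _ _ _)

lemma projEval_coord {j : Fin (n + 1)} (h : IsUnit (eval₂Hom ρ a (X j))) (i : Fin (n + 1)) :
    a j * projEval ρ a h (projCoord j i) = a i := by
  have h1 (l) : Localization.awayLift (eval₂Hom ρ a) (X j) h (algebraMap (ProjPoly k n) _ (X l)) = a l :=
    (IsLocalization.Away.lift_eq _ h _).trans (eval₂_X _ _ _)
  rw [← h1 j, projEval, RingHom.comp_apply, HomogeneousLocalization.algebraMap_apply, ← map_mul,
    algebraMap_mul_val_projCoord, h1]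

lemma projEval_awayMap {g x : ProjPoly k n} {m : ℕ}
    (hg : g ∈ homogeneousSubmodule (Fin (n + 1)) k m)
    (hx : x = f * g) (h : IsUnit (eval₂Hom ρ a f)) (h' : IsUnit (eval₂Hom ρ a x)) (z : ProjAway f) :
    projEval ρ a h' (awayMap _ hg hx z) = projEval ρ a h z := by
  simp only [projEval, RingHom.comp_apply, HomogeneousLocalization.algebraMap_apply]
  rw [val_awayMap]
  rw [← RingHom.comp_apply]
  congr 1
  refine IsLocalization.ringHom_ext (Submonoid.powers f) (RingHom.ext fun y ↦ ?_)
  simp [IsLocalization.Away.lift_eq]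

lemma projAway_ringHom_ext {j : Fin (n + 1)}
    {φ ψ : ProjAway (X j : ProjPoly k n) →+* R}
    (h1 : ∀ c, φ (projAwayC _ c) = ψ (projAwayC _ c))
    (h2 : ∀ i, φ (projCoord j i) = ψ (projCoord j i)) : φ = ψ := by
  refine RingHom.ext fun z ↦ ?_
  obtain ⟨m, F, hF, rfl⟩ := Away.mk_surjective _ (X_mem_homogeneousSubmodule j) z
  rw [eval₂_projCoord j hF, hom_eval₂, hom_eval₂]
  congr 1
  · exact RingHom.ext h1
  · exact funext h2

end

/-- The standard chart `{x_j ≠ 0}` of projective space. -/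
def projChart (k : Type u) [Field k] {n : ℕ} (j : Fin (n + 1)) :
    Spec (.of (ProjAway (X j : ProjPoly k n))) ⟶ ProjSp k n :=
  Proj.awayι (homogeneousSubmodule (Fin (n + 1)) k) (X j) (X_mem_homogeneousSubmodule j) one_pos

instance (j : Fin (n + 1)) : IsOpenImmersion (projChart k j) :=
  inferInstanceAs (IsOpenImmersion (Proj.awayι (homogeneousSubmodule (Fin (n + 1)) k) (X j) _ _))

lemma opensRange_projChart (j : Fin (n + 1)) :
    (projChart k j).opensRange = Proj.basicOpen _ (X j) :=
  Proj.opensRange_awayι _ _ _ _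

lemma projChart_str (j : Fin (n + 1)) :
    projChart k j ≫ projSpStr k n = Spec.map (CommRingCat.ofHom (projAwayC _)) := by
  refine (Proj.awayι_toSpecZero_assoc _ _ _ _ _).trans ?_
  rw [← Spec.map_comp]
  rfl

lemma projChart_preimage_basicOpen (j i : Fin (n + 1)) :
    projChart k j ⁻¹ᵁ Proj.basicOpen _ (X i) = PrimeSpectrum.basicOpen (projCoord j i) := by
  refine (Proj.awayι_preimage_basicOpen _ (X_mem_homogeneousSubmodule j) one_pos (X_mem_homogeneousSubmodule i)
    one_pos).trans ?_
  congr 1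
  apply HomogeneousLocalization.val_injective
  simp [projCoord, Away.isLocalizationElem]

lemma exists_projChart (x : ProjSp k n) : ∃ j y, projChart k j y = x := by
  have : ⨆ j : Fin (n + 1), Proj.basicOpen (homogeneousSubmodule (Fin (n + 1)) k) (X j) = ⊤ := by
    refine Proj.iSup_basicOpen_eq_top' _ X (fun j ↦ ⟨1, X_mem_homogeneousSubmodule j⟩) ?_
    refine eq_top_iff.mpr fun F _ ↦ ?_
    induction F using MvPolynomial.induction_on with
    | C c =>
      exact Subalgebra.algebraMap_mem _
        (⟨C c, isHomogeneous_C _ c⟩ : homogeneousSubmodule (Fin (n + 1)) k 0)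
    | add F G hF hG => exact add_mem (hF trivial) (hG trivial)
    | mul_X F i hF => exact mul_mem (hF trivial) (Algebra.subset_adjoin ⟨i, rfl⟩)
  obtain ⟨j, hj⟩ := Opens.mem_iSup.mp (this.ge (Opens.mem_top x))
  rw [← opensRange_projChart] at hj
  exact ⟨j, hj⟩

variable {R : Type u} [CommRing R] (ρ : k →+* R) (a b : Fin (n + 1) → R)

/-- The point of projective space with homogeneous coordinates `a`, where `a j` is a unit. -/
def projPoint (j : Fin (n + 1)) (h : IsUnit (a j)) : Spec (.of R) ⟶ ProjSp k n :=
  Spec.map (CommRingCat.ofHom (projEval ρ a (f := X j) (by rwa [coe_eval₂Hom, eval₂_X]))) ≫ projChart k j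

lemma projPoint_str (j : Fin (n + 1)) (h : IsUnit (a j)) :
    projPoint ρ a j h ≫ projSpStr k n = Spec.map (CommRingCat.ofHom ρ) := by
  rw [projPoint, Category.assoc, projChart_str, ← Spec.map_comp, ← CommRingCat.ofHom_comp]
  congr 2
  exact RingHom.ext fun c ↦ projEval_C ρ a (f := X j) (by rwa [coe_eval₂Hom, eval₂_X]) c

lemma map_projPoint {R' : Type u} [CommRing R'] (φ : R →+* R') (j : Fin (n + 1)) (h : IsUnit (a j)) :
    Spec.map (CommRingCat.ofHom φ) ≫ projPoint ρ a j h =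
      projPoint (φ.comp ρ) (fun i ↦ φ (a i)) j (h.map φ) := by
  rw [projPoint, projPoint, ← Category.assoc, ← Spec.map_comp, ← CommRingCat.ofHom_comp]
  congr 3
  refine projAway_ringHom_ext (fun c ↦ ?_) fun i ↦ ?_
  · simp [projEval_C]
  · refine (h.map φ).mul_left_cancel ?_
    rw [projEval_coord _ (fun i ↦ φ (a i)), RingHom.comp_apply, ← map_mul, projEval_coord]

/-- Both morphisms factor through `{x_i x_j ≠ 0}`, where they are given by the same evaluation. -/
lemma projPoint_eq_of_isUnit (i j : Fin (n + 1)) (hi : IsUnit (a i)) (hj : IsUnit (a j)) :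
    projPoint ρ a i hi = projPoint ρ a j hj := by
  have hu : IsUnit (eval₂Hom ρ a (X i * X j)) := by
    rw [map_mul, coe_eval₂Hom, eval₂_X, eval₂_X]
    exact hi.mul hj
  have h1 (l m : Fin (n + 1)) (hl : IsUnit (a l)) (e : (X i * X j : ProjPoly k n) = X l * X m) :
      projPoint ρ a l hl = Spec.map (CommRingCat.ofHom (projEval ρ a hu)) ≫
        Proj.awayι _ (X i * X j) (SetLike.mul_mem_graded (X_mem_homogeneousSubmodule i) (X_mem_homogeneousSubmodule j))
        (by simp) := by
    have h2 := Proj.SpecMap_awayMap_awayι (homogeneousSubmodule (Fin (n + 1)) k)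
      (X_mem_homogeneousSubmodule l) one_pos (X_mem_homogeneousSubmodule m) e
    rw [← h2]
    refine Eq.trans ?_ (Category.assoc _ _ _)
    rw [← Spec.map_comp, ← CommRingCat.ofHom_comp]
    refine congrArg (fun φ ↦ Spec.map (CommRingCat.ofHom φ) ≫ projChart k l) ?_
    exact RingHom.ext fun z ↦ (projEval_awayMap ρ a _ e _ hu z).symm
  rw [h1 i j hi rfl, h1 j i hj (mul_comm _ _)]

lemma projPoint_eq_of_mul (j : Fin (n + 1)) (h : IsUnit (a j)) (h' : IsUnit (b j)) (c : R)
    (hc : IsUnit c) (hb : ∀ i, b i = c * a i) : projPoint ρ a j h = projPoint ρ b j h' := by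
  rw [projPoint, projPoint]
  congr 3
  refine projAway_ringHom_ext (fun c ↦ ?_) fun i ↦ ?_
  · rw [projEval_C, projEval_C]
  · refine (hc.mul h).mul_left_cancel ?_
    rw [mul_assoc, projEval_coord, ← hb, ← hb, projEval_coord]

end ProjectiveSpace

end

noncomputable section

open Opposite TopologicalSpace AlgebraicGeometry.Scheme

attribute [local instance] MvPolynomial.gradedAlgebra

section

variable {R : Type u} [CommRing R] {C : Scheme.{u}}

lemma appLE_chartEquiv (c : Spec (.of R) ⟶ C) [IsOpenImmersion c] (a : R) :
    (c.appLE (c ''ᵁ ⊤) ⊤ (c.preimage_image_eq ⊤).ge).hom (chartEquiv c a) =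
      (ΓSpecIso (.of R)).inv.hom a := by
  rw [← Scheme.Hom.appIso_hom']
  exact congr($((c.appIso ⊤).inv_hom_id).hom ((ΓSpecIso (.of R)).inv.hom a))

lemma chartToFunctionField_comp {R' : Type u} [CommRing R'] [IsDomain R] [IsDomain R']
    [IsIntegral C] (c : Spec (.of R) ⟶ C) [IsOpenImmersion c] (φ : R →+* R')
    (o : Spec (.of R') ⟶ C) [IsOpenImmersion o] (h : Spec.map (CommRingCat.ofHom φ) ≫ c = o)
    (a : R) : chartToFunctionField o (φ a) = chartToFunctionField c a := by
  have hle : o ''ᵁ ⊤ ≤ c ''ᵁ ⊤ := by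
    rintro _ ⟨y, -, rfl⟩
    exact ⟨Spec.map (CommRingCat.ofHom φ) y, trivial, congr($h y)⟩
  have h1 : chartEquiv o (φ a) = (C.presheaf.map (homOfLE hle).op).hom (chartEquiv c a) := by
    have h2 : Function.Injective (o.appLE (o ''ᵁ ⊤) ⊤ (o.preimage_image_eq ⊤).ge).hom := by
      rw [← Scheme.Hom.appIso_hom']
      exact (o.appIso ⊤).commRingCatIsoToRingEquiv.injective
    apply h2
    rw [appLE_chartEquiv]
    have h3 : C.presheaf.map (homOfLE hle).op ≫ o.appLE (o ''ᵁ ⊤) ⊤ (o.preimage_image_eq ⊤).ge =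
        c.appLE (c ''ᵁ ⊤) ⊤ (c.preimage_image_eq ⊤).ge ≫
          (Spec.map (CommRingCat.ofHom φ)).appTop := by
      subst h
      rw [Scheme.Hom.map_appLE, ← Scheme.Hom.appLE_comp_appLE _ _ _ ⊤ _
        (c.preimage_image_eq ⊤).ge le_top]
      congr 1
    refine Eq.trans ?_ congr($(h3).hom (chartEquiv c a)).symm
    refine Eq.trans ?_ congr((Spec.map (CommRingCat.ofHom φ)).appTop.hom
      $(appLE_chartEquiv c a)).symm
    exact congr($(ΓSpecIso_inv_naturality (CommRingCat.ofHom φ)).hom a)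
  refine (congrArg (C.germToFunctionField (o ''ᵁ ⊤)).hom h1).trans ?_
  exact C.presheaf.germ_res_apply (homOfLE hle) (genericPoint C) _ (chartEquiv c a)

end

section ProjectiveSpace

open MvPolynomial HomogeneousLocalization

variable {k : Type u} [Field k] {n : ℕ} {R : Type u} [CommRing R] (ρ : k →+* R)
  (a : Fin (n + 1) → R)

lemma projPoint_mem_basicOpen_iff (j : Fin (n + 1)) (h : IsUnit (a j)) (i : Fin (n + 1))
    (y : Spec (.of R)) :
    projPoint ρ a j h y ∈ Proj.basicOpen (homogeneousSubmodule (Fin (n + 1)) k) (X i) ↔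
      a i ∉ y.asIdeal := by
  have hu : IsUnit (eval₂Hom ρ a (X j)) := by rwa [coe_eval₂Hom, eval₂_X]
  have h1 : projPoint ρ a j h y ∈ Proj.basicOpen (homogeneousSubmodule (Fin (n + 1)) k) (X i) ↔
      Spec.map (CommRingCat.ofHom (projEval ρ a hu)) y ∈
        projChart k j ⁻¹ᵁ Proj.basicOpen (homogeneousSubmodule (Fin (n + 1)) k) (X i) := Iff.rfl
  rw [h1, projChart_preimage_basicOpen]
  change projEval ρ a hu (projCoord j i) ∉ y.asIdeal ↔ _
  rw [← projEval_coord ρ a hu i, not_iff_not, Ideal.unit_mul_mem_iff_mem _ h]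

lemma isIso_map_projEval (j : Fin (n + 1)) (h : IsUnit (eval₂Hom ρ a (X j)))
    (hb : Function.Bijective (projEval ρ a h)) :
    IsIso (Spec.map (CommRingCat.ofHom (projEval ρ a h))) := by
  have : IsIso (CommRingCat.ofHom (projEval ρ a h)) :=
    (ConcreteCategory.isIso_iff_bijective _).mpr hb
  infer_instance

lemma isOpenImmersion_projPoint (j : Fin (n + 1)) (h : IsUnit (a j))
    (hb : Function.Bijective (projEval ρ a (f := X j) (by rwa [coe_eval₂Hom, eval₂_X]))) :
    IsOpenImmersion (projPoint ρ a j h) := by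
  have := isIso_map_projEval ρ a j _ hb
  exact inferInstanceAs (IsOpenImmersion (Spec.map _ ≫ projChart k j))

lemma exists_projPoint_eq (j : Fin (n + 1)) (h : IsUnit (a j))
    (hb : Function.Bijective (projEval ρ a (f := X j) (by rwa [coe_eval₂Hom, eval₂_X])))
    {x : ProjSp k n} (hx : x ∈ Proj.basicOpen (homogeneousSubmodule (Fin (n + 1)) k) (X j)) :
    ∃ y, projPoint ρ a j h y = x := by
  have hu : IsUnit (eval₂Hom ρ a (X j)) := by rwa [coe_eval₂Hom, eval₂_X]
  have := isIso_map_projEval ρ a j hu hb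
  rw [← opensRange_projChart] at hx
  obtain ⟨y, rfl⟩ := hx
  obtain ⟨z, rfl⟩ := (Spec.map (CommRingCat.ofHom (projEval ρ a hu))).homeomorph.surjective y
  exact ⟨z, rfl⟩

variable {ρ a} in
lemma projPoint_eq {ρ' : k →+* R} (hρ : ρ = ρ') {b : Fin (n + 1) → R} {i j : Fin (n + 1)}
    (hi : IsUnit (a i)) (hj : IsUnit (b j)) {c : R} (hc : IsUnit c) (hb : ∀ l, b l = c * a l) :
    projPoint ρ a i hi = projPoint ρ' b j hj := by
  subst hρ
  have hj' : IsUnit (a j) := isUnit_of_mul_isUnit_right (hb j ▸ hj)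
  rw [projPoint_eq_of_isUnit ρ a i j hi hj']
  exact projPoint_eq_of_mul ρ a b j hj' hj c hc hb

end ProjectiveSpace

/-! ### The standard charts of `ℙ¹` -/

section ProjectiveLine

open Polynomial LaurentPolynomial

variable (k : Type u) [Field k]

/-- The chart `t ↦ (1 : t)` of the projective line. -/
def lineChart₀ : Spec (.of k[X]) ⟶ ProjSp k 1 :=
  projPoint Polynomial.C ![1, X] 0 isUnit_one

/-- The chart `t ↦ (t : 1)` of the projective line. -/
def lineChart₁ : Spec (.of k[X]) ⟶ ProjSp k 1 :=
  projPoint Polynomial.C ![X, 1] 1 isUnit_one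

variable {k} in
-- Makes `{x_i ≠ 0}` an affine line: the inverse sends `X` to `x_j / x_i`, and the composites are
-- checked on generators.
lemma bijective_projEval_line (a : Fin 2 → k[X]) (i j : Fin 2) (hij : ∀ l, l = i ∨ l = j)
    (hi : a i = 1) (hj : a j = X) (h : IsUnit (MvPolynomial.eval₂Hom Polynomial.C a
      (MvPolynomial.X i))) :
    Function.Bijective (projEval (n := 1) (Polynomial.C (R := k)) a h) := by
  let ψ : k[X] →+* ProjAway (MvPolynomial.X i : ProjPoly k 1) :=
    Polynomial.eval₂RingHom (projAwayC _) (projCoord i j)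
  have h1 (l) : projEval (n := 1) (Polynomial.C (R := k)) a h (projCoord i l) = a l := by
    rw [← projEval_coord _ a h l, hi, one_mul]
  have h0 : projCoord i i = (1 : ProjAway (MvPolynomial.X i : ProjPoly k 1)) := by
    apply HomogeneousLocalization.val_injective
    rw [projCoord, HomogeneousLocalization.Away.val_mk, HomogeneousLocalization.val_one]
    simp
  refine ⟨Function.LeftInverse.injective (g := ψ) ?_, Function.RightInverse.surjective (g := ψ) ?_⟩
  · intro z
    suffices ψ.comp (projEval (n := 1) (Polynomial.C (R := k)) a h) = RingHom.id _ from
      congr($this z)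
    refine projAway_ringHom_ext (fun c ↦ ?_) fun l ↦ ?_
    · simp [projEval_C, ψ]
    · rw [RingHom.comp_apply, h1]
      rcases hij l with rfl | rfl
      · simp [hi, h0]
      · simp [hj, ψ]
  · intro z
    suffices (projEval (n := 1) (Polynomial.C (R := k)) a h).comp ψ = RingHom.id _ from
      congr($this z)
    refine Polynomial.ringHom_ext (fun c ↦ ?_) ?_
    · simp [ψ, projEval_C]
    · simp [ψ, h1, hj]

instance : IsOpenImmersion (lineChart₀ k) :=
  isOpenImmersion_projPoint _ _ _ _ (bijective_projEval_line _ 0 1 (by decide) rfl rfl _)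

instance : IsOpenImmersion (lineChart₁ k) :=
  isOpenImmersion_projPoint _ _ _ _ (bijective_projEval_line _ 1 0 (by decide) rfl rfl _)

lemma lineChart_cover (x : ProjSp k 1) :
    (∃ y, lineChart₀ k y = x) ∨ ∃ y, lineChart₁ k y = x := by
  obtain ⟨j, y, rfl⟩ := exists_projChart x
  have hy : projChart k j y ∈ (projChart k j).opensRange := ⟨y, rfl⟩
  rw [opensRange_projChart] at hy
  fin_cases j
  · exact .inl (exists_projPoint_eq _ _ _ _ (bijective_projEval_line _ 0 1 (by decide) rfl rfl _) hy)
  · exact .inr (exists_projPoint_eq _ _ _ _ (bijective_projEval_line _ 1 0 (by decide) rfl rfl _) hy)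

lemma exists_lineChart₀_eq (y : Spec (.of k[X])) (hy : (X : k[X]) ∉ y.asIdeal) :
    ∃ y', lineChart₀ k y' = lineChart₁ k y :=
  exists_projPoint_eq _ _ _ _ (bijective_projEval_line _ 0 1 (by decide) rfl rfl _)
    ((projPoint_mem_basicOpen_iff _ _ _ _ _ _).mpr hy)

lemma map_toLaurent_lineChart₀ :
    Spec.map (CommRingCat.ofHom (Polynomial.toLaurent (R := k))) ≫ lineChart₀ k =
      Spec.map (CommRingCat.ofHom ((LaurentPolynomial.invert (R := k)).toRingHom.comp
        Polynomial.toLaurent)) ≫ lineChart₁ k := by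
  refine (map_projPoint _ _ _ _ _).trans (Eq.trans ?_ (map_projPoint _ _ _ _ _).symm)
  refine projPoint_eq (RingHom.ext fun c ↦ ?_) _ _ (isUnit_T (-1)) fun l ↦ ?_
  · simp
  · fin_cases l
    · simp
    · change invert (toLaurent 1) = T (-1) * toLaurent X
      rw [map_one, map_one, toLaurent_X, ← T_add, neg_add_cancel, T_zero]

lemma isProjectiveLine_of_iso {C : Scheme.{u}} [IsIntegral C] (φ : C ≅ ProjSp k 1) :
    IsProjectiveLine (φ.hom ≫ projSpStr k 1) (lineChart₀ k ≫ φ.inv) (lineChart₁ k ≫ φ.inv) where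
  str₀ := by
    rw [Category.assoc, Iso.inv_hom_id_assoc]
    exact projPoint_str _ _ _ _
  str₁ := by
    rw [Category.assoc, Iso.inv_hom_id_assoc]
    exact projPoint_str _ _ _ _
  cover x := by
    have hx : φ.inv (φ.hom x) = x := by simp
    refine (lineChart_cover k (φ.hom x)).imp ?_ ?_ <;>
    · rintro ⟨y, hy⟩
      exact ⟨y, (congrArg φ.inv hy).trans hx⟩
  overlap y hy := by
    obtain ⟨y', h⟩ := exists_lineChart₀_eq k y hy
    exact ⟨y', congrArg φ.inv h⟩
  mul_eq_one := by
    have : IsOpenImmersion (Spec.map (CommRingCat.ofHom (Polynomial.toLaurent (R := k)))) :=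
      IsOpenImmersion.of_isLocalization (S := k[T;T⁻¹]) (X : k[X])
    -- On the common chart with ring `k[t, t⁻¹]` the two coordinates become `t` and `t⁻¹`.
    set o := Spec.map (CommRingCat.ofHom (Polynomial.toLaurent (R := k))) ≫ lineChart₀ k ≫ φ.inv
      with ho
    have h0 := chartToFunctionField_comp (lineChart₀ k ≫ φ.inv) _ o rfl X
    have h1 := chartToFunctionField_comp (lineChart₁ k ≫ φ.inv) _ o (by
      rw [ho, ← Category.assoc, ← Category.assoc, map_toLaurent_lineChart₀]) X
    rw [← h0, ← h1, ← map_mul]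
    convert! map_one (chartToFunctionField o)
    change toLaurent X * invert (toLaurent X) = 1
    rw [toLaurent_X, invert_T, ← T_add, add_neg_cancel, T_zero]

end ProjectiveLine

end

/-! ### Differentials: `C` is not generically all of `Z` -/

noncomputable section

open Opposite TopologicalSpace AlgebraicGeometry.Scheme

section Kaehler

open KaehlerDifferential TensorProduct

/-- A localisation is formally étale, so the differentials of `K` are those of `A` extended to `K`.
-/
lemma finrank_kaehlerDifferential_of_isLocalization {k A K : Type u} [CommRing k] [CommRing A]
    [Field K] [Algebra k A] [Algebra k K] [Algebra A K] [IsScalarTower k A K] (M : Submonoid A)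
    [IsLocalization M K] [Module.Free A Ω[A⁄k]] :
    Module.finrank K Ω[K⁄k] = Module.finrank A Ω[A⁄k] := by
  have : Algebra.FormallyEtale A K := .of_isLocalization M
  have : Nontrivial A := (algebraMap A K).domain_nontrivial
  rw [← (tensorKaehlerEquivOfFormallyEtale k A K).finrank_eq, Module.finrank_baseChange]

lemma finrank_kaehlerDifferential_of_polynomial {k K : Type u} [Field k] [Field K] [Algebra k K]
    (κ : Polynomial k →+* K) (hκ : Function.Injective κ)
    (hk : ∀ a, κ (Polynomial.C a) = algebraMap k K a)
    (hs : ∀ z : K, ∃ s t, t ≠ 0 ∧ z * κ t = κ s) :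
    Module.finrank K Ω[K⁄k] = 1 := by
  let _ : Algebra (Polynomial k) K := κ.toAlgebra
  have : IsScalarTower k (Polynomial k) K := .of_algebraMap_eq fun a ↦ (hk a).symm
  have : FaithfulSMul (Polynomial k) K := (faithfulSMul_iff_algebraMap_injective _ _).mpr hκ
  have : IsFractionRing (Polynomial k) K := IsFractionRing.of_field _ _ fun z ↦ by
    obtain ⟨s, t, ht, e⟩ := hs z
    exact ⟨s, t, (eq_div_iff ((map_ne_zero_iff κ hκ).mpr ht)).mpr e⟩
  have : Module.Free (Polynomial k) Ω[Polynomial k⁄k] :=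
    .of_equiv (KaehlerDifferential.polynomialEquiv k).symm
  rw [finrank_kaehlerDifferential_of_isLocalization (A := Polynomial k)
    (nonZeroDivisors (Polynomial k)), (KaehlerDifferential.polynomialEquiv k).finrank_eq,
    Module.finrank_self]

lemma finrank_kaehlerDifferential_of_isStandardSmooth {k A K : Type u} [CommRing k] [CommRing A]
    [Field K] [Algebra k A] [Algebra k K] [Algebra A K] [IsScalarTower k A K] (M : Submonoid A)
    [IsLocalization M K] (n : ℕ) [Algebra.IsStandardSmoothOfRelativeDimension n k A] :
    Module.finrank K Ω[K⁄k] = n := by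
  have : Algebra.IsStandardSmooth k A :=
    Algebra.IsStandardSmoothOfRelativeDimension.isStandardSmooth n
  have : Nontrivial A := (algebraMap A K).domain_nontrivial
  rw [finrank_kaehlerDifferential_of_isLocalization M]
  exact Module.finrank_eq_of_rank_eq
    (Algebra.IsStandardSmoothOfRelativeDimension.rank_kaehlerDifferential n)

end Kaehler

section

variable {k : Type u} [Field k] {Z : Scheme.{u}}

lemma exists_isStandardSmooth (p : Z ⟶ Spec (.of k)) (n : ℕ) [SmoothOfRelativeDimension n p] (z : Z) :
    ∃ (V : Z.Opens) (_ : IsAffineOpen V) (_ : z ∈ V),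
      ((Z.presheaf.map (homOfLE le_top).op).hom.comp (ringHomOfHom p) :
        k →+* Γ(Z, V)).IsStandardSmoothOfRelativeDimension n := by
  obtain ⟨U, hU, V, hV, hz, e, h⟩ :=
    SmoothOfRelativeDimension.exists_isStandardSmoothOfRelativeDimension (n := n) (f := p) z
  have hU' : U = ⊤ := by
    refine top_le_iff.mp fun y _ ↦ ?_
    have : Subsingleton (Spec (.of k)) := inferInstanceAs (Subsingleton (PrimeSpectrum k))
    exact Subsingleton.elim (p z) y ▸ e hz
  subst hU'
  refine ⟨V, hV, hz, ?_⟩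
  have h2 := h.comp (RingHom.IsStandardSmoothOfRelativeDimension.equiv
    (ΓSpecIso (.of k)).symm.commRingCatIsoToRingEquiv)
  rw [Nat.add_zero] at h2
  convert! h2 using 1

/-- Otherwise the function field of `C` would be a localisation of a smooth algebra of relative
dimension two, with differentials of rank two; as the field of fractions of `k[X]` it has
differentials of rank one. -/
theorem not_bijective_stalkMap_of_isProjectiveLine {C : Scheme.{u}} [IsIntegral C]
    (p : Z ⟶ Spec (.of k)) [SmoothOfRelativeDimension 2 p] (i : C ⟶ Z)
    {c₀ c₁ : Spec (.of (Polynomial k)) ⟶ C} [IsOpenImmersion c₀] [IsOpenImmersion c₁]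
    (h : IsProjectiveLine (i ≫ p) c₀ c₁) :
    ¬ Function.Bijective (i.stalkMap (genericPoint C)).hom := by
  intro hb
  obtain ⟨V, hV, hz, hs⟩ := exists_isStandardSmooth p 2 (i (genericPoint C))
  let K : Type u := C.functionField
  let A : Type u := Γ(Z, V)
  let α : k →+* A := (Z.presheaf.map (homOfLE le_top).op).hom.comp (ringHomOfHom p)
  let γ : A →+* Z.presheaf.stalk (i (genericPoint C)) := (Z.presheaf.germ V _ hz).hom
  let σ : Z.presheaf.stalk (i (genericPoint C)) →+* K := (i.stalkMap (genericPoint C)).hom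
  let _ : Algebra k A := α.toAlgebra
  let _ : Algebra A (Z.presheaf.stalk (i (genericPoint C))) := γ.toAlgebra
  let _ : Algebra A K := (σ.comp γ).toAlgebra
  let _ : Algebra k K := ((σ.comp γ).comp α).toAlgebra
  have : IsScalarTower k A K := .of_algebraMap_eq fun _ ↦ rfl
  have hloc : IsLocalization.AtPrime (Z.presheaf.stalk (i (genericPoint C)))
      (hV.primeIdealOf ⟨i (genericPoint C), hz⟩).asIdeal := hV.isLocalization_stalk ⟨_, hz⟩
  let e : Z.presheaf.stalk (i (genericPoint C)) ≃ₐ[A] K :=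
    AlgEquiv.ofBijective ⟨σ, fun _ ↦ rfl⟩ hb
  have : IsLocalization (hV.primeIdealOf ⟨i (genericPoint C), hz⟩).asIdeal.primeCompl K :=
    IsLocalization.isLocalization_of_algEquiv _ e
  have : Algebra.IsStandardSmoothOfRelativeDimension 2 k A := hs
  have h2 := finrank_kaehlerDifferential_of_isStandardSmooth (k := k) (A := A) (K := K)
    (hV.primeIdealOf ⟨i (genericPoint C), hz⟩).asIdeal.primeCompl 2
  have h1 := finrank_kaehlerDifferential_of_polynomial (k := k) (K := K)
    (chartToFunctionField c₀) (chartToFunctionField_injective c₀) (fun a ↦ ?_)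
    (exists_mul_eq_chart c₀)
  · omega
  · refine (chartToFunctionField_of_comp_eq c₀ _ _ h.str₀ a).trans ?_
    rw [ringHomOfHom_comp]
    refine (Scheme.Hom.germ_stalkMap_apply i ⊤ (genericPoint C) (Opens.mem_top _)
      (ringHomOfHom p a)).symm.trans ?_
    exact congrArg σ (Z.presheaf.germ_res_apply (homOfLE le_top) _ hz (ringHomOfHom p a)).symm

end

end

/-! ### Global functions on the line and on its thickening -/

noncomputable section

open Opposite TopologicalSpace AlgebraicGeometry.Scheme

section

variable {k : Type u} [Field k] {C D : Scheme.{u}} [IsIntegral C]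

instance : Nonempty (⊤ : C.Opens) := ⟨⟨genericPoint C, trivial⟩⟩

lemma appTop_eq_ringHomOfHom (s : D ⟶ Spec (.of k)) (a : Γ(Spec (.of k), ⊤)) :
    s.appTop.hom a = ringHomOfHom s ((ΓSpecIso (.of k)).hom.hom a) := by
  change _ = s.appTop.hom (((ΓSpecIso (.of k)).hom ≫ (ΓSpecIso (.of k)).inv).hom a)
  rw [Iso.hom_inv_id]
  rfl

/-- The global functions on a projective line are constant. -/
lemma IsProjectiveLine.exists_eq_ringHomOfHom [IsAlgClosed k] [IsLocallyNoetherian C]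
    {s : C ⟶ Spec (.of k)} {c₀ c₁ : Spec (.of (Polynomial k)) ⟶ C} [IsOpenImmersion c₀]
    [IsOpenImmersion c₁] (H : IsProjectiveLine s c₀ c₁) (v : Γ(C, ⊤)) :
    ∃ a, v = ringHomOfHom s a := by
  have hord (x : C) : Scheme.ord (1 : C.functionField) x = 0 := by
    simpa using IsProjectiveLine.ord_zpow (x := x) (one_ne_zero (α := C.functionField)) 0
  -- For the trivial divisor the degree bound is `0`, so `v * W` and `1 * W` are constants, and `v`
  -- is their quotient.
  obtain ⟨W, hW0, hW⟩ := H.exists_twist (fun _ ↦ 1) (fun _ ↦ one_ne_zero)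
    (by simp [hord]) 0 (by simp [hord])
  set κ := chartToFunctionField c₀
  have key (v : Γ(C, ⊤)) : ∃ a, (C.presheaf.germ ⊤ (genericPoint C) (Opens.mem_top _)).hom v * W =
      κ (Polynomial.C a) := by
    obtain ⟨p, hp, e⟩ := (hW ((C.presheaf.germ ⊤ (genericPoint C) (Opens.mem_top _)).hom v)).mp
      fun x ↦ ⟨(C.presheaf.germ ⊤ x (Opens.mem_top _)).hom v, by
        rw [mul_one]
        exact Scheme.algebraMap_germ_eq_germToFunctionField C (Opens.mem_top x) v⟩
    refine ⟨p.coeff 0, ?_⟩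
    rw [← Polynomial.eq_C_of_natDegree_le_zero hp]
    exact e
  obtain ⟨b, hb⟩ := key 1
  rw [map_one, one_mul] at hb
  obtain ⟨a, ha⟩ := key v
  have hb0 : b ≠ 0 := by
    rintro rfl
    rw [map_zero, map_zero] at hb
    exact hW0 hb
  refine ⟨a / b, Scheme.germToFunctionField_injective C ⊤ (mul_right_cancel₀ hW0 ?_)⟩
  refine ha.trans ?_
  have h1 := chartToFunctionField_of_comp_eq c₀ s _ H.str₀ (a / b)
  refine Eq.trans ?_ congr($h1 * W)
  rw [hb, ← map_mul, ← map_mul, div_mul_cancel₀ _ hb0]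

/-- `Γ(D)` is an extension of the constants `Γ(C) = k`, split by the structure morphism, by the
sections of the ideal of `C`. These are the `b * f` for which `b|_C * W` is a polynomial of degree
at most `d`, so the `ε_l` are taken with `b|_C = X ^ l / W` for `l ≤ d`. -/
theorem IsInvertibleThickening.exists_isDualBasis [IsAlgClosed k] [IsLocallyNoetherian C]
    {c : C ⟶ D} {f : D.presheaf.stalk (c (genericPoint C))} {g : ∀ x : C, D.presheaf.stalk (c x)}
    {w : C → D.presheaf.stalk (c (genericPoint C))} (h : IsInvertibleThickening c f g w)
    {s : D ⟶ Spec (.of k)} {c₀ c₁ : Spec (.of (Polynomial k)) ⟶ C} [IsOpenImmersion c₀]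
    [IsOpenImmersion c₁] (H : IsProjectiveLine (c ≫ s) c₀ c₁) (m : C → C.functionField)
    (hm : ∀ x, (c.stalkMap (genericPoint C)).hom (w x) = m x) (hm0 : ∀ x, m x ≠ 0)
    (hfin : (fun x ↦ Scheme.ord (m x) x).support.Finite) (d : ℕ)
    (hsum : ∑ᶠ x, Scheme.ord (m x) x = d) :
    ∃ ε : Fin (d + 1) → Γ(D, ⊤), IsDualBasis s ε := by
  obtain ⟨W, hW0, hW⟩ := H.exists_twist m hm0 hfin d hsum
  set κ := chartToFunctionField c₀
  let σ : D.presheaf.stalk (c (genericPoint C)) →+* C.functionField :=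
    (c.stalkMap (genericPoint C)).hom
  let γ : Γ(D, ⊤) →+* D.presheaf.stalk (c (genericPoint C)) :=
    (D.presheaf.germ ⊤ _ (Opens.mem_top _)).hom
  let c' : Γ(D, ⊤) →+* Γ(C, ⊤) := (c.app ⊤).hom
  let τ : Γ(Spec (.of k), ⊤) ≃+* k := (ΓSpecIso (.of k)).commRingCatIsoToRingEquiv
  have hs (a) : s.appTop.hom a = ringHomOfHom s (τ a) := appTop_eq_ringHomOfHom s a
  have hκ : Function.Injective κ := chartToFunctionField_injective c₀
  have hσγ (v : Γ(D, ⊤)) : σ (γ v) = C.germToFunctionField ⊤ (c' v) :=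
    Scheme.Hom.germ_stalkMap_apply c ⊤ (genericPoint C) (Opens.mem_top _) v
  have hc (a : k) : c' (ringHomOfHom s a) = ringHomOfHom (c ≫ s) a :=
    congr($(ringHomOfHom_comp c s) a).symm
  have hκC (a : k) : σ (γ (ringHomOfHom s a)) = κ (Polynomial.C a) := by
    rw [hσγ, hc]
    exact (chartToFunctionField_of_comp_eq c₀ _ _ H.str₀ a).symm
  have hσ : Function.Surjective σ := h.stalkMap_surjective _
  choose B hB using fun l : Fin (d + 1) ↦ hσ (κ (Polynomial.X ^ (l : ℕ)) / W)
  choose ε hε hεf using fun l ↦ h.exists_section (B l) fun x ↦ by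
    have h1 := (hW (κ (Polynomial.X ^ (l : ℕ)) / W)).mpr ⟨Polynomial.X ^ (l : ℕ), by
      rw [Polynomial.natDegree_X_pow]
      omega, div_mul_cancel₀ _ hW0⟩ x
    rw [hm]
    refine h1.imp fun a ha ↦ ha.trans ?_
    exact congr($((hB l).symm) * m x)
  have hsumσ (x : Fin (d + 1) → k) : σ (∑ l, γ (ringHomOfHom s (x l)) * B l) =
      κ (∑ l, Polynomial.C (x l) * Polynomial.X ^ (l : ℕ)) / W := by
    simp_rw [map_sum, map_mul, hκC, hB, Finset.sum_div, mul_div_assoc]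
  have hγ (x : Fin (d + 1) → k) : γ (∑ l, ringHomOfHom s (x l) * ε l) =
      (∑ l, γ (ringHomOfHom s (x l)) * B l) * f := by
    rw [map_sum, Finset.sum_mul]
    exact Finset.sum_congr rfl fun l _ ↦ by
      rw [map_mul, mul_assoc]
      exact congr(_ * $(hεf l))
  have hc'0 (x : Fin (d + 1) → k) : c' (∑ l, ringHomOfHom s (x l) * ε l) = 0 := by
    rw [map_sum]
    refine Finset.sum_eq_zero fun l _ ↦ ?_
    rw [map_mul]
    exact congr(_ * $(hε l)).trans (mul_zero _)
  refine ⟨ε, fun l l' ↦ h.mul_eq_zero (hε l) (hε l'), ?_, ?_⟩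
  · refine (injective_iff_map_eq_zero _).mpr fun x hx ↦ ?_
    rw [dualHom_apply, hs] at hx
    simp_rw [hs] at hx
    have h1 : τ x.fst = 0 := by
      have := congr(σ (γ $hx))
      rw [map_add, map_add, hκC, hσγ (∑ l, _), hc'0, map_zero, add_zero, map_zero, map_zero,
        map_eq_zero_iff κ hκ, Polynomial.C_eq_zero] at this
      exact this
    rw [h1, map_zero, zero_add] at hx
    have h2 := congr(γ $hx)
    rw [hγ, map_zero] at h2
    -- A coefficient of `f` counts only modulo the ideal of `C`, that is, through its value in the
    -- function field of `C`.
    have h3 : σ (∑ l, γ (ringHomOfHom s (τ (x.snd l))) * B l) = 0 := (h.mul_gen_eq_zero_iff _).mp h2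
    rw [hsumσ, div_eq_zero_iff, or_iff_left hW0, map_eq_zero_iff κ hκ] at h3
    refine DualRing.ext_iff'.mpr ⟨(map_eq_zero_iff τ τ.injective).mp h1, fun l ↦
      (map_eq_zero_iff τ τ.injective).mp ?_⟩
    have h4 := congr(Polynomial.coeff $h3 l)
    simpa [Polynomial.finsetSum_coeff, Polynomial.coeff_C_mul, Polynomial.coeff_X_pow,
      Fin.val_inj] using h4
  · intro v
    obtain ⟨a, ha⟩ := H.exists_eq_ringHomOfHom (c' v)
    have h0 : c' (v - ringHomOfHom s a) = 0 := by rw [map_sub, hc, ha, sub_self]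
    obtain ⟨b, hb, hb'⟩ := h.exists_coeff _ h0
    obtain ⟨q, hq, e⟩ := (hW (σ b)).mp fun x ↦ (hb' x).imp fun a ha ↦ ha.trans (by rw [hm])
    -- Both sides vanish on `C`, so it is enough to compare generic germs, where the coefficients of
    -- `f` have the same restriction `q / W` to `C`.
    have hv : v - ringHomOfHom s a = ∑ l : Fin (d + 1), ringHomOfHom s (q.coeff l) * ε l := by
      refine h.eq_of_germ_eq h0 (hc'0 _) trivial ?_
      refine hb.trans (Eq.trans ?_ (hγ _).symm)
      rw [← sub_eq_zero, ← sub_mul, h.mul_gen_eq_zero_iff]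
      change σ _ = 0
      rw [map_sub, hsumσ, eq_div_of_mul_eq hW0 e, sub_eq_zero]
      congr 2
      rw [Fin.sum_univ_eq_sum_range (fun l ↦ Polynomial.C (q.coeff l) * Polynomial.X ^ l)]
      exact q.as_sum_range_C_mul_X_pow' (by omega)
    refine ⟨(τ.symm a, fun l ↦ τ.symm (q.coeff l)), ?_⟩
    change s.appTop.hom (τ.symm a) + ∑ l : Fin (d + 1), s.appTop.hom (τ.symm (q.coeff l)) * ε l = v
    simp_rw [hs, RingEquiv.apply_symm_apply]
    rw [← hv]
    ring

end

end

/-! ### The double curve on the surface -/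

noncomputable section

open Opposite TopologicalSpace AlgebraicGeometry.Scheme

attribute [local instance] MvPolynomial.gradedAlgebra

section

variable {k : Type u} [Field k] {C D Z : Scheme.{u}}

/-- The degree zero part of `k[x₀, …, xₙ]` is `k`, so `Proj` is proper over `k`. This supplies the
quasi-compactness and quasi-separatedness of `2C` used in base change. -/
instance projSpStr_isProper (n : ℕ) : IsProper (projSpStr k n) := by
  let 𝒜 := MvPolynomial.homogeneousSubmodule (Fin (n + 1)) k
  have : IsScalarTower k (𝒜 0) (ProjPoly k n) :=
    IsScalarTower.of_algebraMap_eq (R := k) (S := 𝒜 0) (A := ProjPoly k n) fun _ ↦ rfl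
  have : Algebra.FiniteType (𝒜 0) (ProjPoly k n) := .of_restrictScalars_finiteType k _ _
  have : IsIso (CommRingCat.ofHom (algebraMap k (𝒜 0))) := by
    refine (ConcreteCategory.isIso_iff_bijective _).mpr
      ⟨fun _ _ h ↦ MvPolynomial.C_injective (Fin (n + 1)) k (congrArg Subtype.val h), fun ⟨F, hF⟩ ↦ ⟨MvPolynomial.coeff 0 F, Subtype.ext ?_⟩⟩
    exact (MvPolynomial.totalDegree_eq_zero_iff_eq_C.mp (Nat.le_zero.mp hF.totalDegree_le)).symm
  exact inferInstanceAs (IsProper (Proj.toSpecZero 𝒜 ≫ Spec.map (CommRingCat.ofHom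
    (algebraMap k (𝒜 0)))))

theorem exists_isDualBasis [IsAlgClosed k] [IsIntegral C] [IsLocallyNoetherian C] [IsIntegral Z]
    (c : C ⟶ D) (j : D ⟶ Z) [IsClosedImmersion c] [IsClosedImmersion j]
    (h : (c ≫ j).ker ^ 2 = j.ker) (p : Z ⟶ Spec (.of k)) [SmoothOfRelativeDimension 2 p]
    {c₀ c₁ : Spec (.of (Polynomial k)) ⟶ C} [IsOpenImmersion c₀] [IsOpenImmersion c₁]
    (H : IsProjectiveLine ((c ≫ j) ≫ p) c₀ c₁) (d : ℕ)
    (hd : HasSelfIntersection (c ≫ j) (-(d : ℤ))) :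
    ∃ ε : Fin (d + 1) → Γ(D, ⊤), IsDualBasis (j ≫ p) ε := by
  obtain ⟨f, m, hf, hx, hfin, hsum⟩ := hd
  choose g w hg hw hm using hx
  -- For `f = 0` the local ring of `Z` at the generic point of `C` would be the function field of
  -- `C`, which contradicts the dimension of `Z`.
  have hf0 : f ≠ 0 := by
    rintro rfl
    refine not_bijective_stalkMap_of_isProjectiveLine p (c ≫ j) H
      ⟨(RingHom.injective_iff_ker_eq_bot _).mpr ?_, (c ≫ j).stalkMap_surjective _⟩
    rw [hf]
    exact Ideal.span_singleton_eq_bot.mpr rfl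
  have hker (a) : ((c ≫ j).stalkMap (genericPoint C)).hom a = 0 ↔ f ∣ a := by
    rw [← RingHom.mem_ker, hf, Ideal.mem_span_singleton]
  -- Generically `g x` is a multiple of `f`. If `w x` were one too, `f = w x * g x` would be
  -- divisible by `f²`, so the nonzero nonunit `f` would divide `1`.
  have hw0 (x) : ((c ≫ j).stalkMap (genericPoint C)).hom (w x) ≠ 0 := by
    intro h0
    obtain ⟨a, ha⟩ := (hker _).mp h0
    have h1 : ((c ≫ j).stalkMap (genericPoint C)).hom ((Z.presheaf.stalkSpecializes
        (((genericPoint_spec C).specializes (Set.mem_univ x)).map (c ≫ j).continuous)).hom (g x)) =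
          0 := by
      refine (Scheme.Hom.stalkSpecializes_stalkMap_apply (c ≫ j) _ _ (genericPoint_specializes x)
        (g x)).trans ?_
      have : ((c ≫ j).stalkMap x).hom (g x) = 0 := by
        rw [← RingHom.mem_ker, hg]
        exact Ideal.mem_span_singleton_self _
      exact (congrArg _ this).trans (map_zero _)
    obtain ⟨b, hb⟩ := (hker _).mp h1
    have h2 : f * 1 = f * (a * (f * b)) := by
      rw [← mul_assoc, ← ha, ← hb, mul_one]
      exact hw x
    have h3 := congr(((c ≫ j).stalkMap (genericPoint C)).hom $(mul_left_cancel₀ hf0 h2))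
    rw [map_one, (hker _).mpr ⟨a * b, by ring⟩] at h3
    exact one_ne_zero h3
  have hcomp (x : C) : (c ≫ j).stalkMap x = j.stalkMap (c x) ≫ c.stalkMap x :=
    Scheme.Hom.stalkMap_comp c j x
  have hth := isInvertibleThickening_of_ker_eq_sq c j h f hf0 (by rw [← hcomp]; exact hf) g
    (fun x ↦ by rw [← hcomp]; exact hg x) w hw
  rw [Category.assoc] at H
  refine hth.exists_isDualBasis H (fun x ↦ ((c ≫ j).stalkMap (genericPoint C)).hom (w x))
    (fun x ↦ congr($(hcomp (genericPoint C)).hom (w x)).symm) hw0 ?_ d ?_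
  · rwa [← funext hm]
  · simp_rw [← hm, hsum, neg_neg]

theorem parametrises_doubleCurve [IsAlgClosed k] [IsIntegral C] [IsLocallyNoetherian C]
    (p : Z ⟶ Spec (.of k)) (hZ : IsSmoothProjectiveSurface p) (i : C ⟶ Z) [IsClosedImmersion i]
    (φ : C ≅ ProjSp k 1) (hφ : φ.hom ≫ projSpStr k 1 = i ≫ p) (d : ℕ)
    (hd : HasSelfIntersection i (-(d : ℤ))) :
    Parametrises (doubleCurveι i) p (totalSpaceStr k (-2) (d + 1)) := by
  have := hZ.isIntegral
  have := hZ.smooth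
  obtain ⟨n, ι, hι, rfl⟩ := hZ.projective
  have hj : IsClosedImmersion (doubleCurveι i) :=
    inferInstanceAs (IsClosedImmersion (i.ker ^ 2).subschemeι)
  have hker : (doubleCurveι i).ker = i.ker ^ 2 := IdealSheafData.ker_subschemeι _
  -- `C` lies in `2C` because `I² ≤ I`.
  let c := IsClosedImmersion.lift (doubleCurveι i) i (hker.trans_le fun _ ↦ Ideal.pow_le_self two_ne_zero)
  have hc : c ≫ doubleCurveι i = i := IsClosedImmersion.lift_fac _ _ _
  have : IsClosedImmersion (c ≫ doubleCurveι i) := by rwa [hc]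
  have : IsClosedImmersion c := .of_comp_isClosedImmersion c (doubleCurveι i)
  have H := isProjectiveLine_of_iso k φ
  rw [hφ, ← hc] at H
  obtain ⟨ε, hε⟩ := exists_isDualBasis c (doubleCurveι i) (by rw [hc, hker]) (ι ≫ projSpStr k n) H d
    (by rwa [hc])
  have : Surjective (doubleCurveι i ≫ ι ≫ projSpStr k n) := by
    refine ⟨fun y ↦ ⟨c (genericPoint C), ?_⟩⟩
    have : Subsingleton (Spec (.of k)) := inferInstanceAs (Subsingleton (PrimeSpectrum k))
    exact Subsingleton.elim _ _
  exact parametrises_totalSpace _ _ hε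

end

end

/-! ### Reduced closed subschemes and evaluation of homogeneous equations -/

noncomputable section

open Opposite TopologicalSpace AlgebraicGeometry.Scheme

attribute [local instance] MvPolynomial.gradedAlgebra

section Reduced

variable {X Y : Scheme.{u}}

instance isReduced_subscheme_vanishingIdeal (Z : Closeds X) :
    IsReduced (IdealSheafData.vanishingIdeal Z).subscheme := by
  have (U : X.affineOpens) :
      _root_.IsReduced (Γ(X, U) ⧸ (IdealSheafData.vanishingIdeal Z).ideal U) := by
    rw [← Ideal.isRadical_iff_quotient_reduced, IdealSheafData.vanishingIdeal_ideal]
    exact PrimeSpectrum.isRadical_vanishingIdeal _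
  have h (U : X.affineOpens) :
      IsReduced (Spec (.of (Γ(X, U) ⧸ (IdealSheafData.vanishingIdeal Z).ideal U))) := inferInstance
  have (U : (IdealSheafData.vanishingIdeal Z).subschemeCover.openCover.I₀) :
      IsReduced ((IdealSheafData.vanishingIdeal Z).subschemeCover.openCover.X U) := h U
  exact IsReduced.of_openCover _ (IdealSheafData.vanishingIdeal Z).subschemeCover.openCover

/-- The support of the kernel is the closure of the image, and the kernel is radical because `X` is
reduced. -/
lemma vanishingIdeal_le_ker [IsReduced X] (f : X ⟶ Y) [QuasiCompact f] (Z : Closeds Y)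
    (h : ∀ x, f x ∈ Z) : IdealSheafData.vanishingIdeal Z ≤ f.ker := by
  have h1 : f.ker.support ≤ Z := by
    change (f.ker.support : Set Y) ⊆ Z
    rw [Scheme.Hom.support_ker]
    exact closure_minimal (Set.range_subset_iff.mpr h) Z.isClosed
  refine (IdealSheafData.vanishingIdeal_antimono h1).trans ?_
  rw [IdealSheafData.vanishingIdeal_support]
  intro U a ha
  obtain ⟨n, hn⟩ := ha
  rw [Scheme.Hom.ker_apply] at hn ⊢
  rw [RingHom.mem_ker, map_pow] at hn
  exact IsNilpotent.eq_zero ⟨n, hn⟩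

end Reduced

section ToSpec

variable {U : Scheme.{u}} {R : Type u} [CommRing R]

lemma mem_basicOpen_ringHomOfHom (l : U ⟶ Spec (.of R)) (a : R) (x : U) :
    x ∈ U.basicOpen (ringHomOfHom l a) ↔ a ∉ (l x).asIdeal := by
  have h := Scheme.preimage_basicOpen_top l ((ΓSpecIso (.of R)).inv.hom a)
  have h2 : x ∈ U.basicOpen (ringHomOfHom l a) ↔ x ∈ l ⁻¹ᵁ
    (Spec (.of R)).basicOpen ((ΓSpecIso (.of R)).inv.hom a) := by
    rw [h]
    rfl
  rw [h2, basicOpen_eq_of_affine']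
  simp
  exact Iff.rfl

end ToSpec

section ProjectiveSpace

open MvPolynomial HomogeneousLocalization

variable {k : Type u} [Field k] {n : ℕ} {R : Type u} [CommRing R] (ρ : k →+* R)
  (a : Fin (n + 1) → R)

lemma pow_mul_projEval_mk {j : Fin (n + 1)} (h : IsUnit (eval₂Hom ρ a (X j))) {F : ProjPoly k n}
    {m : ℕ} (hF : F ∈ homogeneousSubmodule (Fin (n + 1)) k (m • 1)) :
    a j ^ m * projEval ρ a h (Away.mk _ (X_mem_homogeneousSubmodule j) m F hF) = eval₂ ρ a F := by
  have hF' : F.IsHomogeneous m := by simpa using hF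
  rw [eval₂_projCoord, hom_eval₂, ← eval₂_mul_of_isHomogeneous _ _ _ hF']
  exact eval₂_congr_of_eq (RingHom.ext fun c ↦ projEval_C ρ a h c) (projEval_coord ρ a h) F

lemma projChart_mem_basicOpen_iff (j : Fin (n + 1)) {F : ProjPoly k n} {m : ℕ} (hm : 0 < m)
    (hF : F.IsHomogeneous m) (y : Spec (.of (ProjAway (X j : ProjPoly k n)))) :
    projChart k j y ∈ Proj.basicOpen (homogeneousSubmodule (Fin (n + 1)) k) F ↔
      eval₂ (projAwayC _) (projCoord j) F ∉ y.asIdeal := by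
  have h1 := Proj.awayι_preimage_basicOpen _ (X_mem_homogeneousSubmodule (k := k) j) one_pos
    (show F ∈ homogeneousSubmodule (Fin (n + 1)) k m from hF) hm
  have h2 : Away.isLocalizationElem (X_mem_homogeneousSubmodule (k := k) j)
      (show F ∈ homogeneousSubmodule (Fin (n + 1)) k m from hF) =
      eval₂ (projAwayC _) (projCoord j) F := by
    rw [← eval₂_projCoord j (by simpa using hF)]
    apply HomogeneousLocalization.val_injective
    simp [Away.isLocalizationElem]
  rw [h2] at h1
  exact Iff.of_eq congr(y ∈ $h1)

end ProjectiveSpace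

end

/-! ### Recognising affine charts of the quadric -/

noncomputable section

open Opposite TopologicalSpace AlgebraicGeometry.Scheme

attribute [local instance] MvPolynomial.gradedAlgebra

section Quadric

open MvPolynomial HomogeneousLocalization

/-- The inclusion of the quadric in projective space. -/
def quadricι (k : Type u) [Field k] (d : ℕ) : quadric k d ⟶ ProjSp k (d + 3) :=
  (IdealSheafData.vanishingIdeal (quadricSet k d)).subschemeι

variable {k : Type u} [Field k] {d : ℕ}

instance : IsClosedImmersion (quadricι k d) :=
  inferInstanceAs (IsClosedImmersion (IdealSheafData.subschemeι _))

instance : IsReduced (quadric k d) :=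
  isReduced_subscheme_vanishingIdeal (quadricSet k d)

lemma quadricι_str : quadricι k d ≫ projSpStr k (d + 3) = quadricStr k d := rfl

lemma isHomogeneous_quadricPoly : (quadricPoly k d).IsHomogeneous 2 :=
  ((isHomogeneous_X k _).mul (isHomogeneous_X k _)).add (isHomogeneous_X_pow _ _)

lemma eval₂_quadricPoly {R : Type*} [CommRing R] (ρ : k →+* R) (a : Fin (d + 3 + 1) → R) :
    eval₂ ρ a (quadricPoly k d) = a 0 * a 2 + a 1 ^ 2 := by
  simp [quadricPoly]

lemma mem_quadricSet_iff (x : ProjSp k (d + 3)) : x ∈ quadricSet k d ↔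
    x ∉ Proj.basicOpen (homogeneousSubmodule (Fin (d + 3 + 1)) k) (quadricPoly k d) := by
  have h : x ∈ quadricSet k d ↔ quadricPoly k d ∈ x.asHomogeneousIdeal := Set.singleton_subset_iff
  exact h.trans not_not.symm

lemma range_quadricι : Set.range (quadricι k d) = quadricSet k d := by
  refine (IdealSheafData.range_subschemeι _).trans ?_
  rfl

/-- For a reduced source it suffices to test on points, without generators of the ideal of the
quadric. -/
lemma exists_comp_quadricι {U : Scheme.{u}} [IsReduced U] (g : U ⟶ ProjSp k (d + 3))
    [QuasiCompact g] (h : ∀ x, g x ∈ quadricSet k d) : ∃ f : U ⟶ quadric k d, f ≫ quadricι k d = g :=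
  ⟨IsClosedImmersion.lift (quadricι k d) g
    ((IdealSheafData.ker_subschemeι _).trans_le (vanishingIdeal_le_ker g _ h)),
    IsClosedImmersion.lift_fac _ _ _⟩

lemma projChart_mem_quadricSet_iff (j : Fin (d + 3 + 1))
    (y : Spec (.of (ProjAway (X j : ProjPoly k (d + 3))))) :
    projChart k j y ∈ quadricSet k d ↔
      projCoord j 0 * projCoord j 2 + projCoord j 1 ^ 2 ∈ y.asIdeal := by
  rw [mem_quadricSet_iff, projChart_mem_basicOpen_iff j two_pos isHomogeneous_quadricPoly,
    eval₂_quadricPoly, not_not]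

/-- The equation of the quadric holds for the coordinates of a reduced scheme mapping to it. -/
lemma ringHomOfHom_quadric_eq_zero {U : Scheme.{u}} [IsReduced U] {j : Fin (d + 3 + 1)}
    (l : U ⟶ Spec (.of (ProjAway (X j : ProjPoly k (d + 3)))))
    (h : ∀ x, (l ≫ projChart k j) x ∈ quadricSet k d) :
    ringHomOfHom l (projCoord j 0 * projCoord j 2 + projCoord j 1 ^ 2) = 0 := by
  rw [← basicOpen_eq_bot_iff]
  refine le_bot_iff.mp fun x hx ↦ ?_
  exact (mem_basicOpen_ringHomOfHom l _ x).mp hx ((projChart_mem_quadricSet_iff j (l x)).mp (h x))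

instance quasiCompact_projPoint {n : ℕ} {R : Type u} [CommRing R] (ρ : k →+* R)
    (a : Fin (n + 1) → R) (j : Fin (n + 1)) (h : IsUnit (a j)) : QuasiCompact (projPoint ρ a j h) := by
  have : IsSeparated (Proj.toSpecZero (homogeneousSubmodule (Fin (n + 1)) k)) := inferInstance
  have : (Proj (homogeneousSubmodule (Fin (n + 1)) k)).IsSeparated := inferInstance
  have : (ProjSp k n).IsSeparated := this
  infer_instance

/-- `hsurj` and `hlift` make `R` the coordinate ring of `{x_j ≠ 0}` modulo the equation. `Spec R`
maps to the quadric since `R` is reduced; conversely the open part of the quadric is reduced, so the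
equation holds on it and `hlift` gives a map back to `Spec R`. Both are monomorphisms over
projective space, hence inverse to each other. -/
theorem exists_quadricChart {R : Type u} [CommRing R] [_root_.IsReduced R] (ρ : k →+* R)
    (a : Fin (d + 3 + 1) → R) (j : Fin (d + 3 + 1)) (hj : IsUnit (a j))
    (hj' : IsUnit (eval₂Hom ρ a (X j)))
    (hq : a 0 * a 2 + a 1 ^ 2 = 0) (hsurj : Function.Surjective (projEval ρ a hj'))
    (hlift : ∀ {A : Type u} [CommRing A] (φ : ProjAway (X j : ProjPoly k (d + 3)) →+* A),
      φ (projCoord j 0 * projCoord j 2 + projCoord j 1 ^ 2) = 0 →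
        ∃ τ : R →+* A, τ.comp (projEval ρ a hj') = φ) :
    ∃ f : Spec (.of R) ⟶ quadric k d, f ≫ quadricι k d = projPoint ρ a j hj ∧ IsOpenImmersion f ∧
      ∀ x, (∃ y, f y = x) ↔
        quadricι k d x ∈ Proj.basicOpen (homogeneousSubmodule (Fin (d + 3 + 1)) k) (X j) := by
  have hproj : projPoint ρ a j hj = Spec.map (CommRingCat.ofHom (projEval ρ a hj')) ≫ projChart k j :=
    rfl
  have hev : projEval ρ a hj' (projCoord j 0 * projCoord j 2 + projCoord j 1 ^ 2) = 0 := by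
    have := pow_mul_projEval_mk ρ a hj' (F := quadricPoly k d) (m := 2)
      (by simpa using isHomogeneous_quadricPoly)
    rw [eval₂_projCoord, eval₂_quadricPoly, eval₂_quadricPoly, hq] at this
    exact (hj.pow 2).mul_right_eq_zero.mp this
  obtain ⟨f, hf⟩ := exists_comp_quadricι (projPoint ρ a j hj) fun y ↦ by
    rw [hproj]
    refine (projChart_mem_quadricSet_iff j _).mpr ?_
    change projEval ρ a hj' _ ∈ y.asIdeal
    rw [hev]
    exact zero_mem _
  have : IsClosedImmersion (Spec.map (CommRingCat.ofHom (projEval ρ a hj'))) :=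
    IsClosedImmersion.spec_of_surjective _ hsurj
  have hmono : Mono (f ≫ quadricι k d) := by
    rw [hf, hproj]
    infer_instance
  have hmono' : Mono f := mono_of_mono f (quadricι k d)
  let U : (quadric k d).Opens :=
    quadricι k d ⁻¹ᵁ Proj.basicOpen (homogeneousSubmodule (Fin (d + 3 + 1)) k) (X j)
  have hU : Set.range (U.ι ≫ quadricι k d) ⊆ Set.range (projChart k j) := by
    rintro _ ⟨x, rfl⟩
    change _ ∈ (projChart k j).opensRange
    rw [opensRange_projChart]
    exact x.2
  let l : U.toScheme ⟶ Spec (.of (ProjAway (X j : ProjPoly k (d + 3)))) :=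
    IsOpenImmersion.lift (projChart k j) (U.ι ≫ quadricι k d) hU
  have hl : l ≫ projChart k j = U.ι ≫ quadricι k d := IsOpenImmersion.lift_fac _ _ _
  obtain ⟨τ, hτ⟩ := hlift (ringHomOfHom l) (ringHomOfHom_quadric_eq_zero l fun x ↦ by
    rw [hl]
    exact range_quadricι.le ⟨U.ι x, rfl⟩)
  let r : U.toScheme ⟶ Spec (.of R) := homOfRingHom τ
  have hr : r ≫ f = U.ι := by
    rw [← cancel_mono (quadricι k d), Category.assoc, hf, hproj, ← Category.assoc,
      homOfRingHom_comp, hτ, homOfRingHom_ringHomOfHom, hl]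
  have hrange (y : Spec (.of R)) : f y ∈ U := by
    have h1 : quadricι k d (f y) ∈ (projChart k j).opensRange :=
      ⟨_, congr($(hf.trans hproj) y).symm⟩
    rw [opensRange_projChart] at h1
    exact h1
  let f' : Spec (.of R) ⟶ U.toScheme := IsOpenImmersion.lift U.ι f (by
    rintro _ ⟨y, rfl⟩
    exact ⟨⟨f y, hrange y⟩, rfl⟩)
  have hf' : f' ≫ U.ι = f := IsOpenImmersion.lift_fac _ _ _
  have h1 : f' ≫ r = 𝟙 _ := by rw [← cancel_mono f, Category.assoc, hr, hf', Category.id_comp]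
  have h2 : r ≫ f' = 𝟙 _ := by rw [← cancel_mono U.ι, Category.assoc, hf', hr, Category.id_comp]
  have : IsIso f' := ⟨r, h1, h2⟩
  refine ⟨f, hf, hf' ▸ inferInstance, fun x ↦ ⟨?_, fun hx ↦ ⟨r ⟨x, hx⟩, congr($hr ⟨x, hx⟩)⟩⟩⟩
  rintro ⟨y, rfl⟩
  exact hrange y

end Quadric

end

/-! ### The charts `{x ≠ 0}` and `{z ≠ 0}` of the quadric -/

noncomputable section

open Opposite TopologicalSpace AlgebraicGeometry.Scheme

attribute [local instance] MvPolynomial.gradedAlgebra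

section Coordinates

open MvPolynomial HomogeneousLocalization

variable {k : Type u} [Field k] {d : ℕ} {R R' : Type*}

/-- The index of the homogeneous coordinate `u_l`. -/
def quadIndex (l : Fin (d + 1)) : Fin (d + 3 + 1) := l.succ.succ.succ

/-- The homogeneous coordinates `(x : y : z : u₀ : … : u_d)`. -/
def quadCoord (x y z : R) (u : Fin (d + 1) → R) : Fin (d + 3 + 1) → R :=
  Fin.cons x (Fin.cons y (Fin.cons z u))

variable (x y z : R) (u : Fin (d + 1) → R)

@[simp] lemma quadCoord_zero : quadCoord x y z u 0 = x := rfl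

@[simp] lemma quadCoord_one : quadCoord x y z u 1 = y := rfl

@[simp] lemma quadCoord_two : quadCoord x y z u 2 = z := rfl

@[simp] lemma quadCoord_quadIndex (l : Fin (d + 1)) : quadCoord x y z u (quadIndex l) = u l := rfl

lemma forall_quadIndex {P : Fin (d + 3 + 1) → Prop} (h0 : P 0) (h1 : P 1) (h2 : P 2)
    (h3 : ∀ l, P (quadIndex l)) (i : Fin (d + 3 + 1)) : P i :=
  Fin.cases h0 (Fin.cases h1 (Fin.cases h2 h3)) i

end Coordinates

section Chart

open MvPolynomial HomogeneousLocalization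

variable {k : Type u} [Field k] {r : ℕ} {A : Type*} [CommRing A]

/-- The ring homomorphism from the coordinate ring of `𝔸¹ × 𝔸ʳ` given by the values of the
coordinates. -/
def tsEval (c : k →+* A) (t : A) (b : Fin r → A) : TSChart k r →+* A :=
  eval₂Hom (Polynomial.eval₂RingHom c t) b

variable (c : k →+* A) (t : A) (b : Fin r → A)

@[simp] lemma tsEval_algebraMap (s : k) : tsEval c t b (algebraMap k _ s) = c s := by
  refine (eval₂Hom_C _ _ (Polynomial.C s)).trans ?_
  simp

@[simp] lemma tsEval_t : tsEval c t b (C Polynomial.X) = t := by simp [tsEval]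

@[simp] lemma tsEval_X (l : Fin r) : tsEval c t b (X l) = b l := by simp [tsEval]

end Chart

section ProjCoord

open MvPolynomial HomogeneousLocalization

variable {k : Type u} [Field k] {n : ℕ}

@[simp] lemma projCoord_self (j : Fin (n + 1)) : (projCoord j j : ProjAway (X j : ProjPoly k n)) = 1 := by
  apply HomogeneousLocalization.val_injective
  refine (IsLocalization.Away.algebraMap_isUnit (S := Localization.Away (X j : ProjPoly k n))
    (X j : ProjPoly k n)).mul_left_cancel ?_
  rw [algebraMap_mul_val_projCoord, HomogeneousLocalization.val_one, mul_one]

lemma projEval_coord_of_eq_one {R : Type*} [CommRing R] (ρ : k →+* R) (a : Fin (n + 1) → R)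
    {j : Fin (n + 1)} (hj : a j = 1) (h : IsUnit (eval₂Hom ρ a (X j))) (i : Fin (n + 1)) :
    projEval ρ a h (projCoord j i) = a i := by
  rw [← projEval_coord ρ a h i, hj, one_mul]

end ProjCoord

section QuadricChart

open MvPolynomial HomogeneousLocalization

variable (k : Type u) [Field k] (d : ℕ)

/-- The coordinate `t` of `𝔸¹ × 𝔸^{d+1}`. -/
abbrev tsT : TSChart k (d + 1) := C Polynomial.X

/-- The homogeneous coordinates on the chart `{x ≠ 0}` of the quadric. -/
def quadricCoord₀ : Fin (d + 3 + 1) → TSChart k (d + 1) :=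
  quadCoord 1 (tsT k d) (-tsT k d ^ 2) X

/-- The homogeneous coordinates on the chart `{z ≠ 0}` of the quadric. -/
def quadricCoord₁ : Fin (d + 3 + 1) → TSChart k (d + 1) :=
  quadCoord (-tsT k d ^ 2) (-tsT k d) 1 (fun l ↦ -X l)

lemma isUnit_quadricCoord₀ : IsUnit (quadricCoord₀ k d 0) := isUnit_one

lemma isUnit_quadricCoord₁ : IsUnit (quadricCoord₁ k d 2) := isUnit_one

/-- For `x = 1` the equation reads `z = -y²`, so `t = y` and `b_l = u_l` are free coordinates. -/
theorem exists_quadricChart₀ : ∃ f : Spec (.of (TSChart k (d + 1))) ⟶ quadric k d,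
    f ≫ quadricι k d =
      projPoint (algebraMap k _) (quadricCoord₀ k d) 0 (isUnit_quadricCoord₀ k d) ∧
      IsOpenImmersion f ∧ ∀ x, (∃ y, f y = x) ↔
        quadricι k d x ∈ Proj.basicOpen (homogeneousSubmodule (Fin (d + 3 + 1)) k) (X 0) := by
  have hu : IsUnit (eval₂Hom (algebraMap k (TSChart k (d + 1))) (quadricCoord₀ k d) (X 0)) := by
    rw [coe_eval₂Hom, eval₂_X]
    exact isUnit_quadricCoord₀ k d
  have hc := projEval_coord_of_eq_one (algebraMap k (TSChart k (d + 1))) (quadricCoord₀ k d)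
    (j := 0) rfl hu
  refine exists_quadricChart _ _ _ _ hu ?_ ?_ ?_
  · simp [quadricCoord₀]
  · refine Function.RightInverse.surjective (g := tsEval (projAwayC _) (projCoord 0 1)
      fun l ↦ projCoord 0 (quadIndex l)) fun x ↦ ?_
    refine congr($(ringHom_tsChart_ext (φ := (projEval _ _ hu).comp (tsEval _ _ _))
      (ψ := .id _) (fun s ↦ ?_) ?_ fun l ↦ ?_) x)
    · simp only [RingHom.comp_apply, tsEval_algebraMap, projEval_C, RingHom.id_apply]
    · simp [hc]; simp [quadricCoord₀]
    · simp [hc]; simp [quadricCoord₀]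
  · intro A _ φ hφ
    refine ⟨tsEval (φ.comp (projAwayC _)) (φ (projCoord 0 1)) fun l ↦ φ (projCoord 0 (quadIndex l)),
      projAway_ringHom_ext (fun s ↦ by
        simp only [RingHom.comp_apply, projEval_C, tsEval_algebraMap]) ?_⟩
    simp only [RingHom.comp_apply, hc]
    rw [projCoord_self, one_mul] at hφ
    refine forall_quadIndex ?_ ?_ ?_ fun l ↦ ?_
    · simp [quadricCoord₀]
    · simp [quadricCoord₀]
    · simp only [quadricCoord₀, quadCoord_two, map_neg, map_pow, tsEval_t]
      rw [map_add, map_pow] at hφ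
      exact (eq_neg_of_add_eq_zero_left hφ).symm
    · simp [quadricCoord₀]

/-- For `z = 1` the equation reads `x = -y²`, and the free coordinates are `t = -y` and `b_l =
-u_l`; the signs are those required by the gluing with the first chart. -/
theorem exists_quadricChart₁ : ∃ f : Spec (.of (TSChart k (d + 1))) ⟶ quadric k d,
    f ≫ quadricι k d =
      projPoint (algebraMap k _) (quadricCoord₁ k d) 2 (isUnit_quadricCoord₁ k d) ∧
      IsOpenImmersion f ∧ ∀ x, (∃ y, f y = x) ↔
        quadricι k d x ∈ Proj.basicOpen (homogeneousSubmodule (Fin (d + 3 + 1)) k) (X 2) := by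
  have hu : IsUnit (eval₂Hom (algebraMap k (TSChart k (d + 1))) (quadricCoord₁ k d) (X 2)) := by
    rw [coe_eval₂Hom, eval₂_X]
    exact isUnit_quadricCoord₁ k d
  have hc := projEval_coord_of_eq_one (algebraMap k (TSChart k (d + 1))) (quadricCoord₁ k d)
    (j := 2) rfl hu
  refine exists_quadricChart _ _ _ _ hu ?_ ?_ ?_
  · simp only [quadricCoord₁, quadCoord_zero, quadCoord_one, quadCoord_two]
    ring
  · refine Function.RightInverse.surjective (g := tsEval (projAwayC _) (-projCoord 2 1)
      fun l ↦ -projCoord 2 (quadIndex l)) fun x ↦ ?_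
    refine congr($(ringHom_tsChart_ext (φ := (projEval _ _ hu).comp (tsEval _ _ _))
      (ψ := .id _) (fun s ↦ ?_) ?_ fun l ↦ ?_) x)
    · simp only [RingHom.comp_apply, tsEval_algebraMap, projEval_C, RingHom.id_apply]
    · simp [hc]; simp [quadricCoord₁]
    · simp [hc]; simp [quadricCoord₁]
  · intro A _ φ hφ
    refine ⟨tsEval (φ.comp (projAwayC _)) (-φ (projCoord 2 1))
      fun l ↦ -φ (projCoord 2 (quadIndex l)),
      projAway_ringHom_ext (fun s ↦ by
        simp only [RingHom.comp_apply, projEval_C, tsEval_algebraMap]) ?_⟩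
    simp only [RingHom.comp_apply, hc]
    rw [projCoord_self, mul_one] at hφ
    refine forall_quadIndex ?_ ?_ ?_ fun l ↦ ?_
    · simp only [quadricCoord₁, quadCoord_zero, map_neg, map_pow, tsEval_t, neg_sq]
      rw [map_add, map_pow] at hφ
      exact (eq_neg_of_add_eq_zero_left hφ).symm
    · simp [quadricCoord₁]
    · simp [quadricCoord₁]
    · simp [quadricCoord₁]

end QuadricChart

/-! ### Gluing the charts to an open immersion of the total space -/

section Glue

open MvPolynomial HomogeneousLocalization LaurentPolynomial

variable (k : Type u) [Field k] (d : ℕ)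

lemma exists_tsMap₀_eq {r : ℕ} (x : Spec (.of (TSChart k r)))
    (hx : (MvPolynomial.C Polynomial.X : TSChart k r) ∉ x.asIdeal) : ∃ z, tsMap₀ k r z = x := by
  let _ : Algebra (TSChart k r) (TSOverlap k r) := (tsIncl k r).toAlgebra
  have h1 : IsLocalization
      ((Submonoid.powers (Polynomial.X : Polynomial k)).map (MvPolynomial.C (σ := Fin r)))
      (TSOverlap k r) :=
    MvPolynomial.isLocalization (Submonoid.powers (Polynomial.X : Polynomial k)) k[T;T⁻¹]
  have h2 : IsLocalization.Away (MvPolynomial.C Polynomial.X : TSChart k r) (TSOverlap k r) := by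
    rw [Submonoid.map_powers] at h1
    exact h1
  exact (PrimeSpectrum.localization_away_comap_range (TSOverlap k r)
    (MvPolynomial.C Polynomial.X : TSChart k r)).ge hx

/-- The equivalence of the two charts of the quadric on their overlap. -/
lemma tsMap_projPoint :
    tsMap₀ k (d + 1) ≫ projPoint (algebraMap k _) (quadricCoord₀ k d) 0 (isUnit_quadricCoord₀ k d) =
      tsMap₁ k (-2) (d + 1) ≫
        projPoint (algebraMap k _) (quadricCoord₁ k d) 2 (isUnit_quadricCoord₁ k d) := by
  have hT : IsUnit (MvPolynomial.C (T (-2)) : TSOverlap k (d + 1)) :=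
    (isUnit_T (-2)).map MvPolynomial.C
  have h2 (a b : ℤ) : (MvPolynomial.C (T a) * MvPolynomial.C (T b) : TSOverlap k (d + 1)) =
      MvPolynomial.C (T (a + b)) := by rw [← map_mul, ← T_add]
  rw [tsMap₁, Category.assoc, tsMap₀, map_projPoint, map_projPoint, map_projPoint]
  -- The factor is `-t⁻²`: it takes `(1 : t : -t² : b)` to `(-t⁻² : -t⁻¹ : 1 : -t⁻² b)`, the second
  -- parametrisation at `t' = t⁻¹`, `b' = t⁻² b`.
  refine projPoint_eq ?_ _ _ hT.neg ?_
  · refine RingHom.ext fun s ↦ ?_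
    simp only [RingHom.comp_apply, tsIncl_algebraMap, tsTwist_C, LaurentPolynomial.invert_C]
  · refine forall_quadIndex ?_ ?_ ?_ fun l ↦ ?_
    · simp [quadricCoord₀, quadricCoord₁, tsIncl_t, tsTwist_C, sq, h2]
    · simp [quadricCoord₀, quadricCoord₁, tsIncl_t, tsTwist_C, neg_mul, h2]
    · have h3 := h2 (-2) 2
      rw [neg_add_cancel, T_zero, map_one] at h3
      simp only [quadricCoord₀, quadricCoord₁, tsIncl_t, sq, quadCoord_two, map_one, map_neg,
        map_mul, h2, one_add_one_eq_two]
      linear_combination -h3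
    · simp [quadricCoord₀, quadricCoord₁, tsIncl_b, tsTwist_X, neg_mul]

/-- The map is an open immersion on each chart, so only injectivity across the charts needs an
argument. -/
theorem exists_totalSpace_quadric :
    ∃ g : totalSpace k (-2) (d + 1) ⟶ quadric k d, IsOpenImmersion g ∧
      g ≫ quadricStr k d = totalSpaceStr k (-2) (d + 1) ∧
      ∀ x, (∃ y, g y = x) ↔
        quadricι k d x ∈ Proj.basicOpen (homogeneousSubmodule (Fin (d + 3 + 1)) k) (X 0) ∨
        quadricι k d x ∈ Proj.basicOpen (homogeneousSubmodule (Fin (d + 3 + 1)) k) (X 2) := by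
  obtain ⟨f₀, h₀, ho₀, hr₀⟩ := exists_quadricChart₀ k d
  obtain ⟨f₁, h₁, ho₁, hr₁⟩ := exists_quadricChart₁ k d
  have hc : tsMap₀ k (d + 1) ≫ f₀ = tsMap₁ k (-2) (d + 1) ≫ f₁ := by
    rw [← cancel_mono (quadricι k d), Category.assoc, Category.assoc, h₀, h₁, tsMap_projPoint]
  let g : totalSpace k (-2) (d + 1) ⟶ quadric k d := pushout.desc f₀ f₁ hc
  have hg₀ : tsι₀ k (-2) (d + 1) ≫ g = f₀ := pushout.inl_desc _ _ _
  have hg₁ : tsι₁ k (-2) (d + 1) ≫ g = f₁ := pushout.inr_desc _ _ _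
  have hg₀' (y) : g (tsι₀ k (-2) (d + 1) y) = f₀ y := congr($hg₀ y)
  have hg₁' (y) : g (tsι₁ k (-2) (d + 1) y) = f₁ y := congr($hg₁ y)
  -- A point hit by both charts has `z = -t² ≠ 0`, so `t ≠ 0` and the point comes from the overlap.
  have key (x y) (h : f₀ x = f₁ y) : tsι₀ k (-2) (d + 1) x = tsι₁ k (-2) (d + 1) y := by
    have h1 : projPoint (algebraMap k _) (quadricCoord₀ k d) 0 (isUnit_quadricCoord₀ k d) x ∈
        Proj.basicOpen (homogeneousSubmodule (Fin (d + 3 + 1)) k) (X 2) := by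
      rw [← h₀]
      exact (hr₁ (f₀ x)).mp ⟨y, h.symm⟩
    rw [projPoint_mem_basicOpen_iff] at h1
    obtain ⟨z, rfl⟩ := exists_tsMap₀_eq k x fun hx ↦ h1
      (neg_mem (Ideal.pow_mem_of_mem _ hx 2 two_pos))
    have h2 : f₁ (tsMap₁ k (-2) (d + 1) z) = f₁ y := h ▸ congr($hc z).symm
    rw [← f₁.isOpenEmbedding.injective h2]
    exact congr($tsι_condition z)
  have hinj : Function.Injective g := by
    intro x y hxy
    obtain ⟨x, rfl⟩ | ⟨x, rfl⟩ := tsι_jointly_surjective x <;>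
    obtain ⟨y, rfl⟩ | ⟨y, rfl⟩ := tsι_jointly_surjective y <;>
    simp only [hg₀', hg₁'] at hxy
    · rw [f₀.isOpenEmbedding.injective hxy]
    · exact key x y hxy
    · exact (key y x hxy.symm).symm
    · rw [f₁.isOpenEmbedding.injective hxy]
  have : IsOpenImmersion g := by
    refine IsOpenImmersion.of_forall_source_exists g hinj fun x ↦ ?_
    obtain h | h := tsι_jointly_surjective x
    · exact ⟨_, tsι₀ k (-2) (d + 1), inferInstance, h, by rwa [hg₀]⟩
    · exact ⟨_, tsι₁ k (-2) (d + 1), inferInstance, h, by rwa [hg₁]⟩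
  refine ⟨g, this, ?_, fun x ↦ ⟨?_, ?_⟩⟩
  · refine pushout.hom_ext ?_ ?_
    · refine Eq.trans ?_ (tsι₀_str (k := k)).symm
      change tsι₀ k (-2) (d + 1) ≫ g ≫ _ = _
      rw [← quadricι_str, ← Category.assoc, hg₀, ← Category.assoc, h₀, projPoint_str]
      rfl
    · refine Eq.trans ?_ (tsι₁_str (k := k)).symm
      change tsι₁ k (-2) (d + 1) ≫ g ≫ _ = _
      rw [← quadricι_str, ← Category.assoc, hg₁, ← Category.assoc, h₁, projPoint_str]
      rfl
  · rintro ⟨y, rfl⟩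
    obtain ⟨y, rfl⟩ | ⟨y, rfl⟩ := tsι_jointly_surjective y
    · exact .inl ((hr₀ _).mp ⟨y, (hg₀' y).symm⟩)
    · exact .inr ((hr₁ _).mp ⟨y, (hg₁' y).symm⟩)
  · rintro (h | h)
    · obtain ⟨y, rfl⟩ := (hr₀ x).mpr h
      exact ⟨_, hg₀' y⟩
    · obtain ⟨y, rfl⟩ := (hr₁ x).mpr h
      exact ⟨_, hg₁' y⟩

end Glue

end

/-! ### The test rings `K[s]/(s³) → K[s]/(s²) ⊆ K[p, q]/(p², q²)` -/

noncomputable section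

open Opposite TopologicalSpace AlgebraicGeometry.Scheme

section Truncated

open Polynomial TrivSqZeroExt

variable (K : Type u) [Field K]

/-- The ring `K[s]/(s³)`. -/
abbrev TruncCube : Type u := K[X] ⧸ Ideal.span {(X : K[X]) ^ 3}

variable {K} in
lemma dualDual_mul_self : (inr (inr 1) : DualNumber (DualNumber K)) * inr (inr 1) = 0 :=
  inr_mul_inr _ _ _

/-- The ring homomorphism `K[s]/(s³) ⟶ K[p, q]/(p², q²)` with `s ↦ pq`. -/
def truncToDual : TruncCube K →+* DualNumber (DualNumber K) :=
  Ideal.Quotient.lift (Ideal.span {(X : K[X]) ^ 3})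
    (eval₂RingHom ((inlHom (DualNumber K) (DualNumber K)).comp (inlHom K K))
      (inr (inr 1) : DualNumber (DualNumber K))) (by
    intro a ha
    obtain ⟨b, rfl⟩ := Ideal.mem_span_singleton.mp ha
    rw [map_mul, map_pow, coe_eval₂RingHom, eval₂_X, pow_succ, sq, dualDual_mul_self, zero_mul,
      zero_mul])

/-- The element `s` of `K[s]/(s³)`. -/
def truncS : TruncCube K := Ideal.Quotient.mk _ X

/-- The constants of `K[s]/(s³)`. -/
def truncC : K →+* TruncCube K := (Ideal.Quotient.mk _).comp C

lemma truncToDual_S : truncToDual K (truncS K) = inr (inr 1) := by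
  refine (Ideal.Quotient.lift_mk (Ideal.span {(X : K[X]) ^ 3}) _ _).trans ?_
  simp

lemma truncToDual_C (c : K) : truncToDual K (truncC K c) = inl (inl c) := by
  refine (Ideal.Quotient.lift_mk (Ideal.span {(X : K[X]) ^ 3}) _ _).trans ?_
  simp

lemma truncS_pow_three : truncS K ^ 3 = 0 := by
  rw [truncS, ← map_pow]
  exact Ideal.Quotient.eq_zero_iff_mem.mpr (Ideal.mem_span_singleton_self _)

lemma truncS_pow_two_ne_zero : truncS K ^ 2 ≠ 0 := by
  rw [truncS, ← map_pow]
  intro h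
  have h1 := Ideal.mem_span_singleton.mp (Ideal.Quotient.eq_zero_iff_mem.mp h)
  have h2 := natDegree_le_of_dvd h1 (pow_ne_zero 2 X_ne_zero)
  simp at h2

lemma exists_truncCube_eq (w : TruncCube K) :
    ∃ (a b : K) (e : TruncCube K), w = truncC K a + truncC K b * truncS K + truncS K ^ 2 * e := by
  obtain ⟨f, rfl⟩ := Ideal.Quotient.mk_surjective w
  refine ⟨f.coeff 0, f.divX.coeff 0, Ideal.Quotient.mk _ f.divX.divX, ?_⟩
  nth_rw 1 [← divX_mul_X_add f, ← divX_mul_X_add f.divX]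
  simp only [truncC, truncS, RingHom.comp_apply, map_add, map_mul]
  ring

lemma truncToDual_eq (a b : K) (e : TruncCube K) :
    truncToDual K (truncC K a + truncC K b * truncS K + truncS K ^ 2 * e) =
      inl (inl a) + inr (inr b) := by
  have h : (inl (inl b) : DualNumber (DualNumber K)) * inr (inr 1) = inr (inr b) := by
    rw [inl_mul_inr, smul_eq_mul, inl_mul_inr, smul_eq_mul, mul_one]
  simp only [map_add, map_mul, truncToDual_S, truncToDual_C, sq, dualDual_mul_self,
    zero_mul, add_zero, h]

lemma exists_eq_of_mem_ker {w : TruncCube K} (hw : w ∈ RingHom.ker (truncToDual K)) :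
    ∃ e, w = truncS K ^ 2 * e := by
  obtain ⟨a, b, e, rfl⟩ := exists_truncCube_eq K w
  rw [RingHom.mem_ker, truncToDual_eq] at hw
  have ha : a = 0 := by simpa using congr(($hw).fst.fst)
  have hb : b = 0 := by simpa using congr(($hw).snd.snd)
  exact ⟨e, by simp [ha, hb]⟩

/-- Elements of the kernel are multiples of `s²`, and `s⁴ = 0`. -/
lemma isNilpotent_ker_truncToDual : IsNilpotent (RingHom.ker (truncToDual K)) := by
  refine ⟨2, ?_⟩
  refine (pow_two (RingHom.ker (truncToDual K))).trans (le_bot_iff.mp (Ideal.mul_le.mpr ?_))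
  intro a ha b hb
  obtain ⟨e, rfl⟩ := exists_eq_of_mem_ker K ha
  obtain ⟨f, rfl⟩ := exists_eq_of_mem_ker K hb
  rw [Ideal.mem_bot]
  linear_combination truncS K * e * f * truncS_pow_three K

/-- The ring `K[s]/(s²)`. -/
abbrev TruncSq : Type u := TruncCube K ⧸ RingHom.ker (truncToDual K)

/-- The value at the point `s = 0`. -/
def truncSqEval : TruncSq K →+* K :=
  ((fstHom K K K).toRingHom.comp (fstHom (DualNumber K) (DualNumber K) (DualNumber K)).toRingHom).comp
    (RingHom.kerLift (truncToDual K))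

lemma truncSqEval_mk (w : TruncCube K) :
    truncSqEval K (Ideal.Quotient.mk _ w) = (truncToDual K w).fst.fst := rfl

lemma isNilpotent_of_truncSqEval_eq_zero {w : TruncSq K} (hw : truncSqEval K w = 0) :
    IsNilpotent w := by
  obtain ⟨w, rfl⟩ := Ideal.Quotient.mk_surjective w
  obtain ⟨a, b, e, rfl⟩ := exists_truncCube_eq K w
  rw [truncSqEval_mk, truncToDual_eq] at hw
  have ha : a = 0 := by simpa using hw
  refine IsNilpotent.map (f := Ideal.Quotient.mk _) ⟨3, ?_⟩
  rw [ha, map_zero]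
  linear_combination (truncC K b + truncS K * e) ^ 3 * truncS_pow_three K

/-- Elements of value zero are nilpotent, and any other element is a nonzero constant plus a
nilpotent; so there is only one prime. -/
lemma mem_asIdeal_iff_truncSqEval (y : PrimeSpectrum (TruncSq K)) (w : TruncSq K) :
    w ∈ y.asIdeal ↔ truncSqEval K w = 0 := by
  refine ⟨fun h ↦ ?_, fun h ↦ nilpotent_iff_mem_prime.mp
    (isNilpotent_of_truncSqEval_eq_zero K h) y.asIdeal y.isPrime⟩
  by_contra hne
  obtain ⟨w, rfl⟩ := Ideal.Quotient.mk_surjective w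
  set c := truncSqEval K (Ideal.Quotient.mk _ w) with hc
  have h1 : Ideal.Quotient.mk (RingHom.ker (truncToDual K)) (w - truncC K c) ∈ y.asIdeal := by
    refine nilpotent_iff_mem_prime.mp (isNilpotent_of_truncSqEval_eq_zero K ?_) y.asIdeal y.isPrime
    rw [map_sub, map_sub, ← hc, truncSqEval_mk, truncToDual_C]
    simp
  have h2 : Ideal.Quotient.mk (RingHom.ker (truncToDual K)) (truncC K c) ∈ y.asIdeal := by
    have := y.asIdeal.sub_mem h h1
    rwa [← map_sub, sub_sub_cancel] at this
  refine y.isPrime.ne_top (Ideal.eq_top_of_isUnit_mem _ h2 ?_)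
  exact ((isUnit_iff_ne_zero.mpr hne).map (truncC K)).map (Ideal.Quotient.mk _)

/-- The ring `B = K[s]/(s³)` and its quotient `B/I = K[s]/(s²)`, embedded in `K[p, q]/(p², q²)`
by `s ↦ pq`. -/
theorem exists_truncated_ring : ∃ (B : Type u) (_ : CommRing B) (I : Ideal B) (s : B) (γ : K →+* B)
    (ε : B ⧸ I →+* K) (S : Type u) (_ : CommRing S) (ι : B ⧸ I →+* S) (p q : S),
    IsNilpotent I ∧ (∀ w ∈ I, ∃ e, w = s ^ 2 * e) ∧ s ^ 3 = 0 ∧ s ^ 2 ≠ 0 ∧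
    (∀ (y : PrimeSpectrum (B ⧸ I)) w, w ∈ y.asIdeal ↔ ε w = 0) ∧
    (∀ c, ε (Ideal.Quotient.mk I (γ c)) = c) ∧ ε (Ideal.Quotient.mk I s) = 0 ∧
    Function.Injective ι ∧ p * p = 0 ∧ q * q = 0 ∧ ι (Ideal.Quotient.mk I s) = p * q :=
  ⟨TruncCube K, inferInstance, RingHom.ker (truncToDual K), truncS K, truncC K, truncSqEval K,
    DualNumber (DualNumber K), inferInstance, RingHom.kerLift (truncToDual K), inr 1, inl (inr 1),
    isNilpotent_ker_truncToDual K, fun _ ↦ exists_eq_of_mem_ker K, truncS_pow_three K,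
    truncS_pow_two_ne_zero K, mem_asIdeal_iff_truncSqEval K,
    fun c ↦ by rw [truncSqEval_mk, truncToDual_C]; rfl,
    by rw [truncSqEval_mk, truncToDual_S]; rfl, RingHom.kerLift_injective _, inr_mul_inr _ _ _,
    by rw [← inl_mul, inr_mul_inr, inl_zero],
    (truncToDual_S K).trans (by rw [inr_mul_inl, op_smul_eq_mul, one_mul])⟩

end Truncated

/-! ### Infinitesimal lifting and factorisation through closed subschemes -/

section Lift

lemma RingHom.FormallySmooth.exists_lift {R A B : Type u} [CommRing R] [CommRing A] [CommRing B]
    {f : R →+* A} (hf : f.FormallySmooth) (I : Ideal B) (hI : IsNilpotent I) (ρ : R →+* B)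
    (g : A →+* B ⧸ I) (hg : g.comp f = (Ideal.Quotient.mk I).comp ρ) :
    ∃ g' : A →+* B, (Ideal.Quotient.mk I).comp g' = g := by
  algebraize [f, ρ]
  obtain ⟨g', hg'⟩ := Algebra.FormallySmooth.exists_lift I hI
    (⟨g, fun r ↦ congr($hg r)⟩ : A →ₐ[R] B ⧸ I)
  exact ⟨g', RingHom.ext fun a ↦ congr($hg' a)⟩

/-- The preimage of `Y` is a closed subscheme of `Spec R`. The injection `R → S` factors through its
ring of functions, so no nonzero function vanishes on it and it is all of `Spec R`. -/
lemma exists_comp_of_injective {X Y : Scheme.{u}} (i : Y ⟶ X) [IsClosedImmersion i] {R S : Type u}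
    [CommRing R] [CommRing S] (φ : R →+* S) (hφ : Function.Injective φ) (g : Spec (.of R) ⟶ X)
    (h : Spec (.of S) ⟶ Y) (hg : Spec.map (CommRingCat.ofHom φ) ≫ g = h ≫ i) :
    ∃ g' : Spec (.of R) ⟶ Y, g' ≫ i = g := by
  have h1 : Function.Injective (pullback.fst g i).appTop := by
    have h2 := pullback.lift_fst (Spec.map (CommRingCat.ofHom φ)) h hg
    have h3 : (pullback.fst g i).appTop ≫ (pullback.lift _ h hg).appTop =
        (Spec.map (CommRingCat.ofHom φ)).appTop := by
      rw [← Scheme.Hom.comp_appTop, h2]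
    have h4 : Function.Injective (Spec.map (CommRingCat.ofHom φ)).appTop := by
      have h5 := ΓSpecIso_naturality (CommRingCat.ofHom φ)
      intro a b hab
      refine (ConcreteCategory.bijective_of_isIso (ΓSpecIso (.of R)).hom).1 (hφ ?_)
      have h6 (a) : φ ((ΓSpecIso (.of R)).hom a) =
          (ΓSpecIso (.of S)).hom ((Spec.map (CommRingCat.ofHom φ)).appTop a) := congr($h5 a).symm
      rw [h6, h6, hab]
    intro a b hab
    refine h4 ?_
    rw [← h3]
    exact congr((pullback.lift _ h hg).appTop $hab)
  have := IsClosedImmersion.isIso_of_injective_of_isAffine h1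
  exact ⟨inv (pullback.fst g i) ≫ pullback.snd g i, by
    rw [Category.assoc, ← pullback.condition, IsIso.inv_hom_id_assoc]⟩

lemma formallySmooth_ringHomOfHom {R : Type u} [CommRing R] {U : Scheme.{u}} [IsAffine U]
    (f : U ⟶ Spec (.of R)) [Smooth f] : (ringHomOfHom f).FormallySmooth := by
  have h : Smooth (Spec.map (CommRingCat.ofHom (ringHomOfHom f))) := by
    rw [← IsIso.inv_hom_id_assoc U.toSpecΓ (Spec.map _)]
    change Smooth (_ ≫ homOfRingHom (ringHomOfHom f))
    rw [homOfRingHom_ringHomOfHom]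
    infer_instance
  rw [HasRingHomProperty.Spec_iff (P := @Smooth.{u})] at h
  exact h.1

/-- The ring homomorphism `Γ(U) ⟶ R` given by a morphism from `Spec R`. -/
def ringHomOfSpecHom {R : Type u} [CommRing R] {U : Scheme.{u}} (f : Spec (.of R) ⟶ U) :
    Γ(U, ⊤) →+* R :=
  (f.appTop ≫ (ΓSpecIso (.of R)).hom).hom

lemma ringHomOfSpecHom_comp {R S : Type u} [CommRing R] [CommRing S] {U : Scheme.{u}}
    (f : Spec (.of R) ⟶ U) (a : U ⟶ Spec (.of S)) {τ : S →+* R}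
    (h : f ≫ a = Spec.map (CommRingCat.ofHom τ)) :
    (ringHomOfSpecHom f).comp (ringHomOfHom a) = τ := by
  have h1 : (ΓSpecIso (.of S)).inv ≫ a.appTop ≫ f.appTop ≫ (ΓSpecIso (.of R)).hom =
      CommRingCat.ofHom τ := by
    rw [← Scheme.Hom.comp_appTop_assoc, h, ΓSpecIso_naturality, Iso.inv_hom_id_assoc]
  exact congr(($h1).hom)

end Lift

end

/-! ### The smooth locus of the quadric -/

noncomputable section

open Opposite TopologicalSpace AlgebraicGeometry.Scheme

attribute [local instance] MvPolynomial.gradedAlgebra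

section Smooth

lemma smooth_comp_of_opensRange {U X S : Scheme.{u}} (g : U ⟶ X) [IsOpenImmersion g] (s : X ⟶ S)
    [Smooth (g ≫ s)] : Smooth (g.opensRange.ι ≫ s) := by
  have h : g.opensRange.ι = g.isoOpensRange.inv ≫ g := by simp
  rw [h, Category.assoc]
  infer_instance

instance smooth_totalSpaceStr (k : Type u) [Field k] (n : ℤ) (r : ℕ) :
    Smooth (totalSpaceStr k n r) := by
  have h : Smooth (tsChartStr k r) := by
    rw [tsChartStr, HasRingHomProperty.Spec_iff (P := @Smooth.{u})]
    have : Algebra.Smooth k (Polynomial k) := ⟨inferInstance, inferInstance⟩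
    have : Algebra.Smooth (Polynomial k) (TSChart k r) := ⟨inferInstance, inferInstance⟩
    have : Algebra.Smooth k (TSChart k r) := Algebra.Smooth.comp k (Polynomial k) _
    exact RingHom.smooth_algebraMap.mpr this
  have h₀ : Smooth (tsι₀ k n r ≫ totalSpaceStr k n r) := by rwa [tsι₀_str]
  have h₁ : Smooth (tsι₁ k n r ≫ totalSpaceStr k n r) := by rwa [tsι₁_str]
  have : IsZariskiLocalAtSource @Smooth.{u} := HasRingHomProperty.instIsZariskiLocalAtSource
  refine IsZariskiLocalAtSource.of_iSup_eq_top (P := @Smooth.{u})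
    (fun b : Bool ↦ bif b then (tsι₀ k n r).opensRange else (tsι₁ k n r).opensRange) ?_ ?_
  · rw [iSup_bool_eq, eq_top_iff]
    exact fun x _ ↦ tsι_jointly_surjective x
  · rintro (_ | _)
    · exact smooth_comp_of_opensRange (tsι₁ k n r) _
    · exact smooth_comp_of_opensRange (tsι₀ k n r) _

end Smooth

section Quadric

open MvPolynomial HomogeneousLocalization

variable {k : Type u} [Field k] {d : ℕ}

/-- A morphism to the quadric through a point of its vertex, in the direction of `y`. -/
theorem exists_quadric_tangent {K W S : Type u} [Field K] [CommRing W] [CommRing S] (ρ : k →+* K)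
    (γ : K →+* W) (ι : W →+* S) (hι : Function.Injective ι) (s : W) (p q : S) (hp : p * p = 0)
    (hq : q * q = 0) (hs : ι s = p * q) (u : Fin (d + 1) → K) (l : Fin (d + 1))
    (h : IsUnit (quadCoord 0 s 0 (fun m ↦ γ (u m)) (quadIndex l))) (hl : u l = 1) :
    ∃ t : Spec (.of W) ⟶ quadric k d,
      t ≫ quadricι k d = projPoint (γ.comp ρ) _ (quadIndex l) h := by
  -- The cone is parametrised by `(P² : PQ : -Q² : u)` over a polynomial ring, which is reduced, so
  -- this is a morphism to the quadric. At `P = p`, `Q = q` with `p² = q² = 0` only `pq` survives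
  -- among the first three coordinates, and it is the image of `s`.
  let a : Fin (d + 3 + 1) → MvPolynomial (Fin 2) K :=
    quadCoord (X 0 ^ 2) (X 0 * X 1) (-X 1 ^ 2) fun m ↦ C (u m)
  have ha : a (quadIndex l) = 1 := (congrArg C hl).trans (map_one _)
  have hu : IsUnit (eval₂Hom (C.comp ρ) a (X (quadIndex l))) := by
    rw [coe_eval₂Hom, eval₂_X, ha]
    exact isUnit_one
  have hc := projEval_coord_of_eq_one (C.comp ρ) a ha hu
  obtain ⟨e, he⟩ := exists_comp_quadricι
      (projPoint (C.comp ρ) a (quadIndex l) (ha ▸ isUnit_one)) fun y ↦ by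
    refine (projChart_mem_quadricSet_iff (quadIndex l) _).mpr ?_
    change projEval (C.comp ρ) a hu _ ∈ y.asIdeal
    rw [map_add, map_mul, map_pow, hc, hc, hc]
    convert zero_mem y.asIdeal
    simp only [a, quadCoord_zero, quadCoord_one, quadCoord_two]
    ring
  let ω : MvPolynomial (Fin 2) K →+* S := eval₂Hom (ι.comp γ) ![p, q]
  have hω0 : ω (X 0) = p := eval₂_X _ _ _
  have hω1 : ω (X 1) = q := eval₂_X _ _ _
  have hωC (c) : ω (C c) = ι (γ c) := eval₂_C _ _ _
  refine exists_comp_of_injective (quadricι k d) ι hι _ (Spec.map (CommRingCat.ofHom ω) ≫ e) ?_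
  rw [Category.assoc, he, map_projPoint, map_projPoint]
  refine projPoint_eq ?_ _ _ isUnit_one ?_
  · exact RingHom.ext fun c ↦ (hωC _).symm
  · refine forall_quadIndex ?_ ?_ ?_ fun m ↦ ?_ <;> rw [one_mul]
    · simp only [a, quadCoord_zero, map_zero, map_mul, hω0, pow_two, hp]
    · simp only [a, quadCoord_one, map_mul, hω0, hω1, hs]
    · simp only [a, quadCoord_two, map_zero, map_neg, map_mul, hω1, pow_two, hq, neg_zero]
    · simp only [a, quadCoord_quadIndex, hωC]

/-- Infinitesimal lifting fails at the vertex: the tangent vector `x = z = 0`, `y = s` over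
`K[s]/(s²)` lies on the quadric, but no lift of it to `K[s]/(s³)` satisfies the equation. -/
theorem not_mem_smoothOpen_quadric (x : quadric k d)
    (h0 : quadricι k d x ∉ Proj.basicOpen (homogeneousSubmodule (Fin (d + 3 + 1)) k) (X 0))
    (h2 : quadricι k d x ∉ Proj.basicOpen (homogeneousSubmodule (Fin (d + 3 + 1)) k) (X 2)) :
    x ∉ smoothOpen (quadricStr k d) := by
  intro hx
  obtain ⟨j, y, hy⟩ := exists_projChart (quadricι k d x)
  have hmem (i : Fin (d + 3 + 1)) :
      quadricι k d x ∈ Proj.basicOpen (homogeneousSubmodule (Fin (d + 3 + 1)) k) (X i) ↔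
        projCoord j i ∉ y.asIdeal := by
    rw [← hy, projChart_mem_basicOpen_iff j one_pos (isHomogeneous_X _ _), eval₂_X]
  have hc0 : projCoord j 0 ∈ y.asIdeal := not_not.mp ((hmem 0).not.mp h0)
  have hc2 : projCoord j 2 ∈ y.asIdeal := not_not.mp ((hmem 2).not.mp h2)
  have hc1 : projCoord j 1 ∈ y.asIdeal := by
    have h3 : projChart k j y ∈ quadricSet k d := by
      rw [hy]
      exact range_quadricι.le ⟨x, rfl⟩
    rw [projChart_mem_quadricSet_iff, Ideal.add_mem_iff_right _ (Ideal.mul_mem_right _ _ hc0)] at h3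
    exact y.isPrime.mem_of_pow_mem 2 h3
  have hj : projCoord j j ∉ y.asIdeal := by
    rw [projCoord_self]
    exact fun h ↦ y.isPrime.ne_top ((Ideal.eq_top_iff_one _).mpr h)
  obtain ⟨l, rfl⟩ : ∃ l, j = quadIndex l := by
    revert j
    refine forall_quadIndex ?_ ?_ ?_ fun l _ _ _ _ _ _ _ ↦ ⟨l, rfl⟩
    · exact fun y _ _ h _ _ h' ↦ (h' h).elim
    · exact fun y _ _ _ _ h h' ↦ (h' h).elim
    · exact fun y _ _ _ h _ h' ↦ (h' h).elim
  have hprime : y.asIdeal.IsPrime := y.isPrime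
  -- The point of the vertex may be non-closed, so the test rings are taken over its residue field.
  let K : Type u := y.asIdeal.ResidueField
  let χ : ProjAway (X (quadIndex l) : ProjPoly k (d + 3)) →+* K := algebraMap _ _
  have hχ (f) : f ∈ y.asIdeal ↔ χ f = 0 := Ideal.algebraMap_residueField_eq_zero.symm
  obtain ⟨B, _, I, s, γ, ε, S, _, ι, p, q, hI, hIs, hs3, hs2, hε, hεγ, hεs, hι, hp, hq, hpq⟩ :=
    exists_truncated_ring K
  let ρ : k →+* B ⧸ I := ((Ideal.Quotient.mk I).comp γ).comp (χ.comp (projAwayC _))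
  let a : Fin (d + 3 + 1) → B ⧸ I := quadCoord 0 (Ideal.Quotient.mk I s) 0
    (fun m ↦ Ideal.Quotient.mk I (γ (χ (projCoord (quadIndex l) (quadIndex m)))))
  have hal : a (quadIndex l) = 1 := by
    simp only [a, quadCoord_quadIndex, projCoord_self, map_one]
  have hu : IsUnit (a (quadIndex l)) := hal ▸ isUnit_one
  obtain ⟨t, ht⟩ := exists_quadric_tangent (d := d) (χ.comp (projAwayC _))
    ((Ideal.Quotient.mk I).comp γ) ι hι _ p q hp hq hpq
    (fun m ↦ χ (projCoord (quadIndex l) (quadIndex m))) l hu (by rw [projCoord_self, map_one])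
  have hu' : IsUnit (eval₂Hom ρ a (X (quadIndex l))) := by rwa [coe_eval₂Hom, eval₂_X]
  let τ : ProjAway (X (quadIndex l) : ProjPoly k (d + 3)) →+* B ⧸ I := projEval ρ a hu'
  have hτ : t ≫ quadricι k d = Spec.map (CommRingCat.ofHom τ) ≫ projChart k (quadIndex l) := ht
  have hc (i) : τ (projCoord (quadIndex l) i) = a i := projEval_coord_of_eq_one ρ a hal hu' i
  have hτχ : ε.comp τ = χ := by
    refine projAway_ringHom_ext (fun c ↦ ?_) ?_
    · rw [RingHom.comp_apply, projEval_C]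
      exact hεγ _
    · simp only [RingHom.comp_apply, hc]
      refine forall_quadIndex ?_ ?_ ?_ fun m ↦ hεγ _
      · exact (map_zero ε).trans ((hχ _).mp hc0).symm
      · exact hεs.trans ((hχ _).mp hc1).symm
      · exact (map_zero ε).trans ((hχ _).mp hc2).symm
  -- `Spec K[s]/(s²)` is a single point and goes to `x`, so the tangent vector lies in every
  -- neighbourhood of `x`.
  have htx (w : Spec (.of (B ⧸ I))) : t w = x := by
    apply (quadricι k d).isClosedEmbedding.injective
    rw [← hy]
    refine (congr($hτ w)).trans ?_
    change projChart k _ (Spec.map (CommRingCat.ofHom τ) w) = _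
    congr 1
    refine PrimeSpectrum.ext (Ideal.ext fun f ↦ ?_)
    rw [hχ, ← hτχ, RingHom.comp_apply, ← hε w]
    exact Iff.rfl
  obtain ⟨U, hU, hxU⟩ := Opens.mem_sSup.mp hx
  have hxU' : x ∈ U ⊓ quadricι k d ⁻¹ᵁ (projChart k (quadIndex l)).opensRange := ⟨hxU, ⟨y, hy⟩⟩
  obtain ⟨V, hV, hxV, hVU⟩ := exists_isAffineOpen_mem_and_subset hxU'
  have hVaff : IsAffine V.toScheme := hV
  have hsm : Smooth (V.ι ≫ quadricStr k d) := by
    have : Smooth (Scheme.Opens.ι U ≫ quadricStr k d) := hU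
    have hVU' : V ≤ U := fun _ h ↦ (hVU h).1
    rw [← Scheme.homOfLE_ι _ hVU', Category.assoc]
    infer_instance
  let v : V.toScheme ⟶ Spec (.of (ProjAway (X (quadIndex l) : ProjPoly k (d + 3)))) :=
    IsOpenImmersion.lift (projChart k (quadIndex l)) (V.ι ≫ quadricι k d) (by
      rintro _ ⟨z, rfl⟩
      exact (hVU z.2).2)
  have hv : v ≫ projChart k (quadIndex l) = V.ι ≫ quadricι k d := IsOpenImmersion.lift_fac _ _ _
  let t' : Spec (.of (B ⧸ I)) ⟶ V.toScheme := IsOpenImmersion.lift V.ι t (by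
    rintro _ ⟨w, rfl⟩
    rw [htx w]
    exact ⟨⟨x, hxV⟩, rfl⟩)
  have ht' : t' ≫ V.ι = t := IsOpenImmersion.lift_fac _ _ _
  have h1 : (ringHomOfSpecHom t').comp (ringHomOfHom v) = τ := by
    apply ringHomOfSpecHom_comp
    rw [← cancel_mono (projChart k (quadIndex l)), Category.assoc, hv, ← Category.assoc, ht', hτ]
  have h2 : (ringHomOfSpecHom t').comp (ringHomOfHom (V.ι ≫ quadricStr k d)) = ρ := by
    apply ringHomOfSpecHom_comp
    rw [← Category.assoc, ht', ← quadricι_str, ← Category.assoc, ht, projPoint_str]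
  -- Smoothness near `x` lifts the tangent vector from `K[s]/(s²)` to `K[s]/(s³)` over `k`.
  obtain ⟨g, hg⟩ := (formallySmooth_ringHomOfHom (V.ι ≫ quadricStr k d)).exists_lift
    I hI (γ.comp (χ.comp (projAwayC _))) (ringHomOfSpecHom t') h2
  have hrel := ringHomOfHom_quadric_eq_zero v fun z ↦ by
    rw [hv]
    exact range_quadricι.le ⟨V.ι z, rfl⟩
  have hgc (i) : Ideal.Quotient.mk _ (g (ringHomOfHom v (projCoord (quadIndex l) i))) = a i := by
    rw [← hc, ← h1, ← hg]
    rfl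
  obtain ⟨e0, he0⟩ := hIs _ (Ideal.Quotient.eq_zero_iff_mem.mp (hgc 0))
  obtain ⟨e2, he2⟩ := hIs _ (Ideal.Quotient.eq_zero_iff_mem.mp (hgc 2))
  obtain ⟨e1, he1⟩ := hIs _ (Ideal.Quotient.eq.mp (hgc 1))
  have h3 := congrArg g hrel
  rw [map_add, map_mul, map_pow, map_add, map_mul, map_pow, he0, he2, sub_eq_iff_eq_add.mp he1,
    map_zero] at h3
  refine hs2 ?_
  -- With `x = s² e0`, `y = s + s² e1`, `z = s² e2`, the relation `xz + y² = 0` says that `s²` is a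
  -- multiple of `s³ = 0`.
  linear_combination h3 - (s * e0 * e2 + s * e1 ^ 2 + 2 * e1) * hs3

/-- The smooth locus of the quadric is the total space of `𝒪(-2)^{⊕(d+1)}`. -/
theorem exists_iso_smoothOpen_quadric (k : Type u) [Field k] (d : ℕ) :
    ∃ ψ : totalSpace k (-2) (d + 1) ≅ (smoothOpen (quadricStr k d)).toScheme,
      ψ.hom ≫ (smoothOpen (quadricStr k d)).ι ≫ quadricStr k d =
        totalSpaceStr k (-2) (d + 1) := by
  obtain ⟨g, hg, hgs, hr⟩ := exists_totalSpace_quadric k d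
  have h : smoothOpen (quadricStr k d) = g.opensRange := by
    refine le_antisymm (fun x hx ↦ ?_) ?_
    · refine (hr x).mpr ?_
      by_contra! h
      exact not_mem_smoothOpen_quadric x h.1 h.2 hx
    · have : Smooth (g ≫ quadricStr k d) := hgs ▸ inferInstance
      exact le_sSup (smooth_comp_of_opensRange g (quadricStr k d))
  rw [h]
  exact ⟨g.isoOpensRange, by rw [g.isoOpensRange_hom_ι_assoc, hgs]⟩

end Quadric

end

theorem mainTheorem7 (k : Type u) [Field k] [IsAlgClosed k] [CharZero k]
    (d : ℕ) (hd : 0 < d)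
    (Z : Scheme.{u}) (p : Z ⟶ Spec (.of k)) (hZ : IsSmoothProjectiveSurface p)
    (C : Scheme.{u}) [IsIntegral C] [IsLocallyNoetherian C] (i : C ⟶ Z) [IsClosedImmersion i]
    (hC : ∃ φ : C ≅ ProjSp k 1, φ.hom ≫ projSpStr k 1 = i ≫ p)
    (hCC : HasSelfIntersection i (-(d : ℤ))) :
    Parametrises (doubleCurveι i) p (totalSpaceStr k (-2) (d + 1)) ∧
    Parametrises (doubleCurveι i) p ((smoothOpen (quadricStr k d)).ι ≫ quadricStr k d) ∧
    ∃ ψ : totalSpace k (-2) (d + 1) ≅ (smoothOpen (quadricStr k d)).toScheme,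
      ψ.hom ≫ (smoothOpen (quadricStr k d)).ι ≫ quadricStr k d = totalSpaceStr k (-2) (d + 1) := by
  obtain ⟨φ, hφ⟩ := hC
  obtain ⟨ψ, hψ⟩ := exists_iso_smoothOpen_quadric k d
  have h := parametrises_doubleCurve p hZ i φ hφ d hCC
  exact ⟨h, h.of_iso ψ hψ, ψ, hψ⟩
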